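/- **Setting.** Let $q(x,t)$ be a complex-valued potential of the modified Zakharov--Shabat problem $$\Phi_x=X\Phi,\qquad X=ik^2\sigma_3+kQ,\qquad Q=\begin{pmatrix}0&q\\-q^*&0\end{pmatrix},\quad \sigma_3=\mathrm{diag}(1,-1),$$ associated with the derivative nonlinear Schrödinger equation $iq_t+q_{xx}-i(|q|^2q)_x=0$ with zero boundary condition $q\to0$ as $x\to\pm\infty$. Fix a time $t$ and suppose that $q(\cdot,t)$ is $C^1$ and that $q(\cdot,t)$ and $q_x(\cdot,t)$ belong to $L^1(\mathbb R)$ (that $q$ solves the equation is not needed). Put $$\theta(x,t;k)=k^2(x-2k^2t),\quad \Sigma=\mathbb R\cup i\mathbb R,\quad D^{\pm}=\{k\in\mathbb C:\pm\,\mathrm{Re}(k)\,\mathrm{Im}(k)>0\},\quad v_0=\tfrac12\int_{-\infty}^{\infty}|q(y,t)|^2\,dy .$$ For $k\in\Sigma$ let $\Phi_\pm(x,t;k)=e^{i\theta\sigma_3}+o(1)$ as $x\to\pm\infty$ be the Jost solutions, $\Phi_{\pm j}$ the $j$-th column of $\Phi_\pm$, $S(k)=(s_{ij}(k))$ the scattering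 matrix, defined by $\Phi_+=\Phi_-S(k)$, and $\rho=s_{21}/s_{11}$, $\tilde\rho=s_{12}/s_{22}$ the reflection coefficients. The columns $\Phi_{+1},\Phi_{-2}$ extend to $D^+$ and $\Phi_{-1},\Phi_{+2}$ to $D^-$ as the solutions with $e^{-i\theta}\Phi_{+1}\to(1,0)^T$ and $e^{i\theta}\Phi_{+2}\to(0,1)^T$ as $x\to+\infty$, and $e^{-i\theta}\Phi_{-1}\to(1,0)^T$ and $e^{i\theta}\Phi_{-2}\to(0,1)^T$ as $x\to-\infty$; put $s_{11}=\det(\Phi_{+1},\Phi_{-2})$ on $D^+\cup\Sigma$ and $s_{22}=\det(\Phi_{-1},\Phi_{+2})$ on $D^-\cup\Sigma$. Suppose that $s_{11}(k)\neq0$ for all $k\in\Sigma$ (no spectral singularities), and that the zeros of $s_{11}$ in the open first quadrant are exactly the $N\ge0$ distinct points $k_1,\dots,k_N$, each of them a double zero: $s_{11}(k_n)=s_{11}'(k_n)=0\ne s_{11}''(k_n)$. Put $\eta_n=k_n$ and $\eta_{N+n}=-k_n$ for $1\le n\le N$, and $\widehat\eta_n=\eta_n^*$ (complex conjugate) for $1\le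 n\le 2N$. **Claim.** 1. $s_{11}$ (resp. $s_{22}$) is analytic in $D^+$ (resp. $D^-$), continuous on $D^+\cup\Sigma$ (resp. $D^-\cup\Sigma$), and equal on $\Sigma$ to the corresponding diagonal entry of $S$. 2. (Trace formula.) With $\Sigma$ oriented so that $D^+$ lies on its left, and with the principal logarithm, $$s_{11}(k)=\exp\Big(-\frac1{2\pi i}\int_\Sigma\frac{\log[1-\rho(\zeta)\tilde\rho(\zeta)]}{\zeta-k}\,d\zeta\Big)\prod_{n=1}^{2N}\Big(\frac{k-\eta_n}{k-\widehat\eta_n}\Big)^2e^{-iv_0},\qquad k\in D^+,$$ $$s_{22}(k)=\exp\Big(\frac1{2\pi i}\int_\Sigma\frac{\log[1-\rho(\zeta)\tilde\rho(\zeta)]}{\zeta-k}\,d\zeta\Big)\prod_{n=1}^{2N}\Big(\frac{k-\widehat\eta_n}{k-\eta_n}\Big)^2e^{iv_0},\qquad k\in D^-,$$ where the integrals converge absolutely. 3. $s_{11}(0)=1$; and if the potential is reflectionless, i.e. $\rho=\tilde\rho=0$ on $\Sigma$, then there is an integer $j$ such that $$v_0=8\sum_{n=1}^{N}\arg(k_n)+2j\pi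 .$$ -/

import Mathlib

open MeasureTheory Filter Topology Set

noncomputable section

namespace DNLS

/-- The Pauli matrix `σ₃`. -/
def pauli3 : Matrix (Fin 2) (Fin 2) ℂ := !![1, 0; 0, -1]

/-- The potential matrix `Q` of the Lax pair (with `σ = -1`). -/
def potentialMatrix (q : ℝ → ℝ → ℂ) (x t : ℝ) : Matrix (Fin 2) (Fin 2) ℂ :=
  !![0, q x t; -(starRingEnd ℂ) (q x t), 0]

/-- The matrix `X = i k² σ₃ + k Q` of the modified Zakharov-Shabat problem `Φ_x = X Φ`. -/
def laxX (q : ℝ → ℝ → ℂ) (x t : ℝ) (k : ℂ) : Matrix (Fin 2) (Fin 2) ℂ :=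
  (Complex.I * k ^ 2) • pauli3 + k • potentialMatrix q x t

/-- The phase `θ(x,t;k) = k² (x - 2 k² t)`. -/
def theta (x t : ℝ) (k : ℂ) : ℂ := k ^ 2 * ((x : ℂ) - 2 * k ^ 2 * (t : ℂ))

/-- The contour `Σ = ℝ ∪ iℝ`, as a set. -/
def contour : Set ℂ := {k | k.im = 0 ∨ k.re = 0}

/-- `D⁺`, the union of the open first and third quadrants. -/
def Dplus : Set ℂ := {k | 0 < k.re * k.im}

/-- `D⁻`, the union of the open second and fourth quadrants. -/
def Dminus : Set ℂ := {k | k.re * k.im < 0}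

/-- `φ` is the `j`-th column of the Jost solution normalised at the end `l` of the line
(`l = atTop` for `x → +∞`, `l = atBot` for `x → -∞`): it solves `φ_x = X φ`, and the `j`-th column
`e^{∓ iθ} φ` of the modified Jost solution tends to the `j`-th unit vector.

For `k ∈ Σ` the phase is unimodular and the second condition is `Φ = e^{iθσ₃} + o(1)`.
For integrable continuous `q(·,t)` such a `φ` exists and is unique for both columns and both ends
if `k ∈ Σ`; for `(atTop, 0)` and `(atBot, 1)` if `k ∈ D⁺`; for `(atBot, 0)` and `(atTop, 1)` if
`k ∈ D⁻`; there it is the analytic continuation of the Jost column from `Σ`. -/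
structure IsJostColumn (q : ℝ → ℝ → ℂ) (t : ℝ) (k : ℂ) (l : Filter ℝ) (j : Fin 2)
    (φ : ℝ → Fin 2 → ℂ) : Prop where
  ode : ∀ x : ℝ, HasDerivAt φ ((laxX q x t k).mulVec (φ x)) x
  asymptotics : Tendsto (fun x : ℝ => Complex.exp (-(Complex.I * theta x t k * pauli3 j j)) • φ x) l
    (𝓝 (Pi.single j 1))

/-- The `j`-th column of the Jost solution `Φ₊(·,t;k)` (`l = atTop`) or `Φ₋(·,t;k)` (`l = atBot`). -/
def jostColumn (q : ℝ → ℝ → ℂ) (t : ℝ) (k : ℂ) (l : Filter ℝ) (j : Fin 2) : ℝ → Fin 2 → ℂ :=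
  Classical.epsilon (IsJostColumn q t k l j)

/-- The matrix Jost solution `Φ₊(x,t;k)` (`l = atTop`) or `Φ₋(x,t;k)` (`l = atBot`), `k ∈ Σ`. -/
def jostMatrix (q : ℝ → ℝ → ℂ) (t : ℝ) (k : ℂ) (l : Filter ℝ) (x : ℝ) :
    Matrix (Fin 2) (Fin 2) ℂ :=
  Matrix.of fun i j => jostColumn q t k l j x i

/-- The scattering matrix `S(k)`, `k ∈ Σ`: the matrix, constant in `x`, with
`Φ₊(x,t;k) = Φ₋(x,t;k) S(k)`. -/
def scatteringMatrix (q : ℝ → ℝ → ℂ) (t : ℝ) (k : ℂ) : Matrix (Fin 2) (Fin 2) ℂ :=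
  Classical.epsilon fun S => ∀ x : ℝ, jostMatrix q t k atTop x = jostMatrix q t k atBot x * S

/-- The Wronskian `det [φ, ψ]` of two vectors in `ℂ²`. -/
def wronskian (φ ψ : Fin 2 → ℂ) : ℂ := φ 0 * ψ 1 - φ 1 * ψ 0

/-- The scattering coefficient `s₁₁ = Wr(Φ₊₁, Φ₋₂)` on `D⁺ ∪ Σ`
(the Wronskian does not depend on `x` as `X` is traceless). -/
def s11 (q : ℝ → ℝ → ℂ) (t : ℝ) (k : ℂ) : ℂ :=
  wronskian (jostColumn q t k atTop 0 0) (jostColumn q t k atBot 1 0)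

/-- The scattering coefficient `s₂₂ = Wr(Φ₋₁, Φ₊₂)` on `D⁻ ∪ Σ`. -/
def s22 (q : ℝ → ℝ → ℂ) (t : ℝ) (k : ℂ) : ℂ :=
  wronskian (jostColumn q t k atBot 0 0) (jostColumn q t k atTop 1 0)

/-- The reflection coefficient `ρ = s₂₁ / s₁₁` on `Σ`. -/
def rho (q : ℝ → ℝ → ℂ) (t : ℝ) (k : ℂ) : ℂ :=
  scatteringMatrix q t k 1 0 / scatteringMatrix q t k 0 0

/-- The reflection coefficient `ρ̃ = s₁₂ / s₂₂` on `Σ`. -/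
def rhoTilde (q : ℝ → ℝ → ℂ) (t : ℝ) (k : ℂ) : ℂ :=
  scatteringMatrix q t k 0 1 / scatteringMatrix q t k 1 1

/-- The potential is reflectionless: both reflection coefficients vanish on `Σ`. -/
def IsReflectionless (q : ℝ → ℝ → ℂ) (t : ℝ) : Prop :=
  ∀ k ∈ contour, rho q t k = 0 ∧ rhoTilde q t k = 0

/-- `v₀ = ½ ∫ |q(y,t)|² dy`. -/
def v0 (q : ℝ → ℝ → ℂ) (t : ℝ) : ℝ := (1 / 2) * ∫ y : ℝ, ‖q y t‖ ^ 2

/-- `f` is absolutely integrable along `Σ`, i.e. along each of its four rays. -/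
def ContourIntegrable (f : ℂ → ℂ) : Prop :=
  IntegrableOn (fun r : ℝ => f r) (Ioi 0) ∧
  IntegrableOn (fun r : ℝ => f (Complex.I * r)) (Ioi 0) ∧
  IntegrableOn (fun r : ℝ => f (-r)) (Ioi 0) ∧
  IntegrableOn (fun r : ℝ => f (-(Complex.I * r))) (Ioi 0)

/-- `∫_Σ f(ζ) dζ`, with `Σ` oriented so that `D⁺` lies on its left: the real half-axes
are traversed from `0` to `±∞`, the imaginary ones from `±i∞` to `0`. -/
def contourIntegral (f : ℂ → ℂ) : ℂ :=
  (∫ r in Ioi (0 : ℝ), f r) - Complex.I * (∫ r in Ioi (0 : ℝ), f (Complex.I * r))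
    - (∫ r in Ioi (0 : ℝ), f (-r)) + Complex.I * (∫ r in Ioi (0 : ℝ), f (-(Complex.I * r)))

/-- The integrand `log[1 - ρ(ζ) ρ̃(ζ)] / (ζ - k)` of the trace formula
(principal logarithm; `1 - ρ ρ̃` is a positive real number on `Σ`). -/
def traceIntegrand (q : ℝ → ℝ → ℂ) (t : ℝ) (k ζ : ℂ) : ℂ :=
  Complex.log (1 - rho q t ζ * rhoTilde q t ζ) / (ζ - k)

/-- `η₁, …, η_{2N} = k₁, …, k_N, -k₁, …, -k_N`. -/
def eta {N : ℕ} (k : Fin N → ℂ) : Fin (N + N) → ℂ := Fin.append k (fun n => -k n)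

end DNLS

end

/-! Everything is a function of $z=k^2$. Writing $\Phi_{+1}=e^{i\theta}(a,kb)^T$ turns the spectral
problem into $a'=zqb$, $b'=-2izb-\bar q a$, where only $z$ occurs. Its Volterra series from
$+\infty$ has kernel $e^{2iz(y-x)}$, bounded for $\mathrm{Im}\,z\ge0$, so $a,b$ (`jostEven`,
`jostOdd`) are continuous on the closed upper half-plane and holomorphic inside. The column
$\Phi_{-2}$ is the same construction for $x\mapsto\overline{q(-x)}$. Uniqueness of Jost columns, an
energy estimate, identifies these explicit solutions with the chosen ones, so $s_{11}(k)=A(k^2)$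
with $A$ = `transmission`, $A(0)=1$, and $s_{22}(k)=\overline{A(\overline{k^2})}$.

For large $z$ the combination $w=2izb+\bar qa$ makes the system uniformly bounded: the only
coefficient growing with $z$ is dissipative, the others are integrable because $q_x\in L^1$. One
integration by parts then gives $A(z)=e^{-iv_0}+O(1/|z|)$ (`transmission_asymptotics`).

On $\mathbb R$ the function $A$ has no zeros, since every real $x$ is $\zeta^2$ with
$\zeta\in\Sigma$. Its zeros in the upper half-plane are exactly the distinct points $k_n^2$, still
double since squaring is locally biholomorphic there. Dividing by the squared Blaschke factors and
by $e^{-iv_0}$ leaves a zero-free $F\to1$ with $|F|=|A|$ on $\mathbb R$ (`exists_zero_free`). It has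
a logarithm vanishing at infinity, recovered from its boundary real part by the Schwarz formula
(`eq_exp_integral_log_norm`).

The boundary data are the reflection coefficients: $\det S=1$ and $s_{22}=\overline{s_{11}}$ on
$\Sigma$ give $1-\rho\tilde\rho=|s_{11}|^{-2}$. Adding opposite rays of $\Sigma$ and substituting
$x=\zeta^2$ converts the line integral into the contour integral (`contourIntegral_eq`). The formula
for $s_{22}$ follows by conjugation. If the reflection coefficients vanish, then $F\equiv1$, and
evaluation at $0$ gives $e^{iv_0}=\prod(k_n/\bar k_n)^4$, hence the phase constraint. -/

noncomputable section

namespace DNLS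

/-! ### Holomorphic parameter integrals -/

/-- A parametric integral of holomorphic functions with an integrable bound is holomorphic. -/
theorem differentiableOn_integral_of_dominated {α : Type*} [MeasurableSpace α] {μ : Measure α}
    {F : ℂ → α → ℂ} {U : Set ℂ} (hU : IsOpen U) {bound : α → ℝ}
    (hmeas : ∀ z ∈ U, AEStronglyMeasurable (F z) μ)
    (hbound : ∀ᵐ a ∂μ, ∀ z ∈ U, ‖F z a‖ ≤ bound a) (hint : Integrable bound μ)
    (hdiff : ∀ a, DifferentiableOn ℂ (fun z => F z a) U) :
    DifferentiableOn ℂ (fun z => ∫ a, F z a ∂μ) U := by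
  intro z₀ hz₀
  obtain ⟨ε, hε, hball⟩ := Metric.isOpen_iff.1 hU z₀ hz₀
  have hsub : Metric.ball z₀ (ε / 2) ⊆ U :=
    (Metric.ball_subset_ball (by linarith)).trans hball
  have hderiv : ∀ a, ∀ z ∈ U, HasDerivAt (fun z => F z a) (deriv (fun z => F z a) z) z :=
    fun a z hz => ((hdiff a).differentiableAt (hU.mem_nhds hz)).hasDerivAt
  refine DifferentiableAt.differentiableWithinAt (HasDerivAt.differentiableAt
    (hasDerivAt_integral_of_dominated_loc_of_deriv_le (Metric.ball_mem_nhds z₀ (half_pos hε))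
    (F' := fun z a => deriv (fun z => F z a) z) (bound := fun a => bound a / (ε / 4))
    ?_ ?_ ?_ ?_ (hint.div_const _) ?_).2)
  · filter_upwards [hU.mem_nhds hz₀] with z hz using hmeas z hz
  · exact hint.mono' (hmeas z₀ hz₀) (hbound.mono fun a ha => ha z₀ hz₀)
  -- The derivative in the parameter is measurable as a pointwise limit of difference quotients
  -- along a sequence staying in the ball.
  · have hseq : Tendsto (fun n : ℕ => ((ε / 2 / (n + 1) : ℝ) : ℂ)) atTop (𝓝[≠] 0) := by
      refine tendsto_nhdsWithin_iff.2 ⟨?_, Eventually.of_forall fun n => ?_⟩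
      · rw [← Complex.ofReal_zero]
        refine (Complex.continuous_ofReal.tendsto 0).comp ?_
        have := (tendsto_one_div_add_atTop_nhds_zero_nat (𝕜 := ℝ)).const_mul (ε / 2)
        simpa [div_eq_mul_inv] using this
      · simp only [mem_compl_iff, mem_singleton_iff, Complex.ofReal_eq_zero]
        positivity
    refine aestronglyMeasurable_of_tendsto_ae atTop
      (f := fun (n : ℕ) a => ((ε / 2 / (n + 1) : ℝ) : ℂ)⁻¹ •
        (F (z₀ + ((ε / 2 / (n + 1) : ℝ) : ℂ)) a - F z₀ a)) (fun n => ?_)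
      (Eventually.of_forall fun a => ?_)
    · refine AEStronglyMeasurable.const_smul ((hmeas _ (hball ?_)).sub (hmeas _ hz₀))
        (((ε / 2 / (n + 1) : ℝ) : ℂ)⁻¹)
      rw [Metric.mem_ball, dist_eq_norm, add_sub_cancel_left, Complex.norm_real, Real.norm_eq_abs,
        abs_of_pos (by positivity)]
      calc ε / 2 / (n + 1) ≤ ε / 2 := div_le_self (by linarith) (by linarith [n.cast_nonneg (α := ℝ)])
        _ < ε := by linarith
    · exact (hasDerivAt_iff_tendsto_slope_zero.1 (hderiv a z₀ hz₀)).comp hseq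
  -- Cauchy's estimate on a circle of radius `ε / 4` about a point of the ball of radius `ε / 2`;
  -- such circles stay inside the ball of radius `ε`.
  · filter_upwards [hbound] with a ha z hz
    refine Complex.norm_deriv_le_of_forall_mem_sphere_norm_le (by linarith) ?_ ?_
    · refine DifferentiableOn.diffContOnCl_ball (U := U) (hdiff a) ?_
      intro w hw
      refine hball ?_
      rw [Metric.mem_closedBall] at hw
      rw [Metric.mem_ball] at hz ⊢
      linarith [dist_triangle w z z₀]
    · intro w hw
      refine ha w (hball ?_)
      rw [mem_sphere_iff_norm, ← dist_eq_norm] at hw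
      rw [Metric.mem_ball] at hz ⊢
      linarith [dist_triangle w z z₀]
  · exact Eventually.of_forall fun a z hz => hderiv a z (hsub hz)

/-! ### The Volterra operator -/

/-- The Volterra operator with exponential kernel. -/
def volterra (c : ℂ) (g : ℝ → ℂ) (x : ℝ) : ℂ := ∫ y in Ioi x, Complex.exp (c * (y - x)) * g y

theorem norm_exp_mul_le_one {c : ℂ} (hc : c.re ≤ 0) {s : ℝ} (hs : 0 ≤ s) :
    ‖Complex.exp (c * s)‖ ≤ 1 := by
  rw [Complex.norm_exp, Real.exp_le_one_iff, Complex.re_mul_ofReal]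
  exact mul_nonpos_of_nonpos_of_nonneg hc hs

theorem norm_volterra_integrand_le {c : ℂ} (hc : c.re ≤ 0) (g : ℝ → ℂ) {x y : ℝ} (hxy : x ≤ y) :
    ‖Complex.exp (c * (y - x)) * g y‖ ≤ ‖g y‖ := by
  rw [norm_mul, ← Complex.ofReal_sub]
  exact mul_le_of_le_one_left (norm_nonneg _) (norm_exp_mul_le_one hc (sub_nonneg.2 hxy))

theorem integrableOn_volterra_integrand {c : ℂ} (hc : c.re ≤ 0) {g : ℝ → ℂ} {x : ℝ}
    (hg : Continuous g) (hgi : IntegrableOn g (Ioi x)) :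
    IntegrableOn (fun y : ℝ => Complex.exp (c * (y - x)) * g y) (Ioi x) := by
  refine Integrable.mono' hgi.norm (Continuous.aestronglyMeasurable (by fun_prop)) ?_
  filter_upwards [ae_restrict_mem measurableSet_Ioi] with y hy
  exact norm_volterra_integrand_le hc g (le_of_lt hy)

theorem norm_volterra_le {c : ℂ} (hc : c.re ≤ 0) {g : ℝ → ℂ} {x : ℝ} {b : ℝ → ℝ}
    (hb : IntegrableOn b (Ioi x)) (hgb : ∀ y, x < y → ‖g y‖ ≤ b y) :
    ‖volterra c g x‖ ≤ ∫ y in Ioi x, b y := by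
  refine norm_integral_le_of_norm_le hb ?_
  filter_upwards [ae_restrict_mem measurableSet_Ioi] with y hy
  exact (norm_volterra_integrand_le hc g (le_of_lt hy)).trans (hgb y hy)

theorem hasDerivAt_integral_Ioi {h : ℝ → ℂ} (hh : Continuous h)
    (hi : ∀ x, IntegrableOn h (Ioi x)) (x : ℝ) :
    HasDerivAt (fun x => ∫ y in Ioi x, h y) (-h x) x := by
  have h1 : (fun x => ∫ y in Ioi x, h y) = fun x => (∫ y in Ioi 0, h y) - ∫ y in (0 : ℝ)..x, h y := by
    funext x
    rw [← intervalIntegral.integral_Ioi_sub_Ioi' (hi 0) (hi x)]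
    ring
  rw [h1]
  simpa using (hh.integral_hasStrictDerivAt 0 x).hasDerivAt.const_sub (∫ y in Ioi 0, h y)

/-- The kernel factors as $e^{-cx}e^{cy}$, so the product rule applies to an exponential times a
tail integral. The weight $e^{cy}$ does no harm to integrability on a right half-line because
$\mathrm{Re}\,c\le0$. -/
theorem hasDerivAt_volterra {c : ℂ} (hc : c.re ≤ 0) {g : ℝ → ℂ}
    (hg : Continuous g) (hgi : Integrable g) (x : ℝ) :
    HasDerivAt (volterra c g) (-c * volterra c g x - g x) x := by
  have hint : ∀ x : ℝ, IntegrableOn (fun y : ℝ => Complex.exp (c * y) * g y) (Ioi x) := by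
    intro x
    have := (integrableOn_volterra_integrand hc hg (hgi.integrableOn (s := Ioi x))).const_mul
      (Complex.exp (c * x))
    refine this.congr (Eventually.of_forall fun y => ?_)
    simp only
    rw [← mul_assoc, ← Complex.exp_add]
    ring_nf
  have heq : volterra c g = fun x : ℝ => Complex.exp (-c * x) *
      ∫ y in Ioi x, Complex.exp (c * y) * g y := by
    funext x
    rw [volterra, ← integral_const_mul]
    refine integral_congr_ae (Eventually.of_forall fun y => ?_)
    simp only
    rw [← mul_assoc, ← Complex.exp_add]
    ring_nf
  have h1 : HasDerivAt (fun x : ℝ => Complex.exp (-c * x)) (Complex.exp (-c * x) * (-c * 1)) x :=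
    (((Complex.ofRealCLM.hasDerivAt (x := x)).const_mul (-c))).cexp
  have h2 := h1.mul (hasDerivAt_integral_Ioi (by fun_prop) hint x)
  rw [heq]
  refine h2.congr_deriv ?_
  have : Complex.exp (-c * x) * Complex.exp (c * x) = 1 := by
    rw [← Complex.exp_add]; simp
  linear_combination (-(g x)) * this

theorem continuous_volterra {c : ℂ} (hc : c.re ≤ 0) {g : ℝ → ℂ}
    (hg : Continuous g) (hgi : Integrable g) : Continuous (volterra c g) :=
  continuous_iff_continuousAt.2 fun x => (hasDerivAt_volterra hc hg hgi x).continuousAt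

theorem continuousOn_volterra_param {S : Set ℂ} {c : ℂ → ℂ} {g : ℂ → ℝ → ℂ} {b : ℝ → ℝ} {x : ℝ}
    (hc : ∀ z ∈ S, (c z).re ≤ 0) (hcc : ContinuousOn c S) (hg : ∀ z ∈ S, Continuous (g z))
    (hb : IntegrableOn b (Ioi x)) (hgb : ∀ z ∈ S, ∀ y, ‖g z y‖ ≤ b y)
    (hgc : ∀ y, ContinuousOn (fun z => g z y) S) :
    ContinuousOn (fun z => volterra (c z) (g z) x) S := by
  refine continuousOn_of_dominated (bound := b) (fun z hz => ?_) (fun z hz => ?_) hb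
    (Eventually.of_forall fun y => ?_)
  · have := hg z hz
    exact Continuous.aestronglyMeasurable (by fun_prop)
  · filter_upwards [ae_restrict_mem measurableSet_Ioi] with y hy
    exact (norm_volterra_integrand_le (hc z hz) _ (le_of_lt hy)).trans (hgb z hz y)
  · exact (hcc.mul continuousOn_const).cexp.mul (hgc y)

theorem differentiableOn_volterra_param {U : Set ℂ} (hU : IsOpen U) {c : ℂ → ℂ} {g : ℂ → ℝ → ℂ}
    {b : ℝ → ℝ} {x : ℝ}
    (hc : ∀ z ∈ U, (c z).re ≤ 0) (hcd : DifferentiableOn ℂ c U) (hg : ∀ z ∈ U, Continuous (g z))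
    (hb : IntegrableOn b (Ioi x)) (hgb : ∀ z ∈ U, ∀ y, ‖g z y‖ ≤ b y)
    (hgd : ∀ y, DifferentiableOn ℂ (fun z => g z y) U) :
    DifferentiableOn ℂ (fun z => volterra (c z) (g z) x) U := by
  refine differentiableOn_integral_of_dominated hU (bound := b) (fun z hz => ?_) ?_ hb
    (fun y => ?_)
  · have := hg z hz
    exact Continuous.aestronglyMeasurable (by fun_prop)
  · filter_upwards [ae_restrict_mem measurableSet_Ioi] with y hy z hz
    exact (norm_volterra_integrand_le (hc z hz) _ (le_of_lt hy)).trans (hgb z hz y)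
  · exact (hcd.mul (differentiableOn_const _)).cexp.mul (hgd y)

/-! ### Tail mass and the factorial gain -/

/-- The mass `∫_x^∞ |q|` of `q` to the right of `x`. -/
def tailMass (q : ℝ → ℂ) (x : ℝ) : ℝ := ∫ y in Ioi x, ‖q y‖

theorem tailMass_nonneg (q : ℝ → ℂ) (x : ℝ) : 0 ≤ tailMass q x :=
  integral_nonneg fun _ => norm_nonneg _

theorem tailMass_le {q : ℝ → ℂ} (hi : Integrable q) (x : ℝ) : tailMass q x ≤ ∫ y, ‖q y‖ :=
  setIntegral_le_integral hi.norm (Eventually.of_forall fun _ => norm_nonneg _)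

theorem tendsto_tailMass_atTop (q : ℝ → ℂ) :
    Tendsto (tailMass q) atTop (𝓝 0) :=
  tendsto_integral_Ioi_zero tendsto_id

theorem hasDerivAt_tailMass {q : ℝ → ℂ} (hc : Continuous q) (hi : Integrable q) (x : ℝ) :
    HasDerivAt (tailMass q) (-‖q x‖) x := by
  have h1 : tailMass q = fun x => (∫ y in Ioi 0, ‖q y‖) - ∫ y in (0 : ℝ)..x, ‖q y‖ := by
    funext x
    rw [← intervalIntegral.integral_Ioi_sub_Ioi' hi.norm.integrableOn hi.norm.integrableOn,
      tailMass]
    ring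
  rw [h1]
  simpa using (hc.norm.integral_hasStrictDerivAt 0 x).hasDerivAt.const_sub (∫ y in Ioi 0, ‖q y‖)

theorem integrable_norm_mul_tailMass_pow {q : ℝ → ℂ} (hc : Continuous q) (hi : Integrable q)
    (n : ℕ) : Integrable fun y => ‖q y‖ * tailMass q y ^ n := by
  have hcont : Continuous (tailMass q) :=
    continuous_iff_continuousAt.2 fun x => (hasDerivAt_tailMass hc hi x).continuousAt
  refine (hi.norm.mul_const ((∫ y, ‖q y‖) ^ n)).mono'
    (Continuous.aestronglyMeasurable (by fun_prop)) (Eventually.of_forall fun y => ?_)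
  have := tailMass_nonneg q y
  rw [Real.norm_of_nonneg (by positivity)]
  gcongr
  exact tailMass_le hi y

/-- Since `tailMass q` has derivative $-|q|$ and vanishes at $+\infty$, the integrand has an
explicit primitive. This is the source of the factorials in the Neumann series. -/
theorem integral_norm_mul_tailMass_pow {q : ℝ → ℂ} (hc : Continuous q) (hi : Integrable q)
    (n : ℕ) (x : ℝ) :
    ∫ y in Ioi x, ‖q y‖ * tailMass q y ^ n = tailMass q x ^ (n + 1) / (n + 1) := by
  have hd : ∀ y ∈ Ici x, HasDerivAt (fun y => -(tailMass q y ^ (n + 1) / (n + 1)))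
      (‖q y‖ * tailMass q y ^ n) y := by
    intro y _
    refine (((hasDerivAt_tailMass hc hi y).pow (n + 1)).div_const ((n : ℝ) + 1)).neg.congr_deriv ?_
    have : (n : ℝ) + 1 ≠ 0 := by positivity
    push_cast
    field_simp
  have ht : Tendsto (fun y => -(tailMass q y ^ (n + 1) / ((n : ℝ) + 1))) atTop (𝓝 0) := by
    have := (((tendsto_tailMass_atTop q).pow (n + 1)).div_const ((n : ℝ) + 1)).neg
    simpa using this
  rw [integral_Ioi_of_hasDerivAt_of_tendsto' hd
    (integrable_norm_mul_tailMass_pow hc hi n).integrableOn ht]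
  ring

/-- A bound by a power of `tailMass q` is improved by `volterra` with weight `q`. -/
theorem norm_volterra_mul_le {q p : ℝ → ℂ} (hc : Continuous q) (hi : Integrable q)
    (hpq : ∀ y, ‖p y‖ = ‖q y‖) {c : ℂ} (hcr : c.re ≤ 0) {f : ℝ → ℂ} {M : ℝ} {n : ℕ}
    (hf : ∀ y, ‖f y‖ ≤ M * (tailMass q y ^ n / n.factorial)) (x : ℝ) :
    ‖volterra c (fun y => p y * f y) x‖ ≤ M * (tailMass q x ^ (n + 1) / (n + 1).factorial) := by
  have hb : Integrable fun y => M / n.factorial * (‖q y‖ * tailMass q y ^ n) :=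
    (integrable_norm_mul_tailMass_pow hc hi n).const_mul _
  refine (norm_volterra_le hcr hb.integrableOn fun y _ => ?_).trans (le_of_eq ?_)
  · rw [norm_mul, hpq]
    calc ‖q y‖ * ‖f y‖ ≤ ‖q y‖ * (M * (tailMass q y ^ n / n.factorial)) := by
          gcongr; exact hf y
      _ = _ := by ring
  · rw [integral_const_mul, integral_norm_mul_tailMass_pow hc hi, Nat.factorial_succ]
    push_cast
    field_simp

/-! ### The Neumann series of the Jost solution -/

/-- The even terms of the Neumann series of the Jost solution, as a function of `z = k²`. -/
def neumannEven (q : ℝ → ℂ) (z : ℂ) : ℕ → ℝ → ℂ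
  | 0 => fun _ => 1
  | n + 1 => fun x => -z * volterra 0 (fun y => q y *
      volterra (2 * Complex.I * z) (fun s => (starRingEnd ℂ) (q s) * neumannEven q z n s) y) x

/-- The odd terms of the Neumann series of the Jost solution, as a function of `z = k²`. -/
def neumannOdd (q : ℝ → ℂ) (z : ℂ) (n : ℕ) : ℝ → ℂ :=
  volterra (2 * Complex.I * z) fun s => (starRingEnd ℂ) (q s) * neumannEven q z n s

/-- The first component of the modified Jost solution normalised at `+∞`. -/
def jostEven (q : ℝ → ℂ) (z : ℂ) (x : ℝ) : ℂ := ∑' n, neumannEven q z n x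

/-- The second component of the modified Jost solution normalised at `+∞`, divided by `k`. -/
def jostOdd (q : ℝ → ℂ) (z : ℂ) (x : ℝ) : ℂ := ∑' n, neumannOdd q z n x

theorem neumannEven_succ (q : ℝ → ℂ) (z : ℂ) (n : ℕ) (x : ℝ) :
    neumannEven q z (n + 1) x = -z * volterra 0 (fun y => q y * neumannOdd q z n y) x := rfl

theorem re_two_I_mul_nonpos {z : ℂ} (hz : 0 ≤ z.im) : (2 * Complex.I * z).re ≤ 0 := by
  simp; linarith

section

variable {q : ℝ → ℂ}

theorem norm_neumannOdd_le_of (hc : Continuous q) (hi : Integrable q) {z : ℂ} (hz : 0 ≤ z.im)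
    {n m : ℕ} {M : ℝ}
    (h : ∀ x, ‖neumannEven q z n x‖ ≤ M * (tailMass q x ^ m / m.factorial)) (x : ℝ) :
    ‖neumannOdd q z n x‖ ≤ M * (tailMass q x ^ (m + 1) / (m + 1).factorial) :=
  norm_volterra_mul_le hc hi (by simp) (re_two_I_mul_nonpos hz) h x

/-- An even step consists of two Volterra integrations and one factor $z$, so the tail mass appears
to the power $2n$, divided by $(2n)!$. -/
theorem norm_neumannEven_le (hc : Continuous q) (hi : Integrable q) {z : ℂ} (hz : 0 ≤ z.im)
    (n : ℕ) (x : ℝ) :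
    ‖neumannEven q z n x‖ ≤ ‖z‖ ^ n * (tailMass q x ^ (2 * n) / (2 * n).factorial) := by
  induction n generalizing x with
  | zero => simp [neumannEven]
  | succ n ih =>
    rw [neumannEven_succ, norm_mul, norm_neg, pow_succ' ‖z‖, mul_assoc]
    gcongr
    exact norm_volterra_mul_le hc hi (fun _ => rfl) le_rfl (norm_neumannOdd_le_of hc hi hz ih) x

theorem norm_neumannOdd_le (hc : Continuous q) (hi : Integrable q) {z : ℂ} (hz : 0 ≤ z.im)
    (n : ℕ) (x : ℝ) :
    ‖neumannOdd q z n x‖ ≤ ‖z‖ ^ n * (tailMass q x ^ (2 * n + 1) / (2 * n + 1).factorial) :=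
  norm_neumannOdd_le_of hc hi hz (norm_neumannEven_le hc hi hz n) x

/-- A summable bound of the terms of the Neumann series for `‖z‖ ≤ R`. -/
def neumannBound (q : ℝ → ℂ) (R : ℝ) (n : ℕ) : ℝ :=
  (1 + ∫ y, ‖q y‖) * ((R * (∫ y, ‖q y‖) ^ 2) ^ n / n.factorial)

theorem summable_neumannBound (q : ℝ → ℂ) (R : ℝ) : Summable (neumannBound q R) :=
  (Real.summable_pow_div_factorial _).mul_left _

theorem norm_neumannEven_le_bound (hc : Continuous q) (hi : Integrable q) {z : ℂ}
    (hz : 0 ≤ z.im) {R : ℝ} (hR : ‖z‖ ≤ R) (n : ℕ) (x : ℝ) :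
    ‖neumannEven q z n x‖ ≤ neumannBound q R n := by
  have hK : 0 ≤ ∫ y, ‖q y‖ := integral_nonneg fun _ => norm_nonneg _
  have hR0 : 0 ≤ R := (norm_nonneg z).trans hR
  calc ‖neumannEven q z n x‖ ≤ ‖z‖ ^ n * (tailMass q x ^ (2 * n) / (2 * n).factorial) :=
        norm_neumannEven_le hc hi hz n x
    -- The factorial $(2n)!$ is weakened to $n!$ so that even and odd terms share one exponential
    -- series as majorant.
    _ ≤ R ^ n * ((∫ y, ‖q y‖) ^ (2 * n) / n.factorial) := by
        have h0 := tailMass_nonneg q x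
        have h1 := tailMass_le hi x
        gcongr
        omega
    _ = 1 * ((R * (∫ y, ‖q y‖) ^ 2) ^ n / n.factorial) := by rw [mul_pow, ← pow_mul]; ring
    _ ≤ neumannBound q R n := by
        unfold neumannBound
        gcongr
        linarith

theorem norm_neumannOdd_le_bound (hc : Continuous q) (hi : Integrable q) {z : ℂ}
    (hz : 0 ≤ z.im) {R : ℝ} (hR : ‖z‖ ≤ R) (n : ℕ) (x : ℝ) :
    ‖neumannOdd q z n x‖ ≤ neumannBound q R n := by
  have hK : 0 ≤ ∫ y, ‖q y‖ := integral_nonneg fun _ => norm_nonneg _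
  have hR0 : 0 ≤ R := (norm_nonneg z).trans hR
  calc ‖neumannOdd q z n x‖ ≤ ‖z‖ ^ n * (tailMass q x ^ (2 * n + 1) / (2 * n + 1).factorial) :=
        norm_neumannOdd_le hc hi hz n x
    _ ≤ R ^ n * ((∫ y, ‖q y‖) ^ (2 * n + 1) / n.factorial) := by
        have h0 := tailMass_nonneg q x
        have h1 := tailMass_le hi x
        gcongr
        omega
    _ = (∫ y, ‖q y‖) * ((R * (∫ y, ‖q y‖) ^ 2) ^ n / n.factorial) := by
        rw [mul_pow, ← pow_mul, pow_succ]; ring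
    _ ≤ neumannBound q R n := by
        unfold neumannBound
        gcongr
        linarith

theorem continuous_neumannEven (hc : Continuous q) (hi : Integrable q) {z : ℂ} (hz : 0 ≤ z.im)
    (n : ℕ) : Continuous (neumannEven q z n) := by
  have hstep : ∀ {c : ℂ} {p f : ℝ → ℂ} {M : ℝ}, c.re ≤ 0 → Continuous p → (∀ y, ‖p y‖ = ‖q y‖) →
      Continuous f → (∀ y, ‖f y‖ ≤ M) → Continuous (volterra c fun y => p y * f y) := by
    intro c p f M hcr hp hpq hf hM
    refine continuous_volterra hcr (hp.mul hf) ?_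
    refine (hi.norm.mul_const M).mono' (hp.mul hf).aestronglyMeasurable
      (Eventually.of_forall fun y => ?_)
    rw [norm_mul, hpq]
    gcongr
    exact hM y
  induction n with
  | zero => exact continuous_const
  | succ n ih =>
    have h1 : Continuous (neumannOdd q z n) :=
      hstep (re_two_I_mul_nonpos hz) (Complex.continuous_conj.comp hc) (by simp) ih
        (norm_neumannEven_le_bound hc hi hz le_rfl n)
    exact continuous_const.mul (hstep le_rfl hc (fun _ => rfl) h1
      (norm_neumannOdd_le_bound hc hi hz le_rfl n))

theorem hasDerivAt_neumannOdd (hc : Continuous q) (hi : Integrable q) {z : ℂ} (hz : 0 ≤ z.im)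
    (n : ℕ) (x : ℝ) : HasDerivAt (neumannOdd q z n)
      (-(2 * Complex.I * z) * neumannOdd q z n x - (starRingEnd ℂ) (q x) * neumannEven q z n x)
      x := by
  have h := continuous_neumannEven hc hi hz n
  have hcc : Continuous fun s => (starRingEnd ℂ) (q s) * neumannEven q z n s :=
    (Complex.continuous_conj.comp hc).mul h
  refine hasDerivAt_volterra (re_two_I_mul_nonpos hz) hcc ?_ x
  refine (hi.norm.mul_const (neumannBound q ‖z‖ n)).mono' hcc.aestronglyMeasurable
    (Eventually.of_forall fun y => ?_)
  rw [norm_mul, RCLike.norm_conj]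
  gcongr
  exact norm_neumannEven_le_bound hc hi hz le_rfl n y

theorem continuous_neumannOdd (hc : Continuous q) (hi : Integrable q) {z : ℂ} (hz : 0 ≤ z.im)
    (n : ℕ) : Continuous (neumannOdd q z n) :=
  continuous_iff_continuousAt.2 fun x => (hasDerivAt_neumannOdd hc hi hz n x).continuousAt

theorem integrable_mul_neumannOdd (hc : Continuous q) (hi : Integrable q) {z : ℂ}
    (hz : 0 ≤ z.im) (n : ℕ) : Integrable fun y => q y * neumannOdd q z n y := by
  refine (hi.norm.mul_const (neumannBound q ‖z‖ n)).mono'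
    (hc.mul (continuous_neumannOdd hc hi hz n)).aestronglyMeasurable
    (Eventually.of_forall fun y => ?_)
  rw [norm_mul]
  gcongr
  exact norm_neumannOdd_le_bound hc hi hz le_rfl n y

theorem hasDerivAt_neumannEven_succ (hc : Continuous q) (hi : Integrable q) {z : ℂ}
    (hz : 0 ≤ z.im) (n : ℕ) (x : ℝ) :
    HasDerivAt (neumannEven q z (n + 1)) (z * (q x * neumannOdd q z n x)) x := by
  have h := (hasDerivAt_volterra (c := 0) le_rfl (hc.mul (continuous_neumannOdd hc hi hz n))
    (integrable_mul_neumannOdd hc hi hz n) x).const_mul (-z)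
  refine h.congr_deriv ?_
  simp

theorem summable_neumannEven (hc : Continuous q) (hi : Integrable q) {z : ℂ} (hz : 0 ≤ z.im)
    (x : ℝ) : Summable fun n => neumannEven q z n x :=
  .of_norm_bounded (summable_neumannBound q ‖z‖)
    fun n => norm_neumannEven_le_bound hc hi hz le_rfl n x

theorem summable_neumannOdd (hc : Continuous q) (hi : Integrable q) {z : ℂ} (hz : 0 ≤ z.im)
    (x : ℝ) : Summable fun n => neumannOdd q z n x :=
  .of_norm_bounded (summable_neumannBound q ‖z‖)
    fun n => norm_neumannOdd_le_bound hc hi hz le_rfl n x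

/-- Termwise differentiation of the series; the sup bound on $q$ provides a summable majorant of the
derivatives that is uniform in $x$. -/
theorem hasDerivAt_jostEven (hc : Continuous q) (hi : Integrable q) {M : ℝ}
    (hM : ∀ x, ‖q x‖ ≤ M) {z : ℂ} (hz : 0 ≤ z.im) (x : ℝ) :
    HasDerivAt (jostEven q z) (z * (q x * jostOdd q z x)) x := by
  have heq : jostEven q z = fun x => 1 + ∑' n, neumannEven q z (n + 1) x := by
    funext x
    rw [jostEven, (summable_neumannEven hc hi hz x).tsum_eq_zero_add]
    rfl
  rw [heq]
  have hM0 : 0 ≤ M := (norm_nonneg _).trans (hM 0)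
  have h := hasDerivAt_tsum (g := fun n x => neumannEven q z (n + 1) x)
    (g' := fun n x => z * (q x * neumannOdd q z n x))
    (u := fun n => ‖z‖ * (M * neumannBound q ‖z‖ n)) (y₀ := x)
    (((summable_neumannBound q ‖z‖).mul_left _).mul_left _)
    (fun n y => hasDerivAt_neumannEven_succ hc hi hz n y) (fun n y => ?_)
    ((summable_nat_add_iff 1).2 (summable_neumannEven hc hi hz x)) x
  · refine (h.const_add 1).congr_deriv ?_
    rw [tsum_mul_left, tsum_mul_left, jostOdd]
  · rw [norm_mul, norm_mul]
    gcongr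
    · exact hM y
    · exact norm_neumannOdd_le_bound hc hi hz le_rfl n y

theorem hasDerivAt_jostOdd (hc : Continuous q) (hi : Integrable q) {M : ℝ}
    (hM : ∀ x, ‖q x‖ ≤ M) {z : ℂ} (hz : 0 ≤ z.im) (x : ℝ) :
    HasDerivAt (jostOdd q z)
      (-(2 * Complex.I * z) * jostOdd q z x - (starRingEnd ℂ) (q x) * jostEven q z x) x := by
  have hM0 : 0 ≤ M := (norm_nonneg _).trans (hM 0)
  have h := hasDerivAt_tsum (g := fun n x => neumannOdd q z n x)
    (g' := fun n x => -(2 * Complex.I * z) * neumannOdd q z n x -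
      (starRingEnd ℂ) (q x) * neumannEven q z n x)
    (u := fun n => ‖2 * Complex.I * z‖ * neumannBound q ‖z‖ n + M * neumannBound q ‖z‖ n) (y₀ := x)
    (((summable_neumannBound q ‖z‖).mul_left _).add ((summable_neumannBound q ‖z‖).mul_left _))
    (fun n y => hasDerivAt_neumannOdd hc hi hz n y) (fun n y => ?_)
    (summable_neumannOdd hc hi hz x) x
  · refine h.congr_deriv ?_
    rw [((summable_neumannOdd hc hi hz x).mul_left _).tsum_sub
      ((summable_neumannEven hc hi hz x).mul_left _), tsum_mul_left, tsum_mul_left, jostOdd,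
      jostEven]
  · refine (norm_sub_le _ _).trans ?_
    rw [norm_mul, norm_mul, norm_neg, RCLike.norm_conj]
    gcongr
    · exact norm_neumannOdd_le_bound hc hi hz le_rfl n y
    · exact hM y
    · exact norm_neumannEven_le_bound hc hi hz le_rfl n y

/-- Dominated convergence in the series: every term with $n\ge1$ carries a positive power of the
tail mass, so only the constant term survives. -/
theorem tendsto_jostEven_atTop (hc : Continuous q) (hi : Integrable q) {z : ℂ} (hz : 0 ≤ z.im) :
    Tendsto (jostEven q z) atTop (𝓝 1) := by
  have h := tendsto_tsum_of_dominated_convergence (𝓕 := atTop)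
    (f := fun x n => neumannEven q z n x) (g := fun n => if n = 0 then 1 else 0)
    (summable_neumannBound q ‖z‖) (fun n => ?_)
    (Eventually.of_forall fun x n => norm_neumannEven_le_bound hc hi hz le_rfl n x)
  · rw [tsum_ite_eq] at h
    exact h
  · rcases Nat.eq_zero_or_pos n with rfl | hn
    · simp [neumannEven]
    · rw [if_neg hn.ne']
      refine squeeze_zero_norm (norm_neumannEven_le hc hi hz n) ?_
      have := (((tendsto_tailMass_atTop q).pow (2 * n)).div_const
        ((2 * n).factorial : ℝ)).const_mul (‖z‖ ^ n)
      simpa [hn.ne'] using this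

theorem tendsto_jostOdd_atTop (hc : Continuous q) (hi : Integrable q) {z : ℂ} (hz : 0 ≤ z.im) :
    Tendsto (jostOdd q z) atTop (𝓝 0) := by
  have h := tendsto_tsum_of_dominated_convergence (𝓕 := atTop)
    (f := fun x n => neumannOdd q z n x) (g := fun _ => 0)
    (summable_neumannBound q ‖z‖) (fun n => ?_)
    (Eventually.of_forall fun x n => norm_neumannOdd_le_bound hc hi hz le_rfl n x)
  · rw [tsum_zero] at h
    exact h
  · refine squeeze_zero_norm (norm_neumannOdd_le hc hi hz n) ?_
    have := (((tendsto_tailMass_atTop q).pow (2 * n + 1)).div_const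
      ((2 * n + 1).factorial : ℝ)).const_mul (‖z‖ ^ n)
    simpa using this

theorem jostEven_zero (q : ℝ → ℂ) (x : ℝ) : jostEven q 0 x = 1 := by
  rw [jostEven, tsum_eq_single 0]
  · rfl
  · intro n hn
    obtain ⟨m, rfl⟩ := Nat.exists_eq_succ_of_ne_zero hn
    rw [Nat.succ_eq_add_one, neumannEven_succ]
    simp

/-- The two families are interleaved: the $n$-th odd term comes from the $n$-th even one and yields
the next even one. The restriction to $\|z\|\le R$ makes the integrable bound uniform in $z$. -/
theorem continuousOn_neumannEven (hc : Continuous q) (hi : Integrable q) (R : ℝ) (n : ℕ) (x : ℝ) :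
    ContinuousOn (fun z => neumannEven q z n x) {z | 0 ≤ z.im ∧ ‖z‖ ≤ R} ∧
    ContinuousOn (fun z => neumannOdd q z n x) {z | 0 ≤ z.im ∧ ‖z‖ ≤ R} := by
  have hodd : ∀ n, (∀ x, ContinuousOn (fun z => neumannEven q z n x) {z | 0 ≤ z.im ∧ ‖z‖ ≤ R}) →
      ∀ x, ContinuousOn (fun z => neumannOdd q z n x) {z | 0 ≤ z.im ∧ ‖z‖ ≤ R} := by
    intro n h x
    refine continuousOn_volterra_param (b := fun y => ‖q y‖ * neumannBound q R n)
      (fun z hz => re_two_I_mul_nonpos hz.1) (by fun_prop)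
      (fun z hz => (Complex.continuous_conj.comp hc).mul (continuous_neumannEven hc hi hz.1 n))
      (hi.norm.mul_const _).integrableOn (fun z hz y => ?_) (fun y => continuousOn_const.mul (h y))
    rw [norm_mul, RCLike.norm_conj]
    gcongr
    exact norm_neumannEven_le_bound hc hi hz.1 hz.2 n y
  have heven : ∀ n x, ContinuousOn (fun z => neumannEven q z n x) {z | 0 ≤ z.im ∧ ‖z‖ ≤ R} := by
    intro n
    induction n with
    | zero => exact fun x => continuousOn_const
    | succ n ih =>
      intro x
      refine ContinuousOn.mul (by fun_prop) (continuousOn_volterra_param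
        (b := fun y => ‖q y‖ * neumannBound q R n) (c := fun _ => 0)
        (g := fun z y => q y * neumannOdd q z n y)
        (fun z hz => le_rfl) continuousOn_const
        (fun z hz => hc.mul (continuous_neumannOdd hc hi hz.1 n))
        (hi.norm.mul_const _).integrableOn (fun z hz y => ?_)
        (fun y => continuousOn_const.mul (hodd n ih y)))
      rw [norm_mul]
      gcongr
      exact norm_neumannOdd_le_bound hc hi hz.1 hz.2 n y
  exact ⟨heven n x, hodd n (heven n) x⟩

theorem isOpen_upperHalfBall (R : ℝ) : IsOpen {z : ℂ | 0 < z.im ∧ ‖z‖ < R} :=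
  (isOpen_lt continuous_const Complex.continuous_im).inter
    (isOpen_lt continuous_norm continuous_const)

theorem differentiableOn_neumannEven (hc : Continuous q) (hi : Integrable q) (R : ℝ) (n : ℕ)
    (x : ℝ) :
    DifferentiableOn ℂ (fun z => neumannEven q z n x) {z | 0 < z.im ∧ ‖z‖ < R} ∧
    DifferentiableOn ℂ (fun z => neumannOdd q z n x) {z | 0 < z.im ∧ ‖z‖ < R} := by
  have hodd : ∀ n, (∀ x, DifferentiableOn ℂ (fun z => neumannEven q z n x)
      {z | 0 < z.im ∧ ‖z‖ < R}) →
      ∀ x, DifferentiableOn ℂ (fun z => neumannOdd q z n x) {z | 0 < z.im ∧ ‖z‖ < R} := by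
    intro n h x
    refine differentiableOn_volterra_param (isOpen_upperHalfBall R)
      (b := fun y => ‖q y‖ * neumannBound q R n)
      (fun z hz => re_two_I_mul_nonpos hz.1.le) (by fun_prop)
      (fun z hz => (Complex.continuous_conj.comp hc).mul (continuous_neumannEven hc hi hz.1.le n))
      (hi.norm.mul_const _).integrableOn (fun z hz y => ?_)
      (fun y => (differentiableOn_const _).mul (h y))
    rw [norm_mul, RCLike.norm_conj]
    gcongr
    exact norm_neumannEven_le_bound hc hi hz.1.le hz.2.le n y
  have heven : ∀ n x, DifferentiableOn ℂ (fun z => neumannEven q z n x)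
      {z | 0 < z.im ∧ ‖z‖ < R} := by
    intro n
    induction n with
    | zero => exact fun x => differentiableOn_const _
    | succ n ih =>
      intro x
      refine DifferentiableOn.mul (by fun_prop) (differentiableOn_volterra_param
        (isOpen_upperHalfBall R) (b := fun y => ‖q y‖ * neumannBound q R n) (c := fun _ => 0)
        (g := fun z y => q y * neumannOdd q z n y)
        (fun z hz => le_rfl) (differentiableOn_const _)
        (fun z hz => hc.mul (continuous_neumannOdd hc hi hz.1.le n))
        (hi.norm.mul_const _).integrableOn (fun z hz y => ?_)
        (fun y => (differentiableOn_const _).mul (hodd n ih y)))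
      rw [norm_mul]
      gcongr
      exact norm_neumannOdd_le_bound hc hi hz.1.le hz.2.le n y
  exact ⟨heven n x, hodd n (heven n) x⟩

theorem continuousOn_of_forall_ball {f : ℂ → ℂ}
    (h : ∀ R : ℝ, ContinuousOn f {z | 0 ≤ z.im ∧ ‖z‖ ≤ R}) : ContinuousOn f {z | 0 ≤ z.im} := by
  intro z hz
  refine ((h (‖z‖ + 1)) z ⟨hz, by linarith⟩).mono_of_mem_nhdsWithin ?_
  filter_upwards [self_mem_nhdsWithin, mem_nhdsWithin_of_mem_nhds
    ((isOpen_lt continuous_norm continuous_const).mem_nhds (lt_add_one ‖z‖))] with w hw hw'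
  exact ⟨hw, le_of_lt hw'⟩

theorem differentiableOn_of_forall_ball {f : ℂ → ℂ}
    (h : ∀ R : ℝ, DifferentiableOn ℂ f {z | 0 < z.im ∧ ‖z‖ < R}) :
    DifferentiableOn ℂ f {z | 0 < z.im} := fun z hz =>
  ((h (‖z‖ + 1)).differentiableAt ((isOpen_upperHalfBall _).mem_nhds
    ⟨hz, lt_add_one _⟩)).differentiableWithinAt

theorem continuousOn_jostEven (hc : Continuous q) (hi : Integrable q) (x : ℝ) :
    ContinuousOn (fun z => jostEven q z x) {z | 0 ≤ z.im} :=
  continuousOn_of_forall_ball fun R => continuousOn_tsum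
    (fun n => (continuousOn_neumannEven hc hi R n x).1) (summable_neumannBound q R)
    fun n _ hz => norm_neumannEven_le_bound hc hi hz.1 hz.2 n x

theorem continuousOn_jostOdd (hc : Continuous q) (hi : Integrable q) (x : ℝ) :
    ContinuousOn (fun z => jostOdd q z x) {z | 0 ≤ z.im} :=
  continuousOn_of_forall_ball fun R => continuousOn_tsum
    (fun n => (continuousOn_neumannEven hc hi R n x).2) (summable_neumannBound q R)
    fun n _ hz => norm_neumannOdd_le_bound hc hi hz.1 hz.2 n x

theorem differentiableOn_jostEven (hc : Continuous q) (hi : Integrable q) (x : ℝ) :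
    DifferentiableOn ℂ (fun z => jostEven q z x) {z | 0 < z.im} :=
  differentiableOn_of_forall_ball fun R => Complex.differentiableOn_tsum_of_summable_norm
    (summable_neumannBound q R) (fun n => (differentiableOn_neumannEven hc hi R n x).1)
    (isOpen_upperHalfBall R) fun n _ hz => norm_neumannEven_le_bound hc hi hz.1.le hz.2.le n x

theorem differentiableOn_jostOdd (hc : Continuous q) (hi : Integrable q) (x : ℝ) :
    DifferentiableOn ℂ (fun z => jostOdd q z x) {z | 0 < z.im} :=
  differentiableOn_of_forall_ball fun R => Complex.differentiableOn_tsum_of_summable_norm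
    (summable_neumannBound q R) (fun n => (differentiableOn_neumannEven hc hi R n x).2)
    (isOpen_upperHalfBall R) fun n _ hz => norm_neumannOdd_le_bound hc hi hz.1.le hz.2.le n x

end

/-! ### Backward Grönwall and energy estimates -/

theorem norm_sub_le_integral_Ioi_of_hasDerivAt {f f' : ℝ → ℂ} {b : ℝ → ℝ} {l : ℂ} {x : ℝ}
    (hf : ∀ y, HasDerivAt f (f' y) y) (hb : IntegrableOn b (Ioi x)) (hfb : ∀ y, ‖f' y‖ ≤ b y)
    (hl : Tendsto f atTop (𝓝 l)) : ‖f x - l‖ ≤ ∫ y in Ioi x, b y := by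
  have hf' : f' = deriv f := funext fun y => (hf y).deriv.symm
  have hint : IntegrableOn f' (Ioi x) :=
    hb.mono' (hf' ▸ aestronglyMeasurable_deriv f _) (Eventually.of_forall hfb)
  rw [norm_sub_rev, ← integral_Ioi_of_hasDerivAt_of_tendsto' (fun y _ => hf y) hint hl]
  exact norm_integral_le_of_norm_le hb (Eventually.of_forall hfb)

/-- A backward Grönwall inequality: a nonnegative function with `e' ≥ -K e` is controlled by its
limit at `+∞`. -/
theorem le_mul_exp_of_hasDerivAt_ge {e e' K : ℝ → ℝ} {l : ℝ} (hK : Continuous K)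
    (hKi : Integrable K) (hK0 : ∀ x, 0 ≤ K x) (he : ∀ x, HasDerivAt e (e' x) x)
    (he' : ∀ x, -(K x * e x) ≤ e' x) (hl : Tendsto e atTop (𝓝 l)) (hl0 : 0 ≤ l) (x : ℝ) :
    e x ≤ l * Real.exp (∫ y, K y) := by
  have hd : ∀ x, HasDerivAt (fun x => e x * Real.exp (∫ y in (0 : ℝ)..x, K y))
      (e' x * Real.exp (∫ y in (0 : ℝ)..x, K y) +
        e x * (Real.exp (∫ y in (0 : ℝ)..x, K y) * K x)) x :=
    fun x => (he x).mul (hK.integral_hasStrictDerivAt 0 x).hasDerivAt.exp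
  -- The integrating factor $\exp\int_0^xK$ makes the product nondecreasing, so its value at $x$ is
  -- at most its limit at $+\infty$.
  have hmono : Monotone fun x => e x * Real.exp (∫ y in (0 : ℝ)..x, K y) := by
    refine monotone_of_deriv_nonneg (fun x => (hd x).differentiableAt) fun x => ?_
    rw [(hd x).deriv]
    have : 0 ≤ (e' x + K x * e x) * Real.exp (∫ y in (0 : ℝ)..x, K y) :=
      mul_nonneg (by linarith [he' x]) (Real.exp_pos _).le
    linarith
  have hlim : Tendsto (fun x => e x * Real.exp (∫ y in (0 : ℝ)..x, K y)) atTop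
      (𝓝 (l * Real.exp (∫ y in Ioi 0, K y))) :=
    hl.mul ((Real.continuous_exp.tendsto _).comp
      (intervalIntegral_tendsto_integral_Ioi 0 hKi.integrableOn tendsto_id))
  have h := hmono.ge_of_tendsto hlim x
  have hsplit : (∫ y in Ioi 0, K y) = (∫ y in (0 : ℝ)..x, K y) + ∫ y in Ioi x, K y := by
    rw [← intervalIntegral.integral_Ioi_sub_Ioi' hKi.integrableOn hKi.integrableOn]
    ring
  rw [hsplit, Real.exp_add] at h
  have h' : e x ≤ l * Real.exp (∫ y in Ioi x, K y) := by
    have hpos := Real.exp_pos (∫ y in (0 : ℝ)..x, K y)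
    refine le_of_mul_le_mul_right ?_ hpos
    linarith
  refine h'.trans ?_
  exact mul_le_mul_of_nonneg_left (Real.exp_le_exp.2
    (setIntegral_le_integral hKi (Eventually.of_forall hK0))) hl0

theorem neg_mul_le_re_conj_mul {u w : ℂ} {A : ℝ} (h : ‖w‖ ≤ A) :
    -(‖u‖ * A) ≤ ((starRingEnd ℂ) u * w).re := by
  have h1 := (abs_le.1 (Complex.abs_re_le_norm ((starRingEnd ℂ) u * w))).1
  rw [norm_mul, RCLike.norm_conj] at h1
  have := mul_le_mul_of_nonneg_left h (norm_nonneg u)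
  linarith

/-- Energy estimate for a `2 × 2` linear system with integrable coefficients and a dissipative
diagonal term. -/
theorem energy_le {u v u' v' : ℝ → ℂ} {κ : ℝ → ℝ} {e : ℂ} {l : ℝ} (hκ : Continuous κ)
    (hκi : Integrable κ) (hu : ∀ x, HasDerivAt u (u' x) x)
    (hv : ∀ x, HasDerivAt v (e * v x + v' x) x) (he : 0 ≤ e.re)
    (hu' : ∀ x, ‖u' x‖ ≤ κ x * (‖u x‖ + ‖v x‖)) (hv' : ∀ x, ‖v' x‖ ≤ κ x * (‖u x‖ + ‖v x‖))
    (hκ0 : ∀ x, 0 ≤ κ x)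
    (hl : Tendsto (fun x => ‖u x‖ ^ 2 + ‖v x‖ ^ 2) atTop (𝓝 l)) (x : ℝ) :
    ‖u x‖ ^ 2 + ‖v x‖ ^ 2 ≤ l * Real.exp (∫ y, 4 * κ y) := by
  refine le_mul_exp_of_hasDerivAt_ge (K := fun y => 4 * κ y) (by fun_prop) (hκi.const_mul 4)
    (fun y => by linarith [hκ0 y])
    (fun y => (hu y).norm_sq.add (hv y).norm_sq) (fun y => ?_) hl
    (ge_of_tendsto' hl fun y => by positivity) x
  have h1 := neg_mul_le_re_conj_mul (u := u y) (hu' y)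
  have h2 := neg_mul_le_re_conj_mul (u := v y) (hv' y)
  -- The diagonal term contributes $\mathrm{Re}(e)|v|^2\ge0$ to the derivative of the energy;
  -- estimating backwards from $+\infty$, it can only help. This is why the bound does not depend on
  -- `e`.
  have h3 : 0 ≤ ((starRingEnd ℂ) (v y) * (e * v y)).re := by
    have : (starRingEnd ℂ) (v y) * (e * v y) = e * (Complex.normSq (v y) : ℂ) := by
      rw [Complex.normSq_eq_conj_mul_self]; ring
    rw [this, Complex.re_mul_ofReal]
    exact mul_nonneg he (Complex.normSq_nonneg _)
  rw [Complex.inner, Complex.inner, mul_comm (u' y), mul_comm (e * v y + v' y), mul_add,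
    Complex.add_re]
  change -(4 * κ y * (‖u y‖ ^ 2 + ‖v y‖ ^ 2)) ≤ _
  -- The coupling costs $2\kappa(|u|+|v|)^2\le4\kappa(|u|^2+|v|^2)$, hence the constant 4.
  nlinarith [mul_nonneg (hκ0 y) (sq_nonneg (‖u y‖ - ‖v y‖))]

/-! ### Large spectral parameters -/

section Asymptotics

variable {q : ℝ → ℂ}

theorem hasDerivAt_of_contDiff_one (hq : ContDiff ℝ 1 q) (x : ℝ) : HasDerivAt q (deriv q x) x :=
  (hq.differentiable one_ne_zero x).hasDerivAt

theorem tendsto_zero_atTop_of_integrable (hq : ContDiff ℝ 1 q) (hi : Integrable q)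
    (hi' : Integrable (deriv q)) : Tendsto q atTop (𝓝 0) :=
  tendsto_zero_of_hasDerivAt_of_integrableOn_Ioi (a := 0)
    (fun x _ => hasDerivAt_of_contDiff_one hq x) hi'.integrableOn hi.integrableOn

theorem norm_le_integral_norm_deriv (hq : ContDiff ℝ 1 q) (hi : Integrable q)
    (hi' : Integrable (deriv q)) (x : ℝ) : ‖q x‖ ≤ ∫ y, ‖deriv q y‖ := by
  have h := norm_sub_le_integral_Ioi_of_hasDerivAt (x := x) (hasDerivAt_of_contDiff_one hq)
    hi'.norm.integrableOn (fun y => le_rfl) (tendsto_zero_atTop_of_integrable hq hi hi')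
  rw [sub_zero] at h
  exact h.trans (setIntegral_le_integral hi'.norm (Eventually.of_forall fun _ => norm_nonneg _))

theorem integrable_norm_sq (hq : ContDiff ℝ 1 q) (hi : Integrable q)
    (hi' : Integrable (deriv q)) : Integrable fun y => ‖q y‖ ^ 2 := by
  have hc := hq.continuous
  refine (hi.norm.const_mul (∫ y, ‖deriv q y‖)).mono' (Continuous.aestronglyMeasurable
    (by fun_prop)) (Eventually.of_forall fun y => ?_)
  rw [Real.norm_of_nonneg (by positivity), sq]
  gcongr
  exact norm_le_integral_norm_deriv hq hi hi' y

/-- The combination `2 i z b + q̄ a`, which stays bounded for large spectral parameters. -/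
def jostGauge (q : ℝ → ℂ) (z : ℂ) (x : ℝ) : ℂ :=
  2 * Complex.I * z * jostOdd q z x + (starRingEnd ℂ) (q x) * jostEven q z x

theorem mul_jostOdd_eq (q : ℝ → ℂ) (z : ℂ) (x : ℝ) : z * jostOdd q z x =
    -(Complex.I / 2) * (jostGauge q z x - (starRingEnd ℂ) (q x) * jostEven q z x) := by
  rw [jostGauge]
  linear_combination (z * jostOdd q z x) * Complex.I_sq

variable (hq : ContDiff ℝ 1 q) (hi : Integrable q) (hi' : Integrable (deriv q))
include hq hi hi'

/-- Substituting $zb=-\tfrac i2(w-\bar qa)$, where $w$ is `jostGauge`, removes $z$ from the equation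
for $a$. -/
theorem hasDerivAt_jostEven_gauge {z : ℂ} (hz : 0 ≤ z.im) (x : ℝ) :
    HasDerivAt (jostEven q z) (Complex.I / 2 * (q x * (starRingEnd ℂ) (q x)) * jostEven q z x -
      Complex.I / 2 * q x * jostGauge q z x) x := by
  refine (hasDerivAt_jostEven hq.continuous hi (norm_le_integral_norm_deriv hq hi hi') hz
    x).congr_deriv ?_
  linear_combination q x * mul_jostOdd_eq q z x

/-- The derivative of $2izb$ is exactly $-2izw$. Differentiating $\bar qa$ produces $\bar q_x$ and
another $zb$, which is substituted again; so $z$ survives only in the dissipative diagonal term. -/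
theorem hasDerivAt_jostGauge {z : ℂ} (hz : 0 ≤ z.im) (x : ℝ) :
    HasDerivAt (jostGauge q z) (-(2 * Complex.I * z) * jostGauge q z x +
      (((starRingEnd ℂ) (deriv q x) + Complex.I / 2 * (q x * (starRingEnd ℂ) (q x) ^ 2)) *
        jostEven q z x - Complex.I / 2 * (q x * (starRingEnd ℂ) (q x)) * jostGauge q z x)) x := by
  have h1 := hasDerivAt_jostOdd hq.continuous hi (norm_le_integral_norm_deriv hq hi hi') hz x
  have h2 := hasDerivAt_jostEven hq.continuous hi (norm_le_integral_norm_deriv hq hi hi') hz x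
  have h3 : HasDerivAt (fun x => (starRingEnd ℂ) (q x)) ((starRingEnd ℂ) (deriv q x)) x :=
    (hasDerivAt_of_contDiff_one hq x).star
  refine ((h1.const_mul (2 * Complex.I * z)).add (h3.mul h2)).congr_deriv ?_
  have h4 := mul_jostOdd_eq q z x
  rw [jostGauge] at h4 ⊢
  linear_combination (starRingEnd ℂ) (q x) * q x * h4

theorem tendsto_jostGauge_atTop {z : ℂ} (hz : 0 ≤ z.im) :
    Tendsto (jostGauge q z) atTop (𝓝 0) := by
  have h3 : Tendsto (fun x => (starRingEnd ℂ) (q x)) atTop (𝓝 0) := by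
    have := (Complex.continuous_conj.tendsto 0).comp (tendsto_zero_atTop_of_integrable hq hi hi')
    rw [map_zero] at this
    exact this
  have := ((tendsto_jostOdd_atTop hq.continuous hi hz).const_mul (2 * Complex.I * z)).add
    (h3.mul (tendsto_jostEven_atTop hq.continuous hi hz))
  rw [mul_zero, zero_mul, add_zero] at this
  exact this

theorem norm_jostEven_jostGauge_le : ∃ C : ℝ, 0 ≤ C ∧ ∀ z : ℂ, 0 ≤ z.im → ∀ x,
    ‖jostEven q z x‖ ≤ C ∧ ‖jostGauge q z x‖ ≤ C := by
  set M := ∫ y, ‖deriv q y‖ with hMdef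
  have hM : ∀ x, ‖q x‖ ≤ M := norm_le_integral_norm_deriv hq hi hi'
  have hM0 : 0 ≤ M := (norm_nonneg _).trans (hM 0)
  have hqc := hq.continuous
  have hqc' : Continuous (deriv q) := hq.continuous_deriv le_rfl
  -- One integrable majorant for all the coefficients without $z$: with $|q|\le M$ these are at most
  -- $\tfrac12|q|$, $\tfrac12M|q|$ and $|q_x|+\tfrac12M^2|q|$.
  set κ : ℝ → ℝ := fun x => (M + 1 + M ^ 2) * ‖q x‖ + ‖deriv q x‖ with hκ
  have hκ0 : ∀ x, 0 ≤ κ x := fun x => by positivity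
  refine ⟨Real.sqrt (Real.exp (∫ y, 4 * κ y)), Real.sqrt_nonneg _, fun z hz x => ?_⟩
  have hI : ‖Complex.I / 2‖ = 1 / 2 := by simp
  have hE := energy_le (κ := κ) (l := 1) (e := -(2 * Complex.I * z)) (by fun_prop)
    ((hi.norm.const_mul _).add hi'.norm) (hasDerivAt_jostEven_gauge hq hi hi' hz)
    (hasDerivAt_jostGauge hq hi hi' hz) (by simp; linarith) (fun x => ?_) (fun x => ?_) hκ0
    (by
      have := ((tendsto_jostEven_atTop hqc hi hz).norm.pow 2).add
        ((tendsto_jostGauge_atTop hq hi hi' hz).norm.pow 2)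
      simpa using this) x
  · rw [one_mul] at hE
    constructor
    · exact Real.le_sqrt_of_sq_le (by nlinarith [sq_nonneg ‖jostGauge q z x‖])
    · exact Real.le_sqrt_of_sq_le (by nlinarith [sq_nonneg ‖jostEven q z x‖])
  · refine (norm_sub_le _ _).trans ?_
    simp only [norm_mul, hI, RCLike.norm_conj, mul_add]
    have h1 : 1 / 2 * (‖q x‖ * ‖q x‖) ≤ κ x := by
      have := mul_le_mul_of_nonneg_left (hM x) (norm_nonneg (q x))
      simp only [hκ]
      nlinarith [norm_nonneg (q x), norm_nonneg (deriv q x), mul_nonneg hM0 (norm_nonneg (q x)),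
        mul_nonneg (sq_nonneg M) (norm_nonneg (q x))]
    have h2 : 1 / 2 * ‖q x‖ ≤ κ x := by
      simp only [hκ]
      nlinarith [norm_nonneg (q x), norm_nonneg (deriv q x), mul_nonneg hM0 (norm_nonneg (q x)),
        mul_nonneg (sq_nonneg M) (norm_nonneg (q x))]
    gcongr
  · refine (norm_sub_le _ _).trans ?_
    rw [norm_mul, norm_mul (_ * _) (jostGauge q z x), mul_add]
    have hqq := mul_le_mul_of_nonneg_left (hM x) (norm_nonneg (q x))
    gcongr
    · refine (norm_add_le _ _).trans ?_
      simp only [norm_mul, hI, RCLike.norm_conj, norm_pow, hκ]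
      have : ‖q x‖ ^ 2 ≤ M ^ 2 := by gcongr; exact hM x
      nlinarith [norm_nonneg (q x), norm_nonneg (deriv q x), mul_nonneg hM0 (norm_nonneg (q x)),
        mul_le_mul_of_nonneg_left this (norm_nonneg (q x)),
        mul_nonneg (sq_nonneg M) (norm_nonneg (q x))]
    · simp only [norm_mul, hI, RCLike.norm_conj, hκ]
      nlinarith [norm_nonneg (q x), norm_nonneg (deriv q x), mul_nonneg hM0 (norm_nonneg (q x)),
        mul_nonneg (sq_nonneg M) (norm_nonneg (q x))]

/-- Asymptotics of the Jost solution for large spectral parameters. -/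
theorem jost_asymptotics : ∃ C : ℝ, 0 ≤ C ∧ ∀ z : ℂ, 0 ≤ z.im → z ≠ 0 →
    ‖jostEven q z 0 - Complex.exp (-(Complex.I / 2 * ((∫ y in Ioi (0 : ℝ), ‖q y‖ ^ 2 : ℝ) : ℂ)))‖
      ≤ C / ‖z‖ ∧ ‖z * jostOdd q z 0‖ ≤ C := by
  obtain ⟨C, hC0, hC⟩ := norm_jostEven_jostGauge_le hq hi hi'
  set M := ∫ y, ‖deriv q y‖ with hMdef
  have hM : ∀ x, ‖q x‖ ≤ M := norm_le_integral_norm_deriv hq hi hi'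
  have hM0 : 0 ≤ M := (norm_nonneg _).trans (hM 0)
  have hqc := hq.continuous
  have hI : ‖Complex.I / 2‖ = 1 / 2 := by simp
  set m : ℝ → ℝ := fun x => ∫ y in Ioi x, ‖q y‖ ^ 2 with hm
  -- A unimodular integrating factor cancelling the diagonal term $\tfrac i2|q|^2a$, so that
  -- $(Ea)'=-\tfrac i2Eqw$; its value at $0$ produces the limiting phase.
  set E : ℝ → ℂ := fun x => Complex.exp (Complex.I / 2 * (m x : ℂ)) with hE
  have hmd : ∀ x, HasDerivAt (fun x => (m x : ℂ)) (-(q x * (starRingEnd ℂ) (q x))) x := by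
    intro x
    have h := hasDerivAt_integral_Ioi (h := fun y => ((‖q y‖ ^ 2 : ℝ) : ℂ)) (by fun_prop)
      (fun x => (integrable_norm_sq hq hi hi').ofReal.integrableOn) x
    have h0 : (fun x => (m x : ℂ)) = fun x => ∫ y in Ioi x, ((‖q y‖ ^ 2 : ℝ) : ℂ) :=
      funext fun x => integral_ofReal.symm
    rw [h0]
    refine h.congr_deriv ?_
    rw [Complex.mul_conj, Complex.normSq_eq_norm_sq]
  have hEn : ∀ x, ‖E x‖ = 1 := fun x => by
    rw [hE]; simp only; rw [Complex.norm_exp]; simp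
  have hEd : ∀ x, HasDerivAt E (-(Complex.I / 2 * (q x * (starRingEnd ℂ) (q x))) * E x) x := by
    intro x
    refine ((hmd x).const_mul (Complex.I / 2)).cexp.congr_deriv ?_
    simp only [hE]; ring
  have hEl : Tendsto E atTop (𝓝 1) := by
    have h1 : Tendsto m atTop (𝓝 0) := tendsto_integral_Ioi_zero tendsto_id
    have h2 : Continuous fun s : ℝ => Complex.exp (Complex.I / 2 * (s : ℂ)) := by fun_prop
    have h3 := (h2.tendsto 0).comp h1
    rw [Complex.ofReal_zero, mul_zero, Complex.exp_zero] at h3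
    exact h3
  set b : ℝ → ℝ := fun x => C * (M ^ 2 * ‖q x‖ + ‖deriv q x‖ + M * ‖deriv q x‖ + M ^ 3 * ‖q x‖)
    with hb
  have hbi : Integrable b := by
    refine Integrable.const_mul (((Integrable.add ?_ hi'.norm).add ?_).add ?_) C
    · exact hi.norm.const_mul _
    · exact hi'.norm.const_mul _
    · exact hi.norm.const_mul _
  have hb0 : 0 ≤ ∫ y in Ioi (0 : ℝ), b y := integral_nonneg fun y => by simp only [hb]; positivity
  -- A constant large enough for both bounds: the first needs $\tfrac14(\int b+MC)$, the second
  -- $\tfrac12(C+MC)$.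
  refine ⟨(∫ y in Ioi (0 : ℝ), b y) / 4 + M * C + C, by positivity, fun z hz hz0 => ⟨?_, ?_⟩⟩
  · have hzn : 0 < ‖z‖ := norm_pos_iff.2 hz0
    -- Integration by parts against the oscillating diagonal term: the correction cancels $-\tfrac
    -- i2Eqw$, and all that remains in $F'$ has the factor $1/(4z)$.
    set F : ℝ → ℂ := fun x =>
      E x * jostEven q z x - (4 * z)⁻¹ * (E x * (q x * jostGauge q z x)) with hF
    set r : ℝ → ℂ := fun x => -(4 * z)⁻¹ * (E x *
      (-(Complex.I / 2 * (q x * (starRingEnd ℂ) (q x))) * (q x * jostGauge q z x) +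
        deriv q x * jostGauge q z x +
        q x * (((starRingEnd ℂ) (deriv q x) + Complex.I / 2 * (q x * (starRingEnd ℂ) (q x) ^ 2)) *
        jostEven q z x - Complex.I / 2 * (q x * (starRingEnd ℂ) (q x)) * jostGauge q z x))) with hr
    have hFd : ∀ x, HasDerivAt F (r x) x := by
      intro x
      have hqd := hasDerivAt_of_contDiff_one hq x
      have := ((hEd x).mul (hasDerivAt_jostEven_gauge hq hi hi' hz x)).sub
        (((hEd x).mul (hqd.mul (hasDerivAt_jostGauge hq hi hi' hz x))).const_mul (4 * z)⁻¹)
      refine this.congr_deriv ?_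
      have hzz : (4 * z)⁻¹ * z = 1 / 4 := by field_simp
      simp only [hr, Pi.mul_apply]
      linear_combination (2 * Complex.I * E x * q x * jostGauge q z x) * hzz
    have hFl : Tendsto F atTop (𝓝 1) := by
      have := (hEl.mul (tendsto_jostEven_atTop hqc hi hz)).sub
        ((hEl.mul ((tendsto_zero_atTop_of_integrable hq hi hi').mul
          (tendsto_jostGauge_atTop hq hi hi' hz))).const_mul (4 * z)⁻¹)
      rw [mul_one, mul_zero, mul_zero, mul_zero, sub_zero] at this
      exact this
    have hrb : ∀ x, ‖r x‖ ≤ (4 * ‖z‖)⁻¹ * b x := by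
      intro x
      obtain ⟨ha, hw⟩ := hC z hz x
      have hqx := hM x
      simp only [hr]
      rw [norm_mul, norm_neg, norm_inv, norm_mul, norm_mul (E x), hEn, one_mul, Complex.norm_ofNat]
      gcongr
      refine (norm_add₃_le).trans ?_
      have e1 : ‖-(Complex.I / 2 * (q x * (starRingEnd ℂ) (q x))) * (q x * jostGauge q z x)‖ ≤
          1 / 2 * (M * ‖q x‖) * (M * C) := by
        simp only [norm_mul, norm_neg, hI, RCLike.norm_conj]
        gcongr
      have e2 : ‖deriv q x * jostGauge q z x‖ ≤ ‖deriv q x‖ * C := by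
        rw [norm_mul]; gcongr
      have e3 : ‖q x * (((starRingEnd ℂ) (deriv q x) +
          Complex.I / 2 * (q x * (starRingEnd ℂ) (q x) ^ 2)) * jostEven q z x -
          Complex.I / 2 * (q x * (starRingEnd ℂ) (q x)) * jostGauge q z x)‖ ≤
          M * ((‖deriv q x‖ + 1 / 2 * (‖q x‖ * M ^ 2)) * C + 1 / 2 * (M * ‖q x‖) * C) := by
        rw [norm_mul]
        gcongr
        refine (norm_sub_le _ _).trans ?_
        rw [norm_mul, norm_mul _ (jostGauge q z x)]
        gcongr
        · refine (norm_add_le _ _).trans ?_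
          simp only [norm_mul, hI, RCLike.norm_conj, norm_pow]
          gcongr
        · simp only [norm_mul, hI, RCLike.norm_conj]
          gcongr
      refine (add_le_add (add_le_add e1 e2) e3).trans ?_
      simp only [hb]
      have p1 : 0 ≤ M ^ 3 * ‖q x‖ * C := by positivity
      nlinarith [p1]
    have h1 := norm_sub_le_integral_Ioi_of_hasDerivAt (x := 0) hFd
      ((hbi.const_mul (4 * ‖z‖)⁻¹).integrableOn) hrb hFl
    rw [integral_const_mul] at h1
    have h2 : Complex.exp (-(Complex.I / 2 * (m 0 : ℂ))) * E 0 = 1 := by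
      simp only [hE]; rw [← Complex.exp_add]; simp
    have h3 : ‖Complex.exp (-(Complex.I / 2 * (m 0 : ℂ)))‖ = 1 := by
      rw [Complex.norm_exp]; simp
    have h4 : jostEven q z 0 - Complex.exp (-(Complex.I / 2 * (m 0 : ℂ))) =
        Complex.exp (-(Complex.I / 2 * (m 0 : ℂ))) * ((F 0 - 1) +
          (4 * z)⁻¹ * (E 0 * (q 0 * jostGauge q z 0))) := by
      simp only [hF]
      linear_combination (-(jostEven q z 0)) * h2
    have h5 : ‖(4 * z)⁻¹ * (E 0 * (q 0 * jostGauge q z 0))‖ ≤ (4 * ‖z‖)⁻¹ * (M * C) := by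
      rw [norm_mul, norm_inv, norm_mul, norm_mul, norm_mul, hEn, one_mul, Complex.norm_ofNat]
      gcongr
      · exact hM 0
      · exact (hC z hz 0).2
    rw [h4, norm_mul, h3, one_mul]
    refine (norm_add_le _ _).trans ((add_le_add h1 h5).trans ?_)
    rw [le_div_iff₀ hzn]
    have : ((4 * ‖z‖)⁻¹ * (∫ y in Ioi (0 : ℝ), b y) + (4 * ‖z‖)⁻¹ * (M * C)) * ‖z‖ =
        (∫ y in Ioi (0 : ℝ), b y) / 4 + M * C / 4 := by field_simp
    rw [this]
    have : 0 ≤ M * C := by positivity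
    linarith
  · obtain ⟨ha, hw⟩ := hC z hz 0
    rw [mul_jostOdd_eq, norm_mul, norm_neg, hI]
    have : ‖jostGauge q z 0 - (starRingEnd ℂ) (q 0) * jostEven q z 0‖ ≤ C + M * C := by
      refine (norm_sub_le _ _).trans ?_
      rw [norm_mul, RCLike.norm_conj]
      gcongr
      exact hM 0
    have : 0 ≤ M * C := by positivity
    linarith

end Asymptotics

/-! ### Function theory on the closed upper half-plane -/

section HalfPlane

/-- Neighbourhoods of infinity in the closed upper half-plane. -/
def upperInfty : Filter ℂ := Bornology.cobounded ℂ ⊓ 𝓟 {z | 0 ≤ z.im}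

theorem tendsto_norm_upperInfty : Tendsto (fun z : ℂ => ‖z‖) upperInfty atTop :=
  tendsto_norm_cobounded_atTop.mono_left inf_le_left

theorem eventually_upperInfty_im_nonneg : ∀ᶠ z : ℂ in upperInfty, 0 ≤ z.im :=
  mem_inf_of_right (mem_principal_self _)

theorem exists_of_eventually_upperInfty {p : ℂ → Prop} (h : ∀ᶠ z in upperInfty, p z) :
    ∃ R : ℝ, 0 < R ∧ ∀ z : ℂ, 0 ≤ z.im → R ≤ ‖z‖ → p z := by
  rw [upperInfty, eventually_inf_principal, ← comap_norm_atTop, eventually_comap] at h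
  obtain ⟨R, hR⟩ := eventually_atTop.1 h
  exact ⟨max R 1, by positivity, fun z hz hzR => hR ‖z‖ ((le_max_left _ _).trans hzR) z rfl hz⟩

/-- Reflection of the lower half-plane onto the upper half-plane. -/
def foldUp (z : ℂ) : ℂ := z.re + |z.im| * Complex.I

theorem foldUp_of_nonneg {z : ℂ} (hz : 0 ≤ z.im) : foldUp z = z := by
  rw [foldUp, abs_of_nonneg hz, Complex.re_add_im]

theorem foldUp_im_nonneg (z : ℂ) : 0 ≤ (foldUp z).im := by simp [foldUp]

theorem norm_foldUp (z : ℂ) : ‖foldUp z‖ = ‖z‖ := by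
  rw [foldUp, Complex.norm_add_mul_I, sq_abs, Complex.norm_eq_sqrt_sq_add_sq]

theorem continuous_foldUp : Continuous foldUp := by
  unfold foldUp
  have := Complex.continuous_re
  have := Complex.continuous_im
  fun_prop

/-- The exterior of a disc is the image of the convex half-plane $\mathrm{Re}\,w>\log R$ under the
exponential. -/
theorem isPreconnected_norm_gt {R : ℝ} (hR : 0 < R) : IsPreconnected {z : ℂ | R < ‖z‖} := by
  have h : {z : ℂ | R < ‖z‖} = Complex.exp '' {z : ℂ | Real.log R < z.re} := by
    ext z
    constructor
    · intro hz
      have hz0 : z ≠ 0 := norm_pos_iff.1 (hR.trans hz)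
      refine ⟨Complex.log z, ?_, Complex.exp_log hz0⟩
      rw [mem_ofPred_eq, Complex.log_re]
      exact Real.log_lt_log hR hz
    · rintro ⟨w, hw, rfl⟩
      rw [mem_ofPred_eq, Complex.norm_exp]
      exact (Real.log_lt_iff_lt_exp hR).1 hw
  rw [h]
  exact ((convex_halfSpace_re_gt _).isPreconnected).image _ Complex.continuous_exp.continuousOn

theorem countable_exp_eq_one : {z : ℂ | Complex.exp z = 1}.Countable := by
  refine (countable_range fun n : ℤ => (n : ℂ) * (2 * Real.pi * Complex.I)).mono fun z hz => ?_
  obtain ⟨n, hn⟩ := Complex.exp_eq_one_iff.1 hz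
  exact ⟨n, hn.symm⟩

/-- A continuous logarithm of a holomorphic function is holomorphic. -/
theorem differentiableAt_of_exp_eq {F G : ℂ → ℂ} {z : ℂ} (hG : ContinuousAt G z)
    (hF : DifferentiableAt ℂ F z) (h : ∀ᶠ w in 𝓝 z, Complex.exp (G w) = F w) :
    DifferentiableAt ℂ G z := by
  have hz : Complex.exp (G z) = F z := h.self_of_nhds
  have hlog : DifferentiableAt ℂ (fun w => G z + Complex.log (F w / F z)) z := by
    refine (differentiableAt_const _).add ((hF.div_const _).clog ?_)
    rw [div_self (hz ▸ Complex.exp_ne_zero _)]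
    exact Complex.one_mem_slitPlane
  refine hlog.congr_of_eventuallyEq ?_
  have hIm : ∀ᶠ w in 𝓝 z, |(G w - G z).im| < Real.pi := by
    have hc : ContinuousAt (fun w => |(G w - G z).im|) z :=
      (Complex.continuous_im.continuousAt.comp (hG.sub continuousAt_const)).abs
    refine hc.eventually_lt continuousAt_const ?_
    simp [Real.pi_pos]
  filter_upwards [h, hIm] with w hw hw'
  rw [← hw, ← hz, ← Complex.exp_sub, Complex.log_exp (abs_lt.1 hw').1 (abs_lt.1 hw').2.le]
  ring

/-- A nonvanishing function on the closed upper half-plane which is holomorphic inside and tends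
to `1` at infinity has a logarithm which tends to `0` at infinity. -/
theorem exists_log_of_tendsto_one {F : ℂ → ℂ} (hc : ContinuousOn F {z | 0 ≤ z.im})
    (hd : DifferentiableOn ℂ F {z | 0 < z.im}) (h0 : ∀ z : ℂ, 0 ≤ z.im → F z ≠ 0)
    (hl : Tendsto F upperInfty (𝓝 1)) :
    ∃ G : ℂ → ℂ, ContinuousOn G {z | 0 ≤ z.im} ∧ DifferentiableOn ℂ G {z | 0 < z.im} ∧
      (∀ z : ℂ, 0 ≤ z.im → Complex.exp (G z) = F z) ∧ Tendsto G upperInfty (𝓝 0) := by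
  have hF' : Continuous fun z => F (foldUp z) :=
    hc.comp_continuous continuous_foldUp foldUp_im_nonneg
  have hx₀ : F (foldUp 0) ≠ 0 := h0 _ (foldUp_im_nonneg 0)
  -- Precomposing with `foldUp` makes the function continuous and nonvanishing on the whole simply
  -- connected plane, so it lifts through the covering `exp`.
  obtain ⟨f, ⟨-, hf⟩, -⟩ := Complex.isCoveringMapOn_exp.existsUnique_continuousMap_lifts
    ⟨fun z => F (foldUp z), hF'⟩ (a₀ := 0) (Complex.exp_log hx₀)
    (fun z => h0 _ (foldUp_im_nonneg z))
  set g : ℂ → ℂ := ⇑f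
  have hg : Continuous g := f.continuous
  have hgF' : ∀ z, Complex.exp (g z) = F (foldUp z) := fun z => congrFun hf z
  have hslit : ∀ᶠ z in upperInfty, F z ∈ Complex.slitPlane :=
    hl (Complex.isOpen_slitPlane.mem_nhds Complex.one_mem_slitPlane)
  obtain ⟨R, hR, hRs⟩ := exists_of_eventually_upperInfty hslit
  have hRs' : ∀ z : ℂ, R < ‖z‖ → F (foldUp z) ∈ Complex.slitPlane := fun z hz =>
    hRs _ (foldUp_im_nonneg z) (by rw [norm_foldUp]; exact hz.le)
  set h : ℂ → ℂ := fun z => g z - Complex.log (F (foldUp z)) with hh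
  have hhc : ContinuousOn h {z : ℂ | R < ‖z‖} :=
    hg.continuousOn.sub (hF'.continuousOn.clog hRs')
  -- Near infinity the lift and the principal logarithm differ by elements of $2\pi i\mathbb Z$.
  -- This set is countable, hence totally disconnected, and the exterior domain is connected, so the
  -- difference is constant; subtracting it normalises the logarithm at infinity.
  have hsub : (h '' {z : ℂ | R < ‖z‖}).Subsingleton := by
    refine countable_exp_eq_one.isTotallyDisconnected _ ?_ ((isPreconnected_norm_gt hR).image _ hhc)
    rintro _ ⟨z, hz, rfl⟩
    rw [mem_ofPred_eq, hh]
    simp only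
    rw [Complex.exp_sub, hgF', Complex.exp_log (h0 _ (foldUp_im_nonneg z)),
      div_self (h0 _ (foldUp_im_nonneg z))]
  set p : ℂ := ((R + 1 : ℝ) : ℂ) with hp
  have hpR : R < ‖p‖ := by
    rw [hp, Complex.norm_real, Real.norm_of_nonneg (by positivity)]; linarith
  have hexp : Complex.exp (h p) = 1 := by
    rw [hh]
    simp only
    rw [Complex.exp_sub, hgF', Complex.exp_log (h0 _ (foldUp_im_nonneg p)),
      div_self (h0 _ (foldUp_im_nonneg p))]
  have hGF : ∀ z : ℂ, 0 ≤ z.im → Complex.exp (g z - h p) = F z := fun z hz => by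
    rw [Complex.exp_sub, hexp, div_one, hgF', foldUp_of_nonneg hz]
  refine ⟨fun z => g z - h p, (hg.sub continuous_const).continuousOn, fun z hz => ?_, hGF, ?_⟩
  · have hop : {z : ℂ | 0 < z.im} ∈ 𝓝 z :=
      (isOpen_lt continuous_const Complex.continuous_im).mem_nhds hz
    refine (differentiableAt_of_exp_eq (F := F) (hg.sub continuous_const).continuousAt
      (hd.differentiableAt hop) ?_).differentiableWithinAt
    filter_upwards [hop] with w hw using hGF w (le_of_lt hw)
  · have hlog : Tendsto (fun z => Complex.log (F z)) upperInfty (𝓝 0) := by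
      have := hl.clog Complex.one_mem_slitPlane
      rwa [Complex.log_one] at this
    refine hlog.congr' ?_
    filter_upwards [tendsto_norm_upperInfty.eventually_gt_atTop R,
      eventually_upperInfty_im_nonneg] with z hz hz'
    have := hsub ⟨z, hz, rfl⟩ ⟨p, hpR, rfl⟩
    rw [← this, hh]
    simp only
    rw [foldUp_of_nonneg hz']
    ring

/-- Cauchy's theorem on the upper half-plane. -/
theorem tendsto_integral_real_line_zero {h : ℂ → ℂ} (hc : ContinuousOn h {z | 0 ≤ z.im})
    (hd : DifferentiableOn ℂ h {z | 0 < z.im})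
    (hl : Tendsto (fun z => z * h z) upperInfty (𝓝 0)) :
    Tendsto (fun R : ℝ => ∫ x in (-R)..R, h x) atTop (𝓝 0) := by
  rw [Metric.tendsto_atTop]
  intro ε hε
  have hev : ∀ᶠ z in upperInfty, ‖z * h z‖ < ε / 8 := by
    have := Metric.tendsto_nhds.1 hl (ε / 8) (by positivity)
    simpa using this
  obtain ⟨R₀, hR₀, hbd⟩ := exists_of_eventually_upperInfty hev
  refine ⟨R₀, fun R hR => ?_⟩
  have hR0 : 0 < R := lt_of_lt_of_le hR₀ hR
  have hbd' : ∀ z : ℂ, 0 ≤ z.im → R ≤ ‖z‖ → ‖h z‖ ≤ ε / 8 / R := by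
    intro z hz hzR
    have h1 := (hbd z hz (hR.trans hzR)).le
    rw [norm_mul] at h1
    rw [le_div_iff₀ hR0]
    calc ‖h z‖ * R ≤ ‖h z‖ * ‖z‖ := by gcongr
      _ ≤ ε / 8 := by linarith
  -- The rectangle has base $[-R,R]$ and height $R$. On its other three sides, of total length $4R$,
  -- the integrand is at most $\varepsilon/(8R)$, so they contribute at most $\varepsilon/2$.
  have hrect := Complex.integral_boundary_rect_eq_zero_of_continuousOn_of_differentiableOn h
    (-R : ℂ) (R + R * Complex.I) (hc.mono ?_) (hd.mono ?_)
  · have hre : (-(R : ℂ)).re = -R := by simp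
    have hre' : ((R : ℂ) + R * Complex.I).re = R := by simp
    have him : (-(R : ℂ)).im = 0 := by simp
    have him' : ((R : ℂ) + R * Complex.I).im = R := by simp
    simp only [hre, hre', him, him', Complex.ofReal_zero, zero_mul, add_zero, smul_eq_mul] at hrect
    have e1 : ‖∫ x : ℝ in (-R)..R, h (x + R * Complex.I)‖ ≤ ε / 8 / R * |R - -R| := by
      refine intervalIntegral.norm_integral_le_of_norm_le_const fun x _ => hbd' _ (by simp [hR0.le]) ?_
      calc R = |((x : ℂ) + R * Complex.I).im| := by simp [abs_of_pos hR0]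
        _ ≤ _ := Complex.abs_im_le_norm _
    have e2 : ‖∫ y : ℝ in (0 : ℝ)..R, h (R + y * Complex.I)‖ ≤ ε / 8 / R * |R - 0| := by
      refine intervalIntegral.norm_integral_le_of_norm_le_const fun y hy => hbd' _ ?_ ?_
      · rw [uIoc_of_le hR0.le] at hy; simp [hy.1.le]
      · calc R = |((R : ℂ) + y * Complex.I).re| := by simp [abs_of_pos hR0]
          _ ≤ _ := Complex.abs_re_le_norm _
    have e3 : ‖∫ y : ℝ in (0 : ℝ)..R, h ((-R : ℝ) + y * Complex.I)‖ ≤ ε / 8 / R * |R - 0| := by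
      refine intervalIntegral.norm_integral_le_of_norm_le_const fun y hy => hbd' _ ?_ ?_
      · rw [uIoc_of_le hR0.le] at hy; simp [hy.1.le]
      · calc R = |(((-R : ℝ) : ℂ) + y * Complex.I).re| := by simp [abs_of_pos hR0]
          _ ≤ _ := Complex.abs_re_le_norm _
    have hR2 : |R - -R| = 2 * R := by rw [abs_of_pos] <;> linarith
    have hR3 : |R - 0| = R := by rw [sub_zero, abs_of_pos hR0]
    rw [hR2] at e1
    rw [hR3] at e2 e3
    have hεR : ε / 8 / R * R = ε / 8 := by field_simp
    have e : ∫ x : ℝ in (-R)..R, h x = (∫ x : ℝ in (-R)..R, h (x + R * Complex.I)) -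
        Complex.I * (∫ y : ℝ in (0 : ℝ)..R, h (R + y * Complex.I)) +
        Complex.I * (∫ y : ℝ in (0 : ℝ)..R, h ((-R : ℝ) + y * Complex.I)) := by
      linear_combination hrect
    rw [dist_zero_right, e]
    refine (norm_add_le _ _).trans_lt ?_
    have := norm_sub_le (∫ x : ℝ in (-R)..R, h (x + R * Complex.I))
      (Complex.I * (∫ y : ℝ in (0 : ℝ)..R, h (R + y * Complex.I)))
    rw [norm_mul, Complex.norm_I, one_mul] at this ⊢
    linarith
  · intro z hz
    have := hz.2
    simp [hR0.le, uIcc_of_le] at this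
    exact this.1
  · intro z hz
    have := hz.2
    simp [hR0.le] at this
    exact this.1

/-- The difference of the kernels is $2i\,\mathrm{Im}(w)/|x-w|^2$, with primitive
$2i\arctan((x-\mathrm{Re}\,w)/\mathrm{Im}\,w)$, and arctan increases by $\pi$ in total. -/
theorem tendsto_integral_poisson {w : ℂ} (hw : 0 < w.im) :
    Tendsto (fun R : ℝ => ∫ x in (-R)..R,
      (1 / ((x : ℂ) - w) - 1 / ((x : ℂ) - (starRingEnd ℂ) w))) atTop
      (𝓝 (2 * Real.pi * Complex.I)) := by
  have hd : ∀ x : ℝ, HasDerivAt (fun x : ℝ => Real.arctan ((x - w.re) / w.im))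
      (w.im / ((x - w.re) ^ 2 + w.im ^ 2)) x := by
    intro x
    refine ((((hasDerivAt_id x).sub_const w.re).div_const w.im).arctan).congr_deriv ?_
    have : (x - w.re) ^ 2 + w.im ^ 2 ≠ 0 := by positivity
    simp only [id]
    field_simp
    ring
  have hcont : Continuous fun x : ℝ => w.im / ((x - w.re) ^ 2 + w.im ^ 2) :=
    continuous_const.div (by fun_prop) fun x => by positivity
  have hval : ∀ R : ℝ, ∫ x in (-R)..R,
      (1 / ((x : ℂ) - w) - 1 / ((x : ℂ) - (starRingEnd ℂ) w)) =
      2 * Complex.I * ((Real.arctan ((R - w.re) / w.im) - Real.arctan ((-R - w.re) / w.im) : ℝ) : ℂ) := by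
    intro R
    rw [← intervalIntegral.integral_eq_sub_of_hasDerivAt (fun x _ => hd x)
      (hcont.intervalIntegrable _ _), ← intervalIntegral.integral_ofReal,
      ← intervalIntegral.integral_const_mul]
    refine intervalIntegral.integral_congr fun x _ => ?_
    have h1 : (x : ℂ) - w ≠ 0 := fun h => hw.ne' (by simpa using congrArg Complex.im h)
    have h2 : (x : ℂ) - (starRingEnd ℂ) w ≠ 0 :=
      fun h => hw.ne' (by simpa using congrArg Complex.im h)
    have h3 : (((x - w.re) ^ 2 + w.im ^ 2 : ℝ) : ℂ) = (x - w) * (x - (starRingEnd ℂ) w) := by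
      have : (x : ℂ) - (starRingEnd ℂ) w = (starRingEnd ℂ) ((x : ℂ) - w) := by simp
      rw [this, Complex.mul_conj, Complex.normSq_apply]
      simp [sq]
    rw [Complex.ofReal_div, h3, div_sub_div _ _ h1 h2, ← mul_div_assoc]
    congr 1
    have := Complex.sub_conj w
    push_cast at this
    linear_combination this
  simp only [hval]
  have ht : Tendsto (fun R : ℝ => Real.arctan ((R - w.re) / w.im) -
      Real.arctan ((-R - w.re) / w.im)) atTop (𝓝 (Real.pi / 2 - -(Real.pi / 2))) := by
    refine Tendsto.sub ?_ ?_
    · refine (tendsto_nhds_of_tendsto_nhdsWithin Real.tendsto_arctan_atTop).comp ?_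
      exact (tendsto_atTop_add_const_right _ _ tendsto_id).atTop_div_const hw
    · refine (tendsto_nhds_of_tendsto_nhdsWithin Real.tendsto_arctan_atBot).comp ?_
      exact (tendsto_atBot_add_const_right _ _ tendsto_neg_atTop_atBot).atBot_div_const hw
  have := ((Complex.continuous_ofReal.tendsto _).comp ht).const_mul (2 * Complex.I)
  have hlim : (2 * Complex.I * ((Real.pi / 2 - -(Real.pi / 2) : ℝ) : ℂ)) =
      2 * Real.pi * Complex.I := by push_cast; ring
  rw [hlim] at this
  exact this

theorem tendsto_inv_sub_upperInfty (w : ℂ) : Tendsto (fun z => (z - w)⁻¹) upperInfty (𝓝 0) := by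
  rw [tendsto_zero_iff_norm_tendsto_zero]
  simp only [norm_inv]
  refine tendsto_inv_atTop_zero.comp (tendsto_atTop_mono (fun z => norm_sub_norm_le z w) ?_)
  exact tendsto_atTop_add_const_right _ _ tendsto_norm_upperInfty

theorem tendsto_div_sub_upperInfty (w : ℂ) : Tendsto (fun z => z / (z - w)) upperInfty (𝓝 1) := by
  have h := ((tendsto_inv_sub_upperInfty w).const_mul w).const_add 1
  rw [mul_zero, add_zero] at h
  refine h.congr' ?_
  filter_upwards [tendsto_norm_upperInfty.eventually_gt_atTop ‖w‖] with z hz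
  have : z - w ≠ 0 := sub_ne_zero.2 fun h => by rw [h] at hz; exact lt_irrefl _ hz
  field_simp
  ring

theorem sub_conj_ne_zero {w z : ℂ} (hw : 0 < w.im) (hz : 0 ≤ z.im) :
    z - (starRingEnd ℂ) w ≠ 0 := by
  intro h
  have := congrArg Complex.im h
  simp at this
  linarith

/-- The Schwarz integral formula on the upper half-plane. -/
theorem tendsto_schwarz_integral {G : ℂ → ℂ} (hc : ContinuousOn G {z | 0 ≤ z.im})
    (hd : DifferentiableOn ℂ G {z | 0 < z.im}) (hl : Tendsto G upperInfty (𝓝 0))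
    {w : ℂ} (hw : 0 < w.im) :
    Tendsto (fun R : ℝ => ∫ x in (-R)..R, ((2 * (G x).re : ℝ) : ℂ) / ((x : ℂ) - w)) atTop
      (𝓝 (2 * Real.pi * Complex.I * G w)) := by
  have hopen : IsOpen {z : ℂ | 0 < z.im} := isOpen_lt continuous_const Complex.continuous_im
  have hnhds : {z : ℂ | 0 ≤ z.im} ∈ 𝓝 w :=
    mem_of_superset (hopen.mem_nhds hw) fun z hz =>
      show (0 : ℝ) ≤ z.im from le_of_lt hz
  have hcw : ContinuousOn (fun z => (z - (starRingEnd ℂ) w)⁻¹) {z | 0 ≤ z.im} :=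
    (continuousOn_id.sub continuousOn_const).inv₀ fun z hz => sub_conj_ne_zero hw hz
  have hdw : DifferentiableOn ℂ (fun z => (z - (starRingEnd ℂ) w)⁻¹) {z | 0 < z.im} :=
    (differentiableOn_id.sub (differentiableOn_const _)).inv
      fun z hz => sub_conj_ne_zero hw (le_of_lt hz)
  -- With $P=\frac1{x-w}-\frac1{x-\bar w}$ one has $h_1=P\,(G-G(w))$ on the line and
  -- $2\,\mathrm{Re}(G)/(x-w)=P\,G(w)+h_1+h_2+\overline{h_2}$. Cauchy's theorem kills $h_1$ and
  -- $h_2$. The factor $(z-\bar w)^{-1}$ in $h_1$ is needed because the slope of $G$ alone decays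
  -- only like $1/z$.
  set h₁ : ℂ → ℂ := fun z =>
    (w - (starRingEnd ℂ) w) * (dslope G w z * (z - (starRingEnd ℂ) w)⁻¹) with hh₁
  set h₂ : ℂ → ℂ := fun z => G z * (z - (starRingEnd ℂ) w)⁻¹ with hh₂
  have hc₁ : ContinuousOn h₁ {z | 0 ≤ z.im} :=
    continuousOn_const.mul (((continuousOn_dslope hnhds).2
      ⟨hc, hd.differentiableAt (hopen.mem_nhds hw)⟩).mul hcw)
  have hc₂ : ContinuousOn h₂ {z | 0 ≤ z.im} := hc.mul hcw
  have ht₁ : Tendsto (fun R : ℝ => ∫ x in (-R)..R, h₁ x) atTop (𝓝 0) := by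
    refine tendsto_integral_real_line_zero hc₁ ((differentiableOn_const _).mul
      (((Complex.differentiableOn_dslope (hopen.mem_nhds hw)).2 hd).mul hdw)) ?_
    have h := ((tendsto_div_sub_upperInfty ((starRingEnd ℂ) w)).mul
      ((hl.sub_const (G w)).mul (tendsto_inv_sub_upperInfty w))).const_mul (w - (starRingEnd ℂ) w)
    rw [mul_zero, mul_zero, mul_zero] at h
    refine h.congr' ?_
    filter_upwards [tendsto_norm_upperInfty.eventually_gt_atTop ‖w‖] with z hz
    have hzw : z ≠ w := fun h => by rw [h] at hz; exact lt_irrefl _ hz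
    simp only [hh₁]
    rw [dslope_of_ne _ hzw, slope_def_field]
    ring
  have ht₂ : Tendsto (fun R : ℝ => ∫ x in (-R)..R, h₂ x) atTop (𝓝 0) := by
    refine tendsto_integral_real_line_zero hc₂ (hd.mul hdw) ?_
    have h := hl.mul (tendsto_div_sub_upperInfty ((starRingEnd ℂ) w))
    rw [zero_mul] at h
    refine h.congr fun z => ?_
    simp only [hh₂]
    ring
  have ht₃ : Tendsto (fun R : ℝ => ∫ x in (-R)..R, (starRingEnd ℂ) (h₂ x)) atTop (𝓝 0) := by
    have := (Complex.continuous_conj.tendsto 0).comp ht₂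
    rw [map_zero] at this
    refine this.congr fun R => ?_
    rw [intervalIntegral.intervalIntegral_conj]
    rfl
  have ht := (((tendsto_integral_poisson hw).mul_const (G w)).add ((ht₁.add ht₂).add ht₃))
  rw [add_zero, add_zero, add_zero] at ht
  refine ht.congr fun R => ?_
  have hreal : ∀ {f : ℂ → ℂ}, ContinuousOn f {z | 0 ≤ z.im} → Continuous fun x : ℝ => f x :=
    fun hf => hf.comp_continuous Complex.continuous_ofReal fun x => by simp
  have i₁ : IntervalIntegrable (fun x : ℝ => h₁ x) volume (-R) R :=
    (hreal hc₁).intervalIntegrable _ _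
  have i₂ : IntervalIntegrable (fun x : ℝ => h₂ x) volume (-R) R :=
    (hreal hc₂).intervalIntegrable _ _
  have i₃ : IntervalIntegrable (fun x : ℝ => (starRingEnd ℂ) (h₂ x)) volume (-R) R :=
    (Complex.continuous_conj.comp (hreal hc₂)).intervalIntegrable _ _
  have hne : ∀ x : ℝ, (x : ℂ) - w ≠ 0 := fun x h => hw.ne' (by simpa using congrArg Complex.im h)
  have hne' : ∀ x : ℝ, (x : ℂ) - (starRingEnd ℂ) w ≠ 0 := fun x =>
    sub_conj_ne_zero hw (by simp)
  have i₄ : IntervalIntegrable (fun x : ℝ => (1 / ((x : ℂ) - w) -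
      1 / ((x : ℂ) - (starRingEnd ℂ) w)) * G w) volume (-R) R := by
    refine Continuous.intervalIntegrable ?_ _ _
    exact ((continuous_const.div (by fun_prop) hne).sub
      (continuous_const.div (by fun_prop) hne')).mul continuous_const
  rw [← intervalIntegral.integral_mul_const, ← intervalIntegral.integral_add i₁ i₂,
    ← intervalIntegral.integral_add (i₁.add i₂) i₃,
    ← intervalIntegral.integral_add i₄ ((i₁.add i₂).add i₃)]
  refine intervalIntegral.integral_congr fun x _ => ?_
  have hxw : (x : ℂ) ≠ w := sub_ne_zero.1 (hne x)
  have e1 := hne x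
  have e2 := hne' x
  have e3 : ((2 * (G x).re : ℝ) : ℂ) = G x + (starRingEnd ℂ) (G x) := by
    rw [Complex.add_conj]
  simp only [hh₁, hh₂, e3]
  rw [dslope_of_ne _ hxw, slope_def_field, map_mul, map_inv₀, map_sub, Complex.conj_conj,
    Complex.conj_ofReal]
  field_simp
  ring

/-- A function without zeros on the closed upper half-plane, holomorphic inside and normalised at
infinity, is determined by its modulus on the real line. -/
theorem eq_exp_integral_log_norm {F : ℂ → ℂ} (hc : ContinuousOn F {z | 0 ≤ z.im})
    (hd : DifferentiableOn ℂ F {z | 0 < z.im}) (h0 : ∀ z : ℂ, 0 ≤ z.im → F z ≠ 0)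
    (hl : Tendsto F upperInfty (𝓝 1)) {w : ℂ} (hw : 0 < w.im)
    (hi : Integrable fun x : ℝ => ((2 * Real.log ‖F x‖ : ℝ) : ℂ) / ((x : ℂ) - w)) :
    F w = Complex.exp ((1 / (2 * Real.pi * Complex.I)) *
      ∫ x : ℝ, ((2 * Real.log ‖F x‖ : ℝ) : ℂ) / ((x : ℂ) - w)) := by
  obtain ⟨G, hGc, hGd, hGF, hGl⟩ := exists_log_of_tendsto_one hc hd h0 hl
  have hre : ∀ x : ℝ, (G x).re = Real.log ‖F x‖ := fun x => by
    rw [← hGF x (by simp), Complex.norm_exp, Real.log_exp]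
  have h := tendsto_schwarz_integral hGc hGd hGl hw
  simp only [hre] at h
  have h' := intervalIntegral_tendsto_integral hi tendsto_neg_atTop_atBot tendsto_id
  rw [tendsto_nhds_unique h' h, ← hGF w hw.le]
  congr 1
  have : (2 * Real.pi * Complex.I : ℂ) ≠ 0 := Complex.two_pi_I_ne_zero
  field_simp

end HalfPlane

/-! ### The transmission coefficient in the variable z -/

/-- The potential `x ↦ q̄(-x)` seen from the other end of the line. -/
def conjReflect (p : ℝ → ℂ) (x : ℝ) : ℂ := (starRingEnd ℂ) (p (-x))

theorem norm_conjReflect (p : ℝ → ℂ) (x : ℝ) : ‖conjReflect p x‖ = ‖p (-x)‖ := RCLike.norm_conj _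

theorem continuous_conjReflect {p : ℝ → ℂ} (hp : Continuous p) : Continuous (conjReflect p) :=
  Complex.continuous_conj.comp (hp.comp continuous_neg)

theorem integrable_conjReflect {p : ℝ → ℂ} (hp : Integrable p) : Integrable (conjReflect p) :=
  ContinuousLinearMap.integrable_comp (Complex.conjCLE : ℂ →L[ℝ] ℂ) hp.comp_neg

theorem contDiff_conjReflect {p : ℝ → ℂ} (hp : ContDiff ℝ 1 p) : ContDiff ℝ 1 (conjReflect p) :=
  Complex.conjCLE.contDiff.comp (hp.comp contDiff_neg)

theorem deriv_conjReflect {p : ℝ → ℂ} (hp : ContDiff ℝ 1 p) :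
    deriv (conjReflect p) = fun x => -conjReflect (deriv p) x := by
  funext x
  have h := ((hasDerivAt_of_contDiff_one hp (-x)).scomp x (hasDerivAt_neg x)).star
  simp only [neg_smul, one_smul, star_neg] at h
  exact h.deriv

/-- The scattering coefficient `s₁₁` as a function of `z = k²`. -/
def transmission (p : ℝ → ℂ) (z : ℂ) : ℂ :=
  jostEven p z 0 * jostEven (conjReflect p) z 0 -
    z * (jostOdd p z 0 * jostOdd (conjReflect p) z 0)

theorem transmission_zero (p : ℝ → ℂ) : transmission p 0 = 1 := by
  simp [transmission, jostEven_zero]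

theorem continuousOn_transmission {p : ℝ → ℂ} (hc : Continuous p) (hi : Integrable p) :
    ContinuousOn (transmission p) {z | 0 ≤ z.im} :=
  ((continuousOn_jostEven hc hi 0).mul (continuousOn_jostEven (continuous_conjReflect hc)
    (integrable_conjReflect hi) 0)).sub (continuousOn_id.mul ((continuousOn_jostOdd hc hi 0).mul
    (continuousOn_jostOdd (continuous_conjReflect hc) (integrable_conjReflect hi) 0)))

theorem differentiableOn_transmission {p : ℝ → ℂ} (hc : Continuous p) (hi : Integrable p) :
    DifferentiableOn ℂ (transmission p) {z | 0 < z.im} :=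
  ((differentiableOn_jostEven hc hi 0).mul (differentiableOn_jostEven (continuous_conjReflect hc)
    (integrable_conjReflect hi) 0)).sub (differentiableOn_id.mul
    ((differentiableOn_jostOdd hc hi 0).mul
    (differentiableOn_jostOdd (continuous_conjReflect hc) (integrable_conjReflect hi) 0)))

theorem integral_Ioi_conjReflect (p : ℝ → ℂ) :
    ∫ y in Ioi (0 : ℝ), ‖conjReflect p y‖ ^ 2 = ∫ y in Iic (0 : ℝ), ‖p y‖ ^ 2 := by
  have := integral_comp_neg_Ioi (0 : ℝ) fun y => ‖p y‖ ^ 2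
  rw [neg_zero] at this
  simp only [norm_conjReflect, this]

/-- The two even factors supply the phases of $\int_0^\infty|p|^2$ and $\int_{-\infty}^0|p|^2$,
which multiply to the full phase. The odd product equals $(zb)(z\tilde b)/z$ with both numerators
bounded, so it is $O(1/|z|)$. -/
theorem transmission_asymptotics {p : ℝ → ℂ} (hp : ContDiff ℝ 1 p) (hi : Integrable p)
    (hi' : Integrable (deriv p)) : ∃ C : ℝ, 0 ≤ C ∧ ∀ z : ℂ, 0 ≤ z.im → 1 ≤ ‖z‖ →
    ‖transmission p z - Complex.exp (-(Complex.I * ((1 / 2 * ∫ y, ‖p y‖ ^ 2 : ℝ) : ℂ)))‖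
      ≤ C / ‖z‖ := by
  obtain ⟨C₁, hC₁, h₁⟩ := jost_asymptotics hp hi hi'
  have hi'' : Integrable (deriv (conjReflect p)) := by
    rw [deriv_conjReflect hp]
    exact (integrable_conjReflect hi').neg
  obtain ⟨C₂, hC₂, h₂⟩ := jost_asymptotics (contDiff_conjReflect hp) (integrable_conjReflect hi)
    hi''
  refine ⟨C₁ * (1 + C₂) + C₂ + C₁ * C₂, by positivity, fun z hz hz1 => ?_⟩
  have hz0 : 0 < ‖z‖ := by linarith
  have hzne : z ≠ 0 := norm_pos_iff.1 hz0
  obtain ⟨a₁, b₁⟩ := h₁ z hz hzne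
  obtain ⟨a₂, b₂⟩ := h₂ z hz hzne
  rw [integral_Ioi_conjReflect] at a₂
  set m₁ := ∫ y in Ioi (0 : ℝ), ‖p y‖ ^ 2
  set m₂ := ∫ y in Iic (0 : ℝ), ‖p y‖ ^ 2
  set e₁ := Complex.exp (-(Complex.I / 2 * (m₁ : ℂ))) with he₁
  set e₂ := Complex.exp (-(Complex.I / 2 * (m₂ : ℂ))) with he₂
  have hsum : ∫ y, ‖p y‖ ^ 2 = m₂ + m₁ :=
    (intervalIntegral.integral_Iic_add_Ioi (integrable_norm_sq hp hi hi').integrableOn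
      (integrable_norm_sq hp hi hi').integrableOn).symm
  have hexp : Complex.exp (-(Complex.I * ((1 / 2 * ∫ y, ‖p y‖ ^ 2 : ℝ) : ℂ))) = e₁ * e₂ := by
    rw [he₁, he₂, ← Complex.exp_add, hsum]
    push_cast
    ring_nf
  have hn₁ : ‖e₁‖ = 1 := by rw [he₁, Complex.norm_exp]; simp
  have hn₂ : ‖e₂‖ = 1 := by rw [he₂, Complex.norm_exp]; simp
  have hle : ‖jostEven (conjReflect p) z 0‖ ≤ 1 + C₂ := by
    have h3 : C₂ / ‖z‖ ≤ C₂ := div_le_self hC₂ hz1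
    have h4 := norm_add_le e₂ (jostEven (conjReflect p) z 0 - e₂)
    rw [add_sub_cancel, hn₂] at h4
    linarith
  have hodd : ‖z * (jostOdd p z 0 * jostOdd (conjReflect p) z 0)‖ ≤ C₁ * C₂ / ‖z‖ := by
    have : z * (jostOdd p z 0 * jostOdd (conjReflect p) z 0) =
        (z * jostOdd p z 0) * (z * jostOdd (conjReflect p) z 0) / z := by
      field_simp
    rw [this, norm_div, norm_mul]
    gcongr
  have hdec : transmission p z - e₁ * e₂ =
      (jostEven p z 0 - e₁) * jostEven (conjReflect p) z 0 +
      e₁ * (jostEven (conjReflect p) z 0 - e₂) -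
      z * (jostOdd p z 0 * jostOdd (conjReflect p) z 0) := by
    rw [transmission]; ring
  rw [hexp, hdec]
  refine (norm_sub_le _ _).trans ((add_le_add ((norm_add_le _ _).trans
    (add_le_add (b := C₁ / ‖z‖ * (1 + C₂)) (d := C₂ / ‖z‖) ?_ ?_)) hodd).trans (le_of_eq ?_))
  · rw [norm_mul]
    gcongr
  · rw [norm_mul, hn₁, one_mul]
    exact a₂
  · ring

/-! ### Explicit Jost columns and the conjugation symmetry -/

section JostColumns

variable {q : ℝ → ℝ → ℂ} {t : ℝ} {k : ℂ}

theorem isJostColumn_iff {l : Filter ℝ} {j : Fin 2} {φ : ℝ → Fin 2 → ℂ} :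
    IsJostColumn q t k l j φ ↔
      (∀ x, HasDerivAt (fun x => φ x 0) (Complex.I * k ^ 2 * φ x 0 + k * q x t * φ x 1) x) ∧
      (∀ x, HasDerivAt (fun x => φ x 1)
        (-(k * (starRingEnd ℂ) (q x t)) * φ x 0 - Complex.I * k ^ 2 * φ x 1) x) ∧
      Tendsto (fun x => Complex.exp (-(Complex.I * theta x t k * pauli3 j j)) * φ x 0) l
        (𝓝 (Pi.single (M := fun _ => ℂ) j 1 0)) ∧
      Tendsto (fun x => Complex.exp (-(Complex.I * theta x t k * pauli3 j j)) * φ x 1) l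
        (𝓝 (Pi.single (M := fun _ => ℂ) j 1 1)) := by
  have h0 : ∀ x, (laxX q x t k).mulVec (φ x) 0 = Complex.I * k ^ 2 * φ x 0 + k * q x t * φ x 1 := by
    intro x
    simp [laxX, pauli3, potentialMatrix, Matrix.mulVec, dotProduct, Fin.sum_univ_two]
  have h1 : ∀ x, (laxX q x t k).mulVec (φ x) 1 =
      -(k * (starRingEnd ℂ) (q x t)) * φ x 0 - Complex.I * k ^ 2 * φ x 1 := by
    intro x
    simp [laxX, pauli3, potentialMatrix, Matrix.mulVec, dotProduct, Fin.sum_univ_two]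
    ring
  constructor
  · rintro ⟨h, h'⟩
    have h'' := tendsto_pi_nhds.1 h'
    exact ⟨fun x => h0 x ▸ (hasDerivAt_pi.1 (h x)) 0, fun x => h1 x ▸ (hasDerivAt_pi.1 (h x)) 1,
      h'' 0, h'' 1⟩
  · rintro ⟨d0, d1, l0, l1⟩
    refine ⟨fun x => hasDerivAt_pi.2 (Fin.forall_fin_two.2 ⟨?_, ?_⟩),
      tendsto_pi_nhds.2 (Fin.forall_fin_two.2 ⟨l0, l1⟩)⟩
    · rw [h0]; exact d0 x
    · rw [h1]; exact d1 x

@[simp] theorem pauli3_zero_zero : pauli3 0 0 = 1 := rfl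

@[simp] theorem pauli3_one_one : pauli3 1 1 = -1 := rfl

theorem hasDerivAt_theta (t : ℝ) (k : ℂ) (x : ℝ) :
    HasDerivAt (fun x : ℝ => theta x t k) (k ^ 2) x := by
  have := ((Complex.ofRealCLM.hasDerivAt (x := x)).sub_const (2 * k ^ 2 * (t : ℂ))).const_mul (k ^ 2)
  simpa [theta] using this

theorem hasDerivAt_exp_theta (t : ℝ) (k c : ℂ) (x : ℝ) :
    HasDerivAt (fun x : ℝ => Complex.exp (c * theta x t k))
      (c * k ^ 2 * Complex.exp (c * theta x t k)) x := by
  refine ((hasDerivAt_theta t k x).const_mul c).cexp.congr_deriv ?_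
  ring

/-- The explicit Jost column `Φ₊₁`. -/
def plusFirst (q : ℝ → ℝ → ℂ) (t : ℝ) (k : ℂ) (x : ℝ) : Fin 2 → ℂ :=
  ![Complex.exp (Complex.I * theta x t k) * jostEven (fun x => q x t) (k ^ 2) x,
    Complex.exp (Complex.I * theta x t k) * (k * jostOdd (fun x => q x t) (k ^ 2) x)]

/-- The explicit Jost column `Φ₋₂`. -/
def minusSecond (q : ℝ → ℝ → ℂ) (t : ℝ) (k : ℂ) (x : ℝ) : Fin 2 → ℂ :=
  ![Complex.exp (-Complex.I * theta x t k) *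
      (k * jostOdd (conjReflect fun x => q x t) (k ^ 2) (-x)),
    Complex.exp (-Complex.I * theta x t k) * jostEven (conjReflect fun x => q x t) (k ^ 2) (-x)]

theorem isJostColumn_plusFirst (hc : Continuous fun x => q x t) (hi : Integrable fun x => q x t)
    {M : ℝ} (hM : ∀ x, ‖q x t‖ ≤ M) (hk : 0 ≤ (k ^ 2).im) :
    IsJostColumn q t k atTop 0 (plusFirst q t k) := by
  have hexp : ∀ x, Complex.exp (-(Complex.I * theta x t k * pauli3 0 0)) *
      Complex.exp (Complex.I * theta x t k) = 1 := fun x => by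
    rw [← Complex.exp_add]; simp
  rw [isJostColumn_iff]
  refine ⟨fun x => ?_, fun x => ?_, ?_, ?_⟩
  · refine ((hasDerivAt_exp_theta t k Complex.I x).mul
      (hasDerivAt_jostEven hc hi hM hk x)).congr_deriv ?_
    simp only [plusFirst, Matrix.cons_val_zero, Matrix.cons_val_one]
    ring
  · refine ((hasDerivAt_exp_theta t k Complex.I x).mul
      ((hasDerivAt_jostOdd hc hi hM hk x).const_mul k)).congr_deriv ?_
    simp only [plusFirst, Matrix.cons_val_zero, Matrix.cons_val_one]
    ring
  · refine (tendsto_jostEven_atTop hc hi hk).congr fun x => ?_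
    simp only [plusFirst, Matrix.cons_val_zero]
    rw [← mul_assoc, hexp, one_mul]
  · have := (tendsto_jostOdd_atTop hc hi hk).const_mul k
    rw [mul_zero] at this
    refine this.congr fun x => ?_
    simp only [plusFirst, Matrix.cons_val_one, Matrix.cons_val_zero]
    rw [← mul_assoc, hexp, one_mul]

/-- Reflecting $x\mapsto-x$ and exchanging the two components turns the system for $q$ at $-\infty$
into the one for `conjReflect` at $+\infty$, already solved by the Neumann series. -/
theorem isJostColumn_minusSecond (hc : Continuous fun x => q x t) (hi : Integrable fun x => q x t)
    {M : ℝ} (hM : ∀ x, ‖q x t‖ ≤ M) (hk : 0 ≤ (k ^ 2).im) :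
    IsJostColumn q t k atBot 1 (minusSecond q t k) := by
  have hc' := continuous_conjReflect hc
  have hi' := integrable_conjReflect hi
  have hM' : ∀ x, ‖conjReflect (fun x => q x t) x‖ ≤ M := fun x => by
    rw [norm_conjReflect]; exact hM _
  have hexp : ∀ x, Complex.exp (-(Complex.I * theta x t k * pauli3 1 1)) *
      Complex.exp (-Complex.I * theta x t k) = 1 := fun x => by
    rw [← Complex.exp_add]; simp
  have hcr : ∀ x, conjReflect (fun x => q x t) (-x) = (starRingEnd ℂ) (q x t) := fun x => by
    simp [conjReflect]
  rw [isJostColumn_iff]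
  refine ⟨fun x => ?_, fun x => ?_, ?_, ?_⟩
  · have h := (hasDerivAt_jostOdd hc' hi' hM' hk (-x)).scomp x (hasDerivAt_neg x)
    refine ((hasDerivAt_exp_theta t k (-Complex.I) x).mul (h.const_mul k)).congr_deriv ?_
    simp only [minusSecond, Matrix.cons_val_zero, Matrix.cons_val_one, Function.comp, hcr,
      Complex.conj_conj, neg_smul, one_smul]
    ring
  · have h := (hasDerivAt_jostEven hc' hi' hM' hk (-x)).scomp x (hasDerivAt_neg x)
    refine ((hasDerivAt_exp_theta t k (-Complex.I) x).mul h).congr_deriv ?_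
    simp only [minusSecond, Matrix.cons_val_zero, Matrix.cons_val_one, Function.comp, hcr,
      neg_smul, one_smul]
    ring
  · have := ((tendsto_jostOdd_atTop hc' hi' hk).comp tendsto_neg_atBot_atTop).const_mul k
    rw [mul_zero] at this
    refine this.congr fun x => ?_
    simp only [minusSecond, Matrix.cons_val_zero]
    rw [← mul_assoc, hexp, one_mul]
    rfl
  · refine ((tendsto_jostEven_atTop hc' hi' hk).comp tendsto_neg_atBot_atTop).congr fun x => ?_
    simp only [minusSecond, Matrix.cons_val_one, Matrix.cons_val_zero]
    rw [← mul_assoc, hexp, one_mul]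
    rfl

theorem theta_conj (x t : ℝ) (k : ℂ) :
    (starRingEnd ℂ) (theta x t ((starRingEnd ℂ) k)) = theta x t k := by
  simp [theta, map_ofNat]

/-- The symmetry `k ↦ k̄` maps first columns to second columns. -/
theorem IsJostColumn.conj_first {l : Filter ℝ} {φ : ℝ → Fin 2 → ℂ}
    (h : IsJostColumn q t ((starRingEnd ℂ) k) l 0 φ) :
    IsJostColumn q t k l 1 fun x => ![-(starRingEnd ℂ) (φ x 1), (starRingEnd ℂ) (φ x 0)] := by
  rw [isJostColumn_iff] at h ⊢
  obtain ⟨d0, d1, l0, l1⟩ := h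
  have hexp : ∀ x, (starRingEnd ℂ) (Complex.exp
      (-(Complex.I * theta x t ((starRingEnd ℂ) k)))) =
      Complex.exp (Complex.I * theta x t k) := fun x => by
    rw [← Complex.exp_conj]
    simp [theta_conj]
  refine ⟨fun x => ?_, fun x => ?_, ?_, ?_⟩
  · refine (d1 x).star.neg.congr_deriv ?_
    simp
  · refine (d0 x).star.congr_deriv ?_
    simp
    ring
  · have := ((Complex.continuous_conj.tendsto _).comp l1).neg
    simpa [Function.comp_def, hexp] using this
  · have := ((Complex.continuous_conj.tendsto _).comp l0)
    simpa [Function.comp_def, hexp] using this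

/-- The symmetry `k ↦ k̄` maps second columns to first columns. -/
theorem IsJostColumn.conj_second {l : Filter ℝ} {φ : ℝ → Fin 2 → ℂ}
    (h : IsJostColumn q t ((starRingEnd ℂ) k) l 1 φ) :
    IsJostColumn q t k l 0 fun x => ![(starRingEnd ℂ) (φ x 1), -(starRingEnd ℂ) (φ x 0)] := by
  rw [isJostColumn_iff] at h ⊢
  obtain ⟨d0, d1, l0, l1⟩ := h
  have hexp : ∀ x, (starRingEnd ℂ) (Complex.exp
      (Complex.I * theta x t ((starRingEnd ℂ) k))) =
      Complex.exp (-(Complex.I * theta x t k)) := fun x => by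
    rw [← Complex.exp_conj]
    simp [theta_conj]
  refine ⟨fun x => ?_, fun x => ?_, ?_, ?_⟩
  · refine (d1 x).star.congr_deriv ?_
    simp
    ring
  · refine (d0 x).star.neg.congr_deriv ?_
    simp
  · have := ((Complex.continuous_conj.tendsto _).comp l1)
    simpa [Function.comp_def, hexp] using this
  · have := ((Complex.continuous_conj.tendsto _).comp l0).neg
    simpa [Function.comp_def, hexp] using this

end JostColumns

/-! ### Uniqueness of the Jost columns -/

section Uniqueness

variable {q : ℝ → ℝ → ℂ} {t : ℝ} {k : ℂ}

/-- The energy estimate with limit $0$ at $+\infty$ forces the energy to vanish identically. -/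
theorem eq_zero_of_energy {u v a b : ℝ → ℂ} {e : ℂ} (ha : Continuous a) (hai : Integrable a)
    (hab : ∀ x, ‖b x‖ = ‖a x‖) (he : 0 ≤ e.re)
    (hu : ∀ x, HasDerivAt u (a x * v x) x) (hv : ∀ x, HasDerivAt v (e * v x + b x * u x) x)
    (hul : Tendsto u atTop (𝓝 0)) (hvl : Tendsto v atTop (𝓝 0)) (x : ℝ) : u x = 0 ∧ v x = 0 := by
  have h := energy_le (κ := fun x => ‖a x‖) (l := 0) (by fun_prop) hai.norm hu hv he
    (fun x => ?_) (fun x => ?_) (fun x => norm_nonneg _)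
    (by simpa using (hul.norm.pow 2).add (hvl.norm.pow 2)) x
  · rw [zero_mul] at h
    have h1 : ‖u x‖ = 0 := by nlinarith [norm_nonneg (u x), sq_nonneg ‖v x‖]
    have h2 : ‖v x‖ = 0 := by nlinarith [norm_nonneg (v x), sq_nonneg ‖u x‖]
    exact ⟨norm_eq_zero.1 h1, norm_eq_zero.1 h2⟩
  · rw [norm_mul]
    gcongr
    linarith [norm_nonneg (u x)]
  · rw [norm_mul, hab]
    gcongr
    linarith [norm_nonneg (v x)]

/-- After multiplication by $e^{-i\theta}$ the difference of two such columns tends to $0$ and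
solves a system whose only diagonal coefficient $-2ik^2$ has nonnegative real part. -/
theorem IsJostColumn.eq_of_atTop_zero (hc : Continuous fun x => q x t)
    (hi : Integrable fun x => q x t) (hk : 0 ≤ (k ^ 2).im) {φ ψ : ℝ → Fin 2 → ℂ}
    (hφ : IsJostColumn q t k atTop 0 φ) (hψ : IsJostColumn q t k atTop 0 ψ) : φ = ψ := by
  rw [isJostColumn_iff] at hφ hψ
  obtain ⟨d0, d1, l0, l1⟩ := hφ
  obtain ⟨d0', d1', l0', l1'⟩ := hψ
  have hE : ∀ x, -(Complex.I * theta x t k * pauli3 0 0) = -Complex.I * theta x t k :=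
    fun x => by simp
  simp only [hE] at l0 l1 l0' l1'
  funext x
  have hz := eq_zero_of_energy
    (u := fun x => Complex.exp (-Complex.I * theta x t k) * (φ x 0 - ψ x 0))
    (v := fun x => Complex.exp (-Complex.I * theta x t k) * (φ x 1 - ψ x 1))
    (a := fun x => k * q x t) (b := fun x => -(k * (starRingEnd ℂ) (q x t)))
    (e := -(2 * Complex.I * k ^ 2)) (by fun_prop) (hi.const_mul k) (by simp)
    (by rw [Complex.neg_re]; linarith [re_two_I_mul_nonpos hk])
    (fun x => ((hasDerivAt_exp_theta t k (-Complex.I) x).mul ((d0 x).sub (d0' x))).congr_deriv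
      (by simp only [Pi.sub_apply]; ring))
    (fun x => ((hasDerivAt_exp_theta t k (-Complex.I) x).mul ((d1 x).sub (d1' x))).congr_deriv
      (by simp only [Pi.sub_apply]; ring))
    (by simpa only [mul_sub, sub_self] using l0.sub l0')
    (by simpa only [mul_sub, sub_self] using l1.sub l1') x
  have hne := Complex.exp_ne_zero (-Complex.I * theta x t k)
  funext i
  fin_cases i
  · exact sub_eq_zero.1 ((mul_eq_zero.1 hz.1).resolve_left hne)
  · exact sub_eq_zero.1 ((mul_eq_zero.1 hz.2).resolve_left hne)

theorem IsJostColumn.eq_of_atBot_one (hc : Continuous fun x => q x t)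
    (hi : Integrable fun x => q x t) (hk : 0 ≤ (k ^ 2).im) {φ ψ : ℝ → Fin 2 → ℂ}
    (hφ : IsJostColumn q t k atBot 1 φ) (hψ : IsJostColumn q t k atBot 1 ψ) : φ = ψ := by
  rw [isJostColumn_iff] at hφ hψ
  obtain ⟨d0, d1, l0, l1⟩ := hφ
  obtain ⟨d0', d1', l0', l1'⟩ := hψ
  have hE : ∀ x, -(Complex.I * theta x t k * pauli3 1 1) = Complex.I * theta x t k :=
    fun x => by simp
  simp only [hE] at l0 l1 l0' l1'
  funext x
  have hz := eq_zero_of_energy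
    (u := fun x => Complex.exp (Complex.I * theta (-x) t k) * (φ (-x) 1 - ψ (-x) 1))
    (v := fun x => Complex.exp (Complex.I * theta (-x) t k) * (φ (-x) 0 - ψ (-x) 0))
    (a := fun x => k * (starRingEnd ℂ) (q (-x) t)) (b := fun x => -(k * q (-x) t))
    (e := -(2 * Complex.I * k ^ 2))
    (continuous_const.mul (continuous_conjReflect hc))
    ((integrable_conjReflect hi).const_mul k) (by simp)
    (by rw [Complex.neg_re]; linarith [re_two_I_mul_nonpos hk])
    (fun x => (((hasDerivAt_exp_theta t k Complex.I (-x)).mul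
      ((d1 (-x)).sub (d1' (-x)))).scomp x (hasDerivAt_neg x)).congr_deriv
      (by simp only [Pi.sub_apply, neg_smul, one_smul]; ring))
    (fun x => (((hasDerivAt_exp_theta t k Complex.I (-x)).mul
      ((d0 (-x)).sub (d0' (-x)))).scomp x (hasDerivAt_neg x)).congr_deriv
      (by simp only [Pi.sub_apply, neg_smul, one_smul]; ring))
    (by simpa only [mul_sub, sub_self, Function.comp_def] using
      (l1.sub l1').comp tendsto_neg_atTop_atBot)
    (by simpa only [mul_sub, sub_self, Function.comp_def] using
      (l0.sub l0').comp tendsto_neg_atTop_atBot) (-x)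
  simp only [neg_neg] at hz
  have hne := Complex.exp_ne_zero (Complex.I * theta x t k)
  funext i
  fin_cases i
  · exact sub_eq_zero.1 ((mul_eq_zero.1 hz.2).resolve_left hne)
  · exact sub_eq_zero.1 ((mul_eq_zero.1 hz.1).resolve_left hne)

theorem conj_sq_im (k : ℂ) : ((starRingEnd ℂ) k ^ 2).im = -(k ^ 2).im := by
  rw [← map_pow, Complex.conj_im]

/-- The symmetry $k\mapsto\bar k$ exchanges the sign of $\mathrm{Im}(k^2)$ and the two columns,
reducing to the first column. -/
theorem IsJostColumn.eq_of_atTop_one (hc : Continuous fun x => q x t)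
    (hi : Integrable fun x => q x t) (hk : (k ^ 2).im ≤ 0) {φ ψ : ℝ → Fin 2 → ℂ}
    (hφ : IsJostColumn q t k atTop 1 φ) (hψ : IsJostColumn q t k atTop 1 ψ) : φ = ψ := by
  rw [← Complex.conj_conj k] at hφ hψ
  have h := hφ.conj_second.eq_of_atTop_zero hc hi (by rw [conj_sq_im]; linarith) hψ.conj_second
  funext x i
  have h0 := congrFun (congrFun h x) 0
  have h1 := congrFun (congrFun h x) 1
  fin_cases i
  · exact (starRingEnd ℂ).injective (by simpa using h1)
  · exact (starRingEnd ℂ).injective (by simpa using h0)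

theorem IsJostColumn.eq_of_atBot_zero (hc : Continuous fun x => q x t)
    (hi : Integrable fun x => q x t) (hk : (k ^ 2).im ≤ 0) {φ ψ : ℝ → Fin 2 → ℂ}
    (hφ : IsJostColumn q t k atBot 0 φ) (hψ : IsJostColumn q t k atBot 0 ψ) : φ = ψ := by
  rw [← Complex.conj_conj k] at hφ hψ
  have h := hφ.conj_first.eq_of_atBot_one hc hi (by rw [conj_sq_im]; linarith) hψ.conj_first
  funext x i
  have h0 := congrFun (congrFun h x) 0
  have h1 := congrFun (congrFun h x) 1
  fin_cases i
  · exact (starRingEnd ℂ).injective (by simpa using h1)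
  · exact (starRingEnd ℂ).injective (by simpa using h0)

theorem isJostColumn_jostColumn {l : Filter ℝ} {j : Fin 2} {φ : ℝ → Fin 2 → ℂ}
    (h : IsJostColumn q t k l j φ) : IsJostColumn q t k l j (jostColumn q t k l j) :=
  Classical.epsilon_spec (p := IsJostColumn q t k l j) ⟨φ, h⟩

theorem wronskian_plusFirst_minusSecond (q : ℝ → ℝ → ℂ) (t : ℝ) (k : ℂ) :
    wronskian (plusFirst q t k 0) (minusSecond q t k 0) =
      transmission (fun x => q x t) (k ^ 2) := by
  have h : Complex.exp (Complex.I * theta 0 t k) * Complex.exp (-Complex.I * theta 0 t k) = 1 := by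
    rw [← Complex.exp_add]; simp
  simp only [wronskian, plusFirst, minusSecond, transmission, Matrix.cons_val_zero,
    Matrix.cons_val_one, neg_zero]
  linear_combination (jostEven (fun x => q x t) (k ^ 2) 0 *
    jostEven (conjReflect fun x => q x t) (k ^ 2) 0 - k ^ 2 *
    (jostOdd (fun x => q x t) (k ^ 2) 0 * jostOdd (conjReflect fun x => q x t) (k ^ 2) 0)) * h

variable (hc : Continuous fun x => q x t) (hi : Integrable fun x => q x t)
  {M : ℝ} (hM : ∀ x, ‖q x t‖ ≤ M)
include hc hi hM

/-- Existence makes the choice behind `jostColumn` a genuine Jost column and uniqueness makes it the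
explicit one. -/
theorem jostColumn_atTop_zero (hk : 0 ≤ (k ^ 2).im) :
    jostColumn q t k atTop 0 = plusFirst q t k :=
  (isJostColumn_jostColumn (isJostColumn_plusFirst hc hi hM hk)).eq_of_atTop_zero hc hi hk
    (isJostColumn_plusFirst hc hi hM hk)

theorem jostColumn_atBot_one (hk : 0 ≤ (k ^ 2).im) :
    jostColumn q t k atBot 1 = minusSecond q t k :=
  (isJostColumn_jostColumn (isJostColumn_minusSecond hc hi hM hk)).eq_of_atBot_one hc hi hk
    (isJostColumn_minusSecond hc hi hM hk)

theorem isJostColumn_plusSecond (hk : (k ^ 2).im ≤ 0) : IsJostColumn q t k atTop 1 fun x =>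
    ![-(starRingEnd ℂ) (plusFirst q t ((starRingEnd ℂ) k) x 1),
      (starRingEnd ℂ) (plusFirst q t ((starRingEnd ℂ) k) x 0)] :=
  (isJostColumn_plusFirst hc hi hM (by rw [conj_sq_im]; linarith)).conj_first

theorem isJostColumn_minusFirst (hk : (k ^ 2).im ≤ 0) : IsJostColumn q t k atBot 0 fun x =>
    ![(starRingEnd ℂ) (minusSecond q t ((starRingEnd ℂ) k) x 1),
      -(starRingEnd ℂ) (minusSecond q t ((starRingEnd ℂ) k) x 0)] :=
  (isJostColumn_minusSecond hc hi hM (by rw [conj_sq_im]; linarith)).conj_second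

theorem jostColumn_atTop_one (hk : (k ^ 2).im ≤ 0) : jostColumn q t k atTop 1 = fun x =>
    ![-(starRingEnd ℂ) (plusFirst q t ((starRingEnd ℂ) k) x 1),
      (starRingEnd ℂ) (plusFirst q t ((starRingEnd ℂ) k) x 0)] :=
  (isJostColumn_jostColumn (isJostColumn_plusSecond hc hi hM hk)).eq_of_atTop_one hc hi hk
    (isJostColumn_plusSecond hc hi hM hk)

theorem jostColumn_atBot_zero (hk : (k ^ 2).im ≤ 0) : jostColumn q t k atBot 0 = fun x =>
    ![(starRingEnd ℂ) (minusSecond q t ((starRingEnd ℂ) k) x 1),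
      -(starRingEnd ℂ) (minusSecond q t ((starRingEnd ℂ) k) x 0)] :=
  (isJostColumn_jostColumn (isJostColumn_minusFirst hc hi hM hk)).eq_of_atBot_zero hc hi hk
    (isJostColumn_minusFirst hc hi hM hk)

theorem s11_eq_transmission (hk : 0 ≤ (k ^ 2).im) :
    s11 q t k = transmission (fun x => q x t) (k ^ 2) := by
  rw [s11, jostColumn_atTop_zero hc hi hM hk, jostColumn_atBot_one hc hi hM hk,
    wronskian_plusFirst_minusSecond]

theorem s22_eq_conj_transmission (hk : (k ^ 2).im ≤ 0) :
    s22 q t k = (starRingEnd ℂ) (transmission (fun x => q x t) ((starRingEnd ℂ) (k ^ 2))) := by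
  rw [s22, jostColumn_atTop_one hc hi hM hk, jostColumn_atBot_zero hc hi hM hk, map_pow,
    ← wronskian_plusFirst_minusSecond]
  simp [wronskian]
  ring

end Uniqueness

/-! ### The scattering matrix on the contour -/

section Scattering

variable {q : ℝ → ℝ → ℂ} {t : ℝ} {k : ℂ}

theorem wronskian_const {l l' : Filter ℝ} {j j' : Fin 2} {φ ψ : ℝ → Fin 2 → ℂ}
    (hφ : IsJostColumn q t k l j φ) (hψ : IsJostColumn q t k l' j' ψ) (x y : ℝ) :
    wronskian (φ x) (ψ x) = wronskian (φ y) (ψ y) := by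
  rw [isJostColumn_iff] at hφ hψ
  obtain ⟨d0, d1, -, -⟩ := hφ
  obtain ⟨d0', d1', -, -⟩ := hψ
  have hd : ∀ x, HasDerivAt (fun x => wronskian (φ x) (ψ x)) 0 x := fun x =>
    (((d0 x).mul (d1' x)).sub ((d1 x).mul (d0' x))).congr_deriv (by ring)
  exact is_const_of_deriv_eq_zero (fun x => (hd x).differentiableAt) (fun x => (hd x).deriv) x y

/-- The Wronskian is constant, and the normalising factors $e^{\mp i\theta}$ of the two columns
cancel in it, so its value can be read off from the asymptotics. -/
theorem wronskian_eq_one {l : Filter ℝ} [l.NeBot] {φ ψ : ℝ → Fin 2 → ℂ}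
    (hφ : IsJostColumn q t k l 0 φ) (hψ : IsJostColumn q t k l 1 ψ) (x : ℝ) :
    wronskian (φ x) (ψ x) = 1 := by
  have hconst := wronskian_const hφ hψ
  rw [isJostColumn_iff] at hφ hψ
  obtain ⟨-, -, l0, l1⟩ := hφ
  obtain ⟨-, -, l0', l1'⟩ := hψ
  have h := (l0.mul l1').sub (l1.mul l0')
  have h' : Tendsto (fun y => wronskian (φ y) (ψ y)) l (𝓝 1) := by
    rw [Pi.single_eq_same, Pi.single_eq_same, Pi.single_eq_of_ne one_ne_zero, zero_mul, mul_one,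
      sub_zero] at h
    refine h.congr fun y => ?_
    have he : Complex.exp (-(Complex.I * theta y t k * pauli3 0 0)) *
        Complex.exp (-(Complex.I * theta y t k * pauli3 1 1)) = 1 := by
      rw [← Complex.exp_add]; simp
    rw [wronskian]
    linear_combination (φ y 0 * ψ y 1 - φ y 1 * ψ y 0) * he
  have h'' : Tendsto (fun y => wronskian (φ y) (ψ y)) l (𝓝 (wronskian (φ x) (ψ x))) :=
    tendsto_const_nhds.congr fun y => hconst x y
  exact tendsto_nhds_unique h'' h'

theorem sq_im_eq_zero_of_mem_contour (hk : k ∈ contour) : (k ^ 2).im = 0 := by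
  rw [sq, Complex.mul_im]
  rcases hk with h | h <;> rw [h] <;> ring

/-- On the contour, the diagonal entries of the scattering matrix are the Wronskians `s₁₁`, `s₂₂`,
and the scattering matrix is unimodular. -/
theorem scatteringMatrix_spec (hc : Continuous fun x => q x t) (hi : Integrable fun x => q x t)
    {M : ℝ} (hM : ∀ x, ‖q x t‖ ≤ M) (hk : k ∈ contour) :
    scatteringMatrix q t k 0 0 = s11 q t k ∧ scatteringMatrix q t k 1 1 = s22 q t k ∧
      scatteringMatrix q t k 0 0 * scatteringMatrix q t k 1 1 -
        scatteringMatrix q t k 0 1 * scatteringMatrix q t k 1 0 = 1 := by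
  have h0 := sq_im_eq_zero_of_mem_contour hk
  have p1 := isJostColumn_jostColumn (isJostColumn_plusFirst hc hi hM h0.ge)
  have p2 := isJostColumn_jostColumn (isJostColumn_plusSecond hc hi hM h0.le)
  have m1 := isJostColumn_jostColumn (isJostColumn_minusFirst hc hi hM h0.le)
  have m2 := isJostColumn_jostColumn (isJostColumn_minusSecond hc hi hM h0.ge)
  set φ₁ := jostColumn q t k atTop 0 with hφ₁
  set φ₂ := jostColumn q t k atTop 1 with hφ₂
  set ψ₁ := jostColumn q t k atBot 0 with hψ₁
  set ψ₂ := jostColumn q t k atBot 1 with hψ₂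
  have hψ := wronskian_eq_one m1 m2
  have hφ := wronskian_eq_one p1 p2
  have hex : ∃ S : Matrix (Fin 2) (Fin 2) ℂ, ∀ x : ℝ,
      jostMatrix q t k atTop x = jostMatrix q t k atBot x * S := by
    -- Cramer's rule: $\Phi_-$ has determinant 1, so the coefficients of $\Phi_+$ in its columns are
    -- Wronskians, and these do not depend on $x$.
    refine ⟨!![wronskian (φ₁ 0) (ψ₂ 0), wronskian (φ₂ 0) (ψ₂ 0);
      wronskian (ψ₁ 0) (φ₁ 0), wronskian (ψ₁ 0) (φ₂ 0)], fun x => ?_⟩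
    rw [wronskian_const p1 m2 0 x, wronskian_const p2 m2 0 x, wronskian_const m1 p1 0 x,
      wronskian_const m1 p2 0 x]
    have := hψ x
    rw [wronskian] at this
    ext i j
    fin_cases i <;> fin_cases j <;>
      simp [jostMatrix, Matrix.mul_apply, Fin.sum_univ_two, wronskian, ← hφ₁, ← hφ₂, ← hψ₁, ← hψ₂]
    · linear_combination (-(φ₁ x 0)) * this
    · linear_combination (-(φ₂ x 0)) * this
    · linear_combination (-(φ₁ x 1)) * this
    · linear_combination (-(φ₂ x 1)) * this
  -- The relation at $x=0$ alone determines the chosen matrix, since $\Phi_-(0)$ is invertible.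
  have hS := Classical.epsilon_spec hex 0
  change jostMatrix q t k atTop 0 = jostMatrix q t k atBot 0 * scatteringMatrix q t k at hS
  have hS' : ∀ i j, jostMatrix q t k atTop 0 i j =
      jostMatrix q t k atBot 0 i 0 * scatteringMatrix q t k 0 j +
      jostMatrix q t k atBot 0 i 1 * scatteringMatrix q t k 1 j := fun i j => by
    rw [hS, Matrix.mul_apply, Fin.sum_univ_two]
  have e00 : φ₁ 0 0 = ψ₁ 0 0 * scatteringMatrix q t k 0 0 + ψ₂ 0 0 * scatteringMatrix q t k 1 0 :=
    hS' 0 0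
  have e10 : φ₁ 0 1 = ψ₁ 0 1 * scatteringMatrix q t k 0 0 + ψ₂ 0 1 * scatteringMatrix q t k 1 0 :=
    hS' 1 0
  have e01 : φ₂ 0 0 = ψ₁ 0 0 * scatteringMatrix q t k 0 1 + ψ₂ 0 0 * scatteringMatrix q t k 1 1 :=
    hS' 0 1
  have e11 : φ₂ 0 1 = ψ₁ 0 1 * scatteringMatrix q t k 0 1 + ψ₂ 0 1 * scatteringMatrix q t k 1 1 :=
    hS' 1 1
  have w1 := hψ 0
  have w2 := hφ 0
  rw [wronskian] at w1 w2
  refine ⟨?_, ?_, ?_⟩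
  · change _ = wronskian (φ₁ 0) (ψ₂ 0)
    rw [wronskian, e00, e10]
    linear_combination (-(scatteringMatrix q t k 0 0)) * w1
  · change _ = wronskian (ψ₁ 0) (φ₂ 0)
    rw [wronskian, e01, e11]
    linear_combination (-(scatteringMatrix q t k 1 1)) * w1
  · rw [e00, e10, e01, e11] at w2
    linear_combination w2 - (scatteringMatrix q t k 0 0 * scatteringMatrix q t k 1 1 -
        scatteringMatrix q t k 0 1 * scatteringMatrix q t k 1 0) * w1

theorem s22_eq_conj_s11_of_mem_contour (hc : Continuous fun x => q x t)
    (hi : Integrable fun x => q x t) {M : ℝ} (hM : ∀ x, ‖q x t‖ ≤ M) (hk : k ∈ contour) :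
    s22 q t k = (starRingEnd ℂ) (s11 q t k) := by
  have h0 := sq_im_eq_zero_of_mem_contour hk
  rw [s22_eq_conj_transmission hc hi hM h0.le, s11_eq_transmission hc hi hM h0.ge,
    Complex.conj_eq_iff_im.2 h0]

/-- On the contour, `log (1 - ρ ρ̃) = -2 log |s₁₁|`. -/
theorem log_one_sub_rho_mul (hc : Continuous fun x => q x t) (hi : Integrable fun x => q x t)
    {M : ℝ} (hM : ∀ x, ‖q x t‖ ≤ M) (hk : k ∈ contour) (hs : scatteringMatrix q t k 0 0 ≠ 0) :
    Complex.log (1 - rho q t k * rhoTilde q t k) =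
      ((-(2 * Real.log ‖transmission (fun x => q x t) (k ^ 2)‖) : ℝ) : ℂ) := by
  obtain ⟨h1, h2, h3⟩ := scatteringMatrix_spec hc hi hM hk
  have h4 := s22_eq_conj_s11_of_mem_contour hc hi hM hk
  have hs' : scatteringMatrix q t k 1 1 ≠ 0 := by
    rw [h2, h4, ← h1]
    exact (map_ne_zero _).2 hs
  -- By $\det S=1$; as $S_{22}=\overline{S_{11}}$, the right side is $|s_{11}|^{-2}>0$, and the
  -- principal logarithm is the real one.
  have h5 : 1 - rho q t k * rhoTilde q t k =
      (scatteringMatrix q t k 0 0 * scatteringMatrix q t k 1 1)⁻¹ := by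
    rw [rho, rhoTilde]
    field_simp
    linear_combination h3
  have h6 : scatteringMatrix q t k 0 0 * scatteringMatrix q t k 1 1 =
      ((‖s11 q t k‖ ^ 2 : ℝ) : ℂ) := by
    rw [h1, h2, h4, Complex.mul_conj, Complex.normSq_eq_norm_sq]
  rw [h5, h6, ← Complex.ofReal_inv, ← Complex.ofReal_log (by positivity), Real.log_inv,
    Real.log_pow, s11_eq_transmission hc hi hM (sq_im_eq_zero_of_mem_contour hk).ge]
  push_cast
  rfl

end Scattering

/-! ### Dividing out double zeros -/

section Zeros

theorem isOpen_upper : IsOpen {z : ℂ | 0 < z.im} := isOpen_lt continuous_const Complex.continuous_im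

theorem upper_mem_nhds {z : ℂ} (hz : 0 < z.im) : {z : ℂ | 0 ≤ z.im} ∈ 𝓝 z :=
  mem_of_superset (isOpen_upper.mem_nhds hz) fun w hw => show (0 : ℝ) ≤ w.im from le_of_lt hw

/-- A double zero in the upper half-plane can be divided out. -/
theorem exists_eq_sq_mul {a : ℂ → ℂ} (hc : ContinuousOn a {z | 0 ≤ z.im})
    (hd : DifferentiableOn ℂ a {z | 0 < z.im}) {z₀ : ℂ} (hz₀ : 0 < z₀.im)
    (hord : 2 ≤ analyticOrderAt a z₀) : ∃ b : ℂ → ℂ, ContinuousOn b {z | 0 ≤ z.im} ∧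
      DifferentiableOn ℂ b {z | 0 < z.im} ∧ ∀ w, a w = (w - z₀) ^ 2 * b w := by
  have hop := isOpen_upper.mem_nhds hz₀
  have ha : AnalyticAt ℂ a z₀ := hd.analyticAt hop
  have hder := (natCast_le_analyticOrderAt_iff_iteratedDeriv_eq_zero (n := 2) ha).1
    (by exact_mod_cast hord)
  have h0 : a z₀ = 0 := by simpa using hder 0 (by norm_num)
  have h1 : deriv a z₀ = 0 := by simpa using hder 1 (by norm_num)
  have hd₁ : DifferentiableOn ℂ (dslope a z₀) {z | 0 < z.im} :=
    (Complex.differentiableOn_dslope hop).2 hd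
  have hc₁ : ContinuousOn (dslope a z₀) {z | 0 ≤ z.im} :=
    (continuousOn_dslope (upper_mem_nhds hz₀)).2 ⟨hc, hd.differentiableAt hop⟩
  -- Taking the slope at $z_0$ twice divides by $(w-z_0)^2$, since $a(z_0)=a'(z_0)=0$; slopes keep
  -- holomorphy inside and continuity up to the real line.
  refine ⟨dslope (dslope a z₀) z₀, (continuousOn_dslope (upper_mem_nhds hz₀)).2
    ⟨hc₁, hd₁.differentiableAt hop⟩, (Complex.differentiableOn_dslope hop).2 hd₁, fun w => ?_⟩
  have e1 := sub_smul_dslope a z₀ w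
  have e2 := sub_smul_dslope (dslope a z₀) z₀ w
  rw [dslope_same, h1, smul_eq_mul, sub_zero] at e2
  rw [smul_eq_mul, h0, sub_zero] at e1
  rw [sq, mul_assoc, e2, e1]

/-- Finitely many double zeros in the upper half-plane can be divided out. -/
theorem exists_eq_prod_mul {ι : Type*} {a : ℂ → ℂ} (hc : ContinuousOn a {z | 0 ≤ z.im})
    (hd : DifferentiableOn ℂ a {z | 0 < z.im}) {l : ι → ℂ} (hl : Function.Injective l)
    (s : Finset ι) (hpos : ∀ i ∈ s, 0 < (l i).im) (hord : ∀ i ∈ s, analyticOrderAt a (l i) = 2) :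
    ∃ b : ℂ → ℂ, ContinuousOn b {z | 0 ≤ z.im} ∧ DifferentiableOn ℂ b {z | 0 < z.im} ∧
      (∀ w, a w = (∏ i ∈ s, (w - l i) ^ 2) * b w) ∧ ∀ i ∈ s, b (l i) ≠ 0 := by
  classical
  have hP : ∀ (s : Finset ι) (z : ℂ), AnalyticAt ℂ (fun w => ∏ i ∈ s, (w - l i) ^ 2) z :=
    fun s z => by fun_prop
  have hex : ∀ s : Finset ι, (∀ i ∈ s, 0 < (l i).im) → (∀ i ∈ s, analyticOrderAt a (l i) = 2) →
      ∃ b : ℂ → ℂ, ContinuousOn b {z | 0 ≤ z.im} ∧ DifferentiableOn ℂ b {z | 0 < z.im} ∧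
      ∀ w, a w = (∏ i ∈ s, (w - l i) ^ 2) * b w := by
    intro s
    induction s using Finset.induction_on with
    | empty => exact fun _ _ => ⟨a, hc, hd, by simp⟩
    | insert i₀ s hi₀ ih =>
      intro hpos hord
      obtain ⟨b, hbc, hbd, hb⟩ := ih (fun i hi => hpos i (Finset.mem_insert_of_mem hi))
        (fun i hi => hord i (Finset.mem_insert_of_mem hi))
      have hp := hpos i₀ (Finset.mem_insert_self _ _)
      have hba : AnalyticAt ℂ b (l i₀) := hbd.analyticAt (isOpen_upper.mem_nhds hp)
      have hone : analyticOrderAt (fun w => ∏ i ∈ s, (w - l i) ^ 2) (l i₀) = 0 := by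
        rw [(hP s _).analyticOrderAt_eq_zero]
        refine Finset.prod_ne_zero_iff.2 fun i hi => pow_ne_zero _ (sub_ne_zero.2 fun h => hi₀ ?_)
        rwa [hl h]
      have hab : a = (fun w => ∏ i ∈ s, (w - l i) ^ 2) * b := funext hb
      have hordb : analyticOrderAt b (l i₀) = 2 := by
        have := hord i₀ (Finset.mem_insert_self _ _)
        rwa [hab, analyticOrderAt_mul (hP s _) hba, hone, zero_add] at this
      obtain ⟨c, hcc, hcd, hcb⟩ := exists_eq_sq_mul hbc hbd hp hordb.ge
      refine ⟨c, hcc, hcd, fun w => ?_⟩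
      rw [hb, hcb, Finset.prod_insert hi₀]
      ring
  obtain ⟨b, hbc, hbd, hb⟩ := hex s hpos hord
  refine ⟨b, hbc, hbd, hb, fun i hi h0 => ?_⟩
  have hba : AnalyticAt ℂ b (l i) := hbd.analyticAt (isOpen_upper.mem_nhds (hpos i hi))
  have hab : a = (fun w => ∏ i ∈ s, (w - l i) ^ 2) * b := funext hb
  -- Orders add: a further zero of the quotient would raise the order of `a` from 2 to at least 3.
  have h1 : 1 ≤ analyticOrderAt b (l i) :=
    Order.one_le_iff_pos.2 (pos_iff_ne_zero.2 (hba.analyticOrderAt_ne_zero.2 h0))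
  have h2 : 2 ≤ analyticOrderAt (fun w => ∏ i ∈ s, (w - l i) ^ 2) (l i) := by
    refine (natCast_le_analyticOrderAt (n := 2) (hP s _)).2
      ⟨fun w => ∏ j ∈ s.erase i, (w - l j) ^ 2, by fun_prop, Eventually.of_forall fun w => ?_⟩
    rw [smul_eq_mul, Finset.mul_prod_erase s (fun j => (w - l j) ^ 2) hi]
  have h3 := hord i hi
  rw [hab, analyticOrderAt_mul (hP s _) hba] at h3
  have h4 : (3 : ℕ∞) ≤ 2 := by
    rw [← h3]
    calc (3 : ℕ∞) = 2 + 1 := by norm_num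
      _ ≤ _ := add_le_add h2 h1
  exact absurd h4 (by decide)

end Zeros

/-! ### Decay of the density and integrability -/

section RealIntegrals

theorem abs_log_le {y : ℝ} (hy : 1 / 2 ≤ y) : |Real.log y| ≤ 2 * |y - 1| := by
  have hy0 : 0 < y := by linarith
  have h1 := Real.log_le_sub_one_of_pos hy0
  have h2 := Real.one_sub_inv_le_log_of_pos hy0
  have h3 : 1 - y⁻¹ = (y - 1) / y := by field_simp
  rw [h3] at h2
  have h4 : -(2 * |y - 1|) ≤ (y - 1) / y := by
    rw [le_div_iff₀ hy0]
    have h5 := neg_abs_le (y - 1)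
    have h6 := mul_le_mul_of_nonneg_left hy (abs_nonneg (y - 1))
    linarith
  exact abs_le.2 ⟨by linarith, by linarith [le_abs_self (y - 1), abs_nonneg (y - 1)]⟩

/-- The logarithm of a nonvanishing continuous function with a limit of modulus one at rate
`1/|x|` decays like `1/|x|`. -/
theorem exists_abs_log_norm_le {a : ℝ → ℂ} (ha : Continuous a) (h0 : ∀ x, a x ≠ 0) {e : ℂ}
    (he : ‖e‖ = 1) {C : ℝ} (hC : 0 ≤ C) (h : ∀ x : ℝ, 1 ≤ |x| → ‖a x - e‖ ≤ C / |x|) :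
    ∃ K : ℝ, 0 ≤ K ∧ ∀ x, |Real.log ‖a x‖| ≤ K / (1 + |x|) := by
  -- Beyond $R$ the modulus is within $1/2$ of 1 and the linear bound on the logarithm applies; on
  -- $[-R,R]$ compactness suffices.
  set R := max 1 (2 * C)
  have hR1 : 1 ≤ R := le_max_left _ _
  have hcont : Continuous fun x => Real.log ‖a x‖ := ha.norm.log fun x => norm_ne_zero_iff.2 (h0 x)
  obtain ⟨B, hB⟩ := (isCompact_Icc (a := -R) (b := R)).exists_bound_of_continuousOn
    hcont.continuousOn
  have hB0 : 0 ≤ B := (norm_nonneg _).trans (hB 0 ⟨by linarith, by linarith⟩)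
  refine ⟨B * (1 + R) + 4 * C, by positivity, fun x => ?_⟩
  rw [le_div_iff₀ (by positivity)]
  rcases le_or_gt |x| R with hx | hx
  · have h1 := hB x (abs_le.1 hx)
    rw [Real.norm_eq_abs] at h1
    calc |Real.log ‖a x‖| * (1 + |x|) ≤ B * (1 + R) := by gcongr
      _ ≤ _ := by linarith
  · have hx1 : 1 ≤ |x| := by linarith
    have hx0 : 0 < |x| := by linarith
    have h1 : |‖a x‖ - 1| ≤ C / |x| := by
      rw [← he]
      exact (abs_norm_sub_norm_le _ _).trans (h x hx1)
    have h2 : C / |x| ≤ 1 / 2 := by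
      rw [div_le_iff₀ hx0]
      linarith [le_max_right 1 (2 * C)]
    have h3 := abs_log_le (y := ‖a x‖) (by linarith [neg_abs_le (‖a x‖ - 1)])
    calc |Real.log ‖a x‖| * (1 + |x|) ≤ 2 * (C / |x|) * (1 + |x|) := by gcongr; linarith
      _ ≤ 2 * (C / |x|) * (2 * |x|) := by gcongr; linarith
      _ = 4 * C := by field_simp; ring
      _ ≤ _ := by linarith [mul_nonneg hB0 (by linarith : 0 ≤ 1 + R)]

theorem integrable_of_norm_le_inv_one_add_sq {f : ℝ → ℂ} (hf : Continuous f) {C : ℝ}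
    (h : ∀ x, ‖f x‖ ≤ C / (1 + x ^ 2)) : Integrable f := by
  refine (integrable_inv_one_add_sq.const_mul C).mono' hf.aestronglyMeasurable
    (Eventually.of_forall fun x => ?_)
  rw [← div_eq_mul_inv]
  exact h x

variable {L : ℝ → ℝ} {K : ℝ}

/-- The density of the trace formula is integrable along each ray of the contour. -/
theorem integrable_ray {c z : ℂ} {ε δ : ℝ} (hL : Continuous L) (hK : 0 ≤ K)
    (hLK : ∀ x, |L x| ≤ K / (1 + |x|)) (hε : |ε| = 1) (hδ : 0 < δ)
    (hcz : ∀ r : ℝ, δ ≤ ‖c * r - z‖) :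
    Integrable fun r : ℝ => (L (ε * r ^ 2) : ℂ) / (c * r - z) := by
  have hne : ∀ r : ℝ, c * r - z ≠ 0 := fun r => norm_pos_iff.1 (hδ.trans_le (hcz r))
  refine integrable_of_norm_le_inv_one_add_sq (C := K / δ)
    ((Complex.continuous_ofReal.comp (hL.comp (by fun_prop))).div (by fun_prop) hne) fun r => ?_
  have h1 := hLK (ε * r ^ 2)
  rw [abs_mul, hε, one_mul, abs_of_nonneg (sq_nonneg r)] at h1
  rw [norm_div, Complex.norm_real, Real.norm_eq_abs]
  calc |L (ε * r ^ 2)| / ‖c * r - z‖ ≤ K / (1 + r ^ 2) / δ := by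
        gcongr
        exact hcz r
    _ = K / δ / (1 + r ^ 2) := div_right_comm _ _ _

/-- Density and kernel each decay like $1/|x|$, so the product is dominated by $1/(1+x^2)$. -/
theorem integrable_cauchy {w : ℂ} (hL : Continuous L) (hK : 0 ≤ K)
    (hLK : ∀ x, |L x| ≤ K / (1 + |x|)) (hw : w.im ≠ 0) :
    Integrable fun x : ℝ => (L x : ℂ) / (x - w) := by
  have him : ∀ x : ℝ, |w.im| ≤ ‖(x : ℂ) - w‖ := fun x => by
    have := Complex.abs_im_le_norm ((x : ℂ) - w)
    simpa using this
  have hpos : 0 < |w.im| := abs_pos.2 hw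
  have hne : ∀ x : ℝ, (x : ℂ) - w ≠ 0 := fun x => norm_pos_iff.1 (hpos.trans_le (him x))
  -- Chosen so that $1+|x|\le D|x-w|$: $|x|\le|x-w|+\|w\|$, and $1+\|w\|$ is absorbed using
  -- $|x-w|\ge|\mathrm{Im}\,w|$.
  set D := 1 + (1 + ‖w‖) / |w.im| with hD
  have hD0 : 0 < D := by positivity
  have hlow : ∀ x : ℝ, (1 + |x|) / D ≤ ‖(x : ℂ) - w‖ := fun x => by
    rw [div_le_iff₀ hD0, hD]
    have h1 : |x| ≤ ‖(x : ℂ) - w‖ + ‖w‖ := by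
      have := norm_add_le ((x : ℂ) - w) w
      rwa [sub_add_cancel, Complex.norm_real, Real.norm_eq_abs] at this
    have h2 : 1 + ‖w‖ ≤ ‖(x : ℂ) - w‖ * ((1 + ‖w‖) / |w.im|) := by
      rw [← mul_div_assoc, le_div_iff₀ hpos, mul_comm]
      gcongr
      exact him x
    linarith
  refine integrable_of_norm_le_inv_one_add_sq (C := K * D)
    ((Complex.continuous_ofReal.comp hL).div (by fun_prop) hne) fun x => ?_
  rw [norm_div, Complex.norm_real, Real.norm_eq_abs]
  calc |L x| / ‖(x : ℂ) - w‖ ≤ K / (1 + |x|) / ((1 + |x|) / D) := by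
        gcongr
        · exact hLK x
        · exact hlow x
    _ = K * D / ((1 + |x|) * (1 + |x|)) := by field_simp
    _ ≤ K * D / (1 + x ^ 2) := by
        gcongr
        nlinarith [abs_nonneg x, sq_abs x]

theorem integral_two_mul_comp_sq (g : ℝ → ℂ) :
    ∫ r in Ioi (0 : ℝ), (2 * r : ℂ) * g (r ^ 2) = ∫ x in Ioi (0 : ℝ), g x := by
  rw [← integral_comp_rpow_Ioi_of_pos (g := g) two_pos]
  refine setIntegral_congr_fun measurableSet_Ioi fun r _ => ?_
  simp only [Real.rpow_two]
  rw [Complex.real_smul]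
  norm_num

end RealIntegrals

/-! ### From the contour to the real line -/

section Contour

theorem ofReal_mem_contour (r : ℝ) : (r : ℂ) ∈ contour := Or.inl (by simp)

theorem I_mul_ofReal_mem_contour (r : ℝ) : Complex.I * (r : ℂ) ∈ contour := Or.inr (by simp)

theorem neg_mem_contour {k : ℂ} (hk : k ∈ contour) : -k ∈ contour := by
  rcases hk with h | h
  · exact Or.inl (by simp [h])
  · exact Or.inr (by simp [h])

theorem exists_mem_contour_sq_eq (x : ℝ) : ∃ ζ ∈ contour, ζ ^ 2 = (x : ℂ) := by
  rcases le_total 0 x with hx | hx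
  · refine ⟨(Real.sqrt x : ℝ), ofReal_mem_contour _, ?_⟩
    rw [← Complex.ofReal_pow, Real.sq_sqrt hx]
  · refine ⟨Complex.I * (Real.sqrt (-x) : ℝ), I_mul_ofReal_mem_contour _, ?_⟩
    rw [mul_pow, ← Complex.ofReal_pow, Real.sq_sqrt (by linarith), Complex.I_sq]
    simp

/-- A contour integral with a density depending on `ζ²` only, as an integral over the line. -/
theorem contourIntegral_eq {f : ℂ → ℂ} {L : ℝ → ℝ} {K : ℝ} {z : ℂ} (hL : Continuous L)
    (hK : 0 ≤ K) (hLK : ∀ x, |L x| ≤ K / (1 + |x|)) (hz : z.re * z.im ≠ 0)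
    (hf : ∀ ζ ∈ contour, f ζ = (L (ζ ^ 2).re : ℂ) / (ζ - z)) :
    ContourIntegrable f ∧ contourIntegral f = ∫ x : ℝ, (L x : ℂ) / (x - z ^ 2) := by
  have hre : z.re ≠ 0 := left_ne_zero_of_mul hz
  have him : z.im ≠ 0 := right_ne_zero_of_mul hz
  have hsq : (z ^ 2).im ≠ 0 := by
    rw [sq, Complex.mul_im]
    intro h
    exact hz (by linarith)
  have f₁ : (fun r : ℝ => f r) = fun r : ℝ => (L (1 * r ^ 2) : ℂ) / (1 * r - z) := by
    funext r
    rw [hf _ (ofReal_mem_contour r), ← Complex.ofReal_pow, Complex.ofReal_re, one_mul, one_mul]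
  have f₂ : (fun r : ℝ => f (Complex.I * r)) =
      fun r : ℝ => (L (-1 * r ^ 2) : ℂ) / (Complex.I * r - z) := by
    funext r
    rw [hf _ (I_mul_ofReal_mem_contour r), mul_pow, Complex.I_sq]
    norm_cast
  have f₃ : (fun r : ℝ => f (-r)) = fun r : ℝ => (L (1 * r ^ 2) : ℂ) / ((-1) * r - z) := by
    funext r
    rw [hf _ (neg_mem_contour (ofReal_mem_contour r)), neg_sq, ← Complex.ofReal_pow,
      Complex.ofReal_re, one_mul, neg_one_mul]
  have f₄ : (fun r : ℝ => f (-(Complex.I * r))) =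
      fun r : ℝ => (L (-1 * r ^ 2) : ℂ) / ((-Complex.I) * r - z) := by
    funext r
    have hr : (-(Complex.I * (r : ℂ))) ^ 2 = ((-1 * r ^ 2 : ℝ) : ℂ) := by
      rw [neg_sq, mul_pow, Complex.I_sq]
      push_cast
      ring
    rw [hf _ (neg_mem_contour (I_mul_ofReal_mem_contour r)), hr, Complex.ofReal_re, neg_mul Complex.I]
  have i₁ : Integrable fun r : ℝ => (L (1 * r ^ 2) : ℂ) / (1 * r - z) :=
    integrable_ray hL hK hLK (by simp) (abs_pos.2 him) fun r => by
      simpa using Complex.abs_im_le_norm ((1 : ℂ) * r - z)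
  have i₂ : Integrable fun r : ℝ => (L (-1 * r ^ 2) : ℂ) / (Complex.I * r - z) :=
    integrable_ray hL hK hLK (by simp) (abs_pos.2 hre) fun r => by
      simpa using Complex.abs_re_le_norm (Complex.I * r - z)
  have i₃ : Integrable fun r : ℝ => (L (1 * r ^ 2) : ℂ) / ((-1) * r - z) :=
    integrable_ray hL hK hLK (by simp) (abs_pos.2 him) fun r => by
      simpa using Complex.abs_im_le_norm ((-1 : ℂ) * r - z)
  have i₄ : Integrable fun r : ℝ => (L (-1 * r ^ 2) : ℂ) / ((-Complex.I) * r - z) :=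
    integrable_ray hL hK hLK (by simp) (abs_pos.2 hre) fun r => by
      simpa using Complex.abs_re_le_norm ((-Complex.I) * r - z)
  have n₁ : ∀ r : ℝ, (r : ℂ) - z ≠ 0 := fun r h => him (by simpa using congrArg Complex.im h)
  have n₂ : ∀ r : ℝ, (r : ℂ) + z ≠ 0 := fun r h => him (by simpa using congrArg Complex.im h)
  have n₃ : ∀ r : ℝ, Complex.I * r - z ≠ 0 := fun r h => hre (by simpa using congrArg Complex.re h)
  have n₄ : ∀ r : ℝ, Complex.I * r + z ≠ 0 := fun r h => hre (by simpa using congrArg Complex.re h)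
  refine ⟨⟨f₁ ▸ i₁.integrableOn, f₂ ▸ i₂.integrableOn, f₃ ▸ i₃.integrableOn,
    f₄ ▸ i₄.integrableOn⟩, ?_⟩
  have hg := integrable_cauchy hL hK hLK hsq
  have hsplit : ∫ x : ℝ, (L x : ℂ) / (x - z ^ 2) = (∫ x in Ioi (0 : ℝ), (L x : ℂ) / (x - z ^ 2)) +
      ∫ x in Ioi (0 : ℝ), (L (-x) : ℂ) / (((-x : ℝ) : ℂ) - z ^ 2) := by
    have := integral_comp_neg_Ioi (0 : ℝ) fun x : ℝ => (L x : ℂ) / (x - z ^ 2)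
    rw [this, neg_zero, add_comm]
    exact (intervalIntegral.integral_Iic_add_Ioi hg.integrableOn hg.integrableOn).symm
  rw [hsplit, ← integral_two_mul_comp_sq fun x : ℝ => (L x : ℂ) / (x - z ^ 2),
    ← integral_two_mul_comp_sq fun x : ℝ => (L (-x) : ℂ) / (((-x : ℝ) : ℂ) - z ^ 2)]
  -- Opposite rays combine by $\frac1{r-z}+\frac1{r+z}=\frac{2r}{r^2-z^2}$; the factor $2r$ is the
  -- Jacobian of $x=r^2$.
  have hA : (∫ r in Ioi (0 : ℝ), f r) - (∫ r in Ioi (0 : ℝ), f (-r)) =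
      ∫ r in Ioi (0 : ℝ), (2 * r : ℂ) * ((L (r ^ 2) : ℂ) / (((r ^ 2 : ℝ) : ℂ) - z ^ 2)) := by
    rw [f₁, f₃, ← integral_sub i₁.integrableOn i₃.integrableOn]
    refine integral_congr_ae (Eventually.of_forall fun r => ?_)
    have e1 := n₁ r
    have e2 := n₂ r
    have e3 : (-1 : ℂ) * r - z = -(r + z) := by ring
    have e4 : ((r ^ 2 : ℝ) : ℂ) - z ^ 2 = (r - z) * (r + z) := by push_cast; ring
    simp only [one_mul]
    rw [e3, e4]
    field_simp
    ring
  -- The same on the imaginary axis, where $\zeta^2=-r^2$: the orientation factor $-i$ and the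
  -- numerator $2ir$ again make $2r$, now covering the negative half-line.
  have hB : -Complex.I * ((∫ r in Ioi (0 : ℝ), f (Complex.I * r)) -
      ∫ r in Ioi (0 : ℝ), f (-(Complex.I * r))) =
      ∫ r in Ioi (0 : ℝ), (2 * r : ℂ) * ((L (-(r ^ 2)) : ℂ) / (((-(r ^ 2) : ℝ) : ℂ) - z ^ 2)) := by
    rw [f₂, f₄, ← integral_sub i₂.integrableOn i₄.integrableOn, ← integral_const_mul]
    refine integral_congr_ae (Eventually.of_forall fun r => ?_)
    have e1 := n₃ r
    have e2 := n₄ r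
    have e3 : -Complex.I * r - z = -(Complex.I * r + z) := by ring
    have e4 : ((-(r ^ 2) : ℝ) : ℂ) - z ^ 2 = (Complex.I * r - z) * (Complex.I * r + z) := by
      push_cast
      linear_combination (-(r : ℂ) ^ 2) * Complex.I_sq
    simp only [neg_one_mul]
    rw [e3, e4]
    field_simp
    linear_combination (-2 * (r : ℂ) * (L (-r ^ 2) : ℂ)) * Complex.I_sq
  rw [← hA, ← hB, contourIntegral]
  ring

end Contour

/-! ### Blaschke factorisation and the phase constraint -/

section TraceFormula

/-- Every point of the upper half-plane has a square root in the open first quadrant, where the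
zeros of $s_{11}$ are listed. -/
theorem exists_sq_eq_of_im_pos {w : ℂ} (hw : 0 < w.im) :
    ∃ k : ℂ, 0 < k.re ∧ 0 < k.im ∧ k ^ 2 = w := by
  obtain ⟨k, hk⟩ := IsAlgClosed.exists_pow_nat_eq w (n := 2) two_pos
  have him : 0 < k.re * k.im := by
    have := congrArg Complex.im hk
    rw [sq, Complex.mul_im] at this
    linarith
  rcases pos_and_pos_or_neg_and_neg_of_mul_pos him with h | h
  · exact ⟨k, h.1, h.2, hk⟩
  · exact ⟨-k, by simpa using h.1, by simpa using h.2, by rw [neg_sq, hk]⟩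

theorem norm_div_sub_conj (x : ℝ) {l : ℂ} (hl : 0 < l.im) :
    ‖((x : ℂ) - l) / ((x : ℂ) - (starRingEnd ℂ) l)‖ = 1 := by
  have h : (x : ℂ) - (starRingEnd ℂ) l = (starRingEnd ℂ) ((x : ℂ) - l) := by simp
  rw [norm_div, h, RCLike.norm_conj, div_self]
  rw [norm_ne_zero_iff]
  intro h0
  have := congrArg Complex.im h0
  simp at this
  exact hl.ne' this

variable {N : ℕ} {A : ℂ → ℂ} {l : Fin N → ℂ} {v C : ℝ}

/-- Dividing a function with double zeros in the upper half-plane by the corresponding Blaschke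
product gives a zero-free function with the same modulus on the real line. -/
theorem exists_zero_free (hc : ContinuousOn A {z | 0 ≤ z.im})
    (hd : DifferentiableOn ℂ A {z | 0 < z.im}) (hl : Function.Injective l)
    (hpos : ∀ n, 0 < (l n).im) (hord : ∀ n, analyticOrderAt A (l n) = 2)
    (hzero : ∀ w : ℂ, 0 ≤ w.im → A w = 0 → ∃ n, l n = w)
    (has : ∀ w : ℂ, 0 ≤ w.im → 1 ≤ ‖w‖ → ‖A w - Complex.exp (-(Complex.I * v))‖ ≤ C / ‖w‖) :
    ∃ F : ℂ → ℂ, ContinuousOn F {z | 0 ≤ z.im} ∧ DifferentiableOn ℂ F {z | 0 < z.im} ∧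
      (∀ z : ℂ, 0 ≤ z.im → F z ≠ 0) ∧ Tendsto F upperInfty (𝓝 1) ∧
      ∀ w : ℂ, 0 ≤ w.im → A w =
        F w * (∏ n, ((w - l n) / (w - (starRingEnd ℂ) (l n))) ^ 2) *
          Complex.exp (-(Complex.I * v)) := by
  obtain ⟨b, hbc, hbd, hb, hb0⟩ := exists_eq_prod_mul hc hd hl Finset.univ (fun n _ => hpos n)
    (fun n _ => hord n)
  have hne : ∀ w : ℂ, 0 ≤ w.im → ∀ n, w - (starRingEnd ℂ) (l n) ≠ 0 := fun w hw n =>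
    sub_conj_ne_zero (hpos n) hw
  have hexp : Complex.exp (Complex.I * v) * Complex.exp (-(Complex.I * v)) = 1 := by
    rw [← Complex.exp_add, add_neg_cancel, Complex.exp_zero]
  -- Multiplying the zero-free quotient by the conjugate factors restores the modulus on the real
  -- line; $e^{iv}$ moves the limit at infinity to 1.
  set F : ℂ → ℂ := fun w =>
    b w * (∏ n, (w - (starRingEnd ℂ) (l n)) ^ 2) * Complex.exp (Complex.I * v) with hF
  have hfac : ∀ w : ℂ, 0 ≤ w.im → A w =
      F w * (∏ n, ((w - l n) / (w - (starRingEnd ℂ) (l n))) ^ 2) *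
        Complex.exp (-(Complex.I * v)) := by
    intro w hw
    have hp : (∏ n, (w - (starRingEnd ℂ) (l n)) ^ 2) ≠ 0 :=
      Finset.prod_ne_zero_iff.2 fun n _ => pow_ne_zero 2 (hne w hw n)
    simp only [hF, div_pow, Finset.prod_div_distrib]
    rw [hb w]
    field_simp
    linear_combination (-((∏ n, (w - l n) ^ 2) * b w)) * hexp
  refine ⟨F, ?_, ?_, ?_, ?_, hfac⟩
  · exact (hbc.mul (by fun_prop)).mul continuousOn_const
  · exact (hbd.mul (by fun_prop)).mul (differentiableOn_const _)
  · intro w hw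
    refine mul_ne_zero (mul_ne_zero (fun h0 => ?_) (Finset.prod_ne_zero_iff.2 fun n _ =>
      pow_ne_zero 2 (hne w hw n))) (Complex.exp_ne_zero _)
    obtain ⟨n, rfl⟩ := hzero w hw (by rw [hb, h0, mul_zero])
    exact hb0 n (Finset.mem_univ n) h0
  · have hA : Tendsto A upperInfty (𝓝 (Complex.exp (-(Complex.I * v)))) := by
      rw [tendsto_iff_norm_sub_tendsto_zero]
      refine squeeze_zero' (Eventually.of_forall fun _ => norm_nonneg _) ?_
        (tendsto_norm_upperInfty.const_div_atTop C)
      filter_upwards [tendsto_norm_upperInfty.eventually_ge_atTop 1,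
        eventually_upperInfty_im_nonneg] with w h1 h2 using has w h2 h1
    have hfrac : ∀ n, Tendsto (fun w => (w - (starRingEnd ℂ) (l n)) / (w - l n)) upperInfty
        (𝓝 1) := by
      intro n
      have h := (tendsto_div_sub_upperInfty (l n)).sub
        ((tendsto_inv_sub_upperInfty (l n)).const_mul ((starRingEnd ℂ) (l n)))
      rw [mul_zero, sub_zero] at h
      refine h.congr fun w => ?_
      rw [sub_div, div_eq_mul_inv ((starRingEnd ℂ) (l n))]
    have hprod : Tendsto (fun w => ∏ n, ((w - (starRingEnd ℂ) (l n)) / (w - l n)) ^ 2) upperInfty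
        (𝓝 1) := by
      have := tendsto_finsetProd (Finset.univ : Finset (Fin N)) fun n _ => (hfrac n).pow 2
      simpa using this
    have hlim := (hA.mul hprod).mul_const (Complex.exp (Complex.I * v))
    rw [mul_one, mul_comm (Complex.exp _), hexp] at hlim
    refine hlim.congr' ?_
    have hlarge : ∀ᶠ w : ℂ in upperInfty, ∀ n, w - l n ≠ 0 := by
      rw [eventually_all]
      intro n
      filter_upwards [tendsto_norm_upperInfty.eventually_gt_atTop ‖l n‖] with w hw
      exact sub_ne_zero.2 fun h => by rw [h] at hw; exact lt_irrefl _ hw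
    filter_upwards [hlarge] with w hw
    have hp : (∏ n, (w - l n) ^ 2) ≠ 0 :=
      Finset.prod_ne_zero_iff.2 fun n _ => pow_ne_zero 2 (hw n)
    simp only [hF, div_pow, Finset.prod_div_distrib]
    rw [hb w]
    field_simp

theorem norm_eq_of_factor {F : ℂ → ℂ} (hpos : ∀ n, 0 < (l n).im)
    (h : ∀ w : ℂ, 0 ≤ w.im → A w =
        F w * (∏ n, ((w - l n) / (w - (starRingEnd ℂ) (l n))) ^ 2) *
          Complex.exp (-(Complex.I * v))) (x : ℝ) : ‖F x‖ = ‖A x‖ := by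
  rw [h x (by simp), norm_mul, norm_mul, norm_prod]
  simp only [norm_pow, norm_div_sub_conj x (hpos _), one_pow, Finset.prod_const_one, mul_one]
  rw [Complex.norm_exp]
  simp

/-- With $|A|=1$ on the line the Schwarz formula has zero density, so $F\equiv1$ and $A$ is the
Blaschke product times $e^{-iv}$; evaluation at the origin gives the identity. -/
theorem exp_eq_of_unimodular {F : ℂ → ℂ} (hpos : ∀ n, 0 < (l n).im)
    (hFc : ContinuousOn F {z | 0 ≤ z.im}) (hFd : DifferentiableOn ℂ F {z | 0 < z.im})
    (hF0 : ∀ z : ℂ, 0 ≤ z.im → F z ≠ 0) (hFl : Tendsto F upperInfty (𝓝 1))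
    (hF : ∀ w : ℂ, 0 ≤ w.im → A w =
        F w * (∏ n, ((w - l n) / (w - (starRingEnd ℂ) (l n))) ^ 2) *
          Complex.exp (-(Complex.I * v)))
    (hA0 : A 0 = 1) (hlog : ∀ x : ℝ, Real.log ‖A x‖ = 0) :
    Complex.exp (Complex.I * v) = ∏ n, (l n / (starRingEnd ℂ) (l n)) ^ 2 := by
  have h1 : ∀ w : ℂ, 0 < w.im → F w = 1 := by
    intro w hw
    have hz : ∀ x : ℝ, ((2 * Real.log ‖F x‖ : ℝ) : ℂ) / ((x : ℂ) - w) = 0 := fun x => by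
      rw [norm_eq_of_factor hpos hF, hlog]
      simp
    rw [eq_exp_integral_log_norm hFc hFd hF0 hFl hw (by simp only [hz]; exact integrable_zero _ _ _)]
    simp only [hz]
    simp
  -- The representation holds only in the open half-plane; the origin is reached by continuity along
  -- $i\varepsilon$.
  have h2 : F 0 = 1 := by
    have hseq : Tendsto (fun ε : ℝ => (ε : ℂ) * Complex.I) (𝓝[>] 0) (𝓝[{z | 0 ≤ z.im}] 0) := by
      refine tendsto_nhdsWithin_iff.2 ⟨?_, ?_⟩
      · have hcont : Continuous fun ε : ℝ => (ε : ℂ) * Complex.I := by fun_prop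
        have := (hcont.tendsto 0).mono_left (nhdsWithin_le_nhds (s := Ioi 0))
        simpa using this
      · filter_upwards [self_mem_nhdsWithin] with ε hε
        simpa using le_of_lt (mem_Ioi.1 hε)
    have h3 := (hFc 0 (by simp)).tendsto.comp hseq
    refine tendsto_nhds_unique h3 (tendsto_const_nhds.congr' ?_)
    filter_upwards [self_mem_nhdsWithin] with ε hε
    exact (h1 _ (by simpa using hε)).symm
  have h3 := hF 0 le_rfl
  rw [hA0, h2, one_mul] at h3
  have hexp : Complex.exp (Complex.I * v) * Complex.exp (-(Complex.I * v)) = 1 := by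
    rw [← Complex.exp_add, add_neg_cancel, Complex.exp_zero]
  simp only [zero_sub, neg_div_neg_eq] at h3
  linear_combination Complex.exp (Complex.I * v) * h3 +
    (∏ n, (l n / (starRingEnd ℂ) (l n)) ^ 2) * hexp

theorem div_conj_eq_exp {z : ℂ} (hz : z ≠ 0) :
    z / (starRingEnd ℂ) z = Complex.exp (2 * Complex.arg z * Complex.I) := by
  have h := Complex.norm_mul_exp_arg_mul_I z
  have hn : (‖z‖ : ℂ) ≠ 0 := by simpa using hz
  have hc : (starRingEnd ℂ) z = ‖z‖ * Complex.exp (-(Complex.arg z * Complex.I)) := by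
    conv_lhs => rw [← h]
    rw [map_mul, ← Complex.exp_conj]
    simp
  rw [hc]
  nth_rewrite 1 [← h]
  rw [mul_div_mul_left _ _ hn, ← Complex.exp_sub]
  ring_nf

theorem sq_injective_on_quadrant {k : Fin N → ℂ} (hk : Function.Injective k)
    (hre : ∀ n, 0 < (k n).re) : Function.Injective fun n => k n ^ 2 := by
  intro m n h
  rcases sq_eq_sq_iff_eq_or_eq_neg.1 h with h | h
  · exact hk h
  · have h1 := congrArg Complex.re h
    rw [Complex.neg_re] at h1
    linarith [hre m, hre n]

/-- The zeros come in pairs $\pm k_n$, and $(z-k_n)(z+k_n)=z^2-k_n^2$. -/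
theorem prod_eta_eq (k : Fin N → ℂ) (z : ℂ) :
    ∏ n, ((z - eta k n) / (z - (starRingEnd ℂ) (eta k n))) ^ 2 =
      ∏ n, ((z ^ 2 - k n ^ 2) / (z ^ 2 - (starRingEnd ℂ) (k n ^ 2))) ^ 2 := by
  rw [Fin.prod_univ_add, ← Finset.prod_mul_distrib]
  refine Finset.prod_congr rfl fun n _ => ?_
  simp only [eta, Fin.append_left, Fin.append_right]
  rw [← mul_pow, div_mul_div_comm, map_neg, map_pow]
  ring_nf

end TraceFormula

end DNLS

end

/-! ### The main theorem -/

theorem mainTheorem7 (q : ℝ → ℝ → ℂ) (t : ℝ)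
    (hq : ContDiff ℝ 1 (fun x : ℝ => q x t))
    (hq_int : Integrable (fun x : ℝ => q x t) volume)
    (hqx_int : Integrable (deriv fun x : ℝ => q x t) volume)
    -- no spectral singularities
    (hsing : ∀ ζ ∈ DNLS.contour, DNLS.scatteringMatrix q t ζ 0 0 ≠ 0)
    -- the zeros of `s₁₁` in the open first quadrant are `k₁, …, k_N`, all of them double
    (N : ℕ) (k : Fin N → ℂ) (hk_inj : Function.Injective k)
    (hk : ∀ z : ℂ, (0 < z.re ∧ 0 < z.im ∧ DNLS.s11 q t z = 0) ↔ ∃ n, k n = z)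
    (hk_double : ∀ n, deriv (DNLS.s11 q t) (k n) = 0 ∧
      iteratedDeriv 2 (DNLS.s11 q t) (k n) ≠ 0) :
    -- `s₁₁`, `s₂₂` are the continuations of the diagonal entries of `S` from `Σ` to `D⁺`, `D⁻`
    (ContinuousOn (DNLS.s11 q t) (DNLS.Dplus ∪ DNLS.contour) ∧
      AnalyticOnNhd ℂ (DNLS.s11 q t) DNLS.Dplus ∧
      ∀ ζ ∈ DNLS.contour, DNLS.s11 q t ζ = DNLS.scatteringMatrix q t ζ 0 0) ∧
    (ContinuousOn (DNLS.s22 q t) (DNLS.Dminus ∪ DNLS.contour) ∧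
      AnalyticOnNhd ℂ (DNLS.s22 q t) DNLS.Dminus ∧
      ∀ ζ ∈ DNLS.contour, DNLS.s22 q t ζ = DNLS.scatteringMatrix q t ζ 1 1) ∧
    -- the trace formula
    (∀ z ∈ DNLS.Dplus, DNLS.ContourIntegrable (DNLS.traceIntegrand q t z) ∧
      DNLS.s11 q t z =
        Complex.exp (-(1 / (2 * Real.pi * Complex.I)) *
            DNLS.contourIntegral (DNLS.traceIntegrand q t z)) *
          (∏ n, ((z - DNLS.eta k n) / (z - (starRingEnd ℂ) (DNLS.eta k n))) ^ 2) *
          Complex.exp (-(Complex.I * DNLS.v0 q t))) ∧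
    (∀ z ∈ DNLS.Dminus, DNLS.ContourIntegrable (DNLS.traceIntegrand q t z) ∧
      DNLS.s22 q t z =
        Complex.exp ((1 / (2 * Real.pi * Complex.I)) *
            DNLS.contourIntegral (DNLS.traceIntegrand q t z)) *
          (∏ n, ((z - (starRingEnd ℂ) (DNLS.eta k n)) / (z - DNLS.eta k n)) ^ 2) *
          Complex.exp (Complex.I * DNLS.v0 q t)) ∧
    -- the value at the origin and the constraint on reflectionless potentials
    DNLS.s11 q t 0 = 1 ∧
    (DNLS.IsReflectionless q t →
      ∃ j : ℤ, DNLS.v0 q t = 8 * (∑ n, Complex.arg (k n)) + 2 * j * Real.pi) := by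
  classical
  set A : ℂ → ℂ := DNLS.transmission fun x => q x t with hA
  have hc := hq.continuous
  have hM : ∀ x, ‖q x t‖ ≤ ∫ y, ‖deriv (fun x => q x t) y‖ :=
    DNLS.norm_le_integral_norm_deriv hq hq_int hqx_int
  have hAc : ContinuousOn A {z | 0 ≤ z.im} := DNLS.continuousOn_transmission hc hq_int
  have hAd : DifferentiableOn ℂ A {z | 0 < z.im} := DNLS.differentiableOn_transmission hc hq_int
  have h11 : ∀ z : ℂ, 0 ≤ (z ^ 2).im → DNLS.s11 q t z = A (z ^ 2) := fun z hz =>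
    DNLS.s11_eq_transmission hc hq_int hM hz
  have h22 : ∀ z : ℂ, (z ^ 2).im ≤ 0 →
      DNLS.s22 q t z = (starRingEnd ℂ) (A ((starRingEnd ℂ) (z ^ 2))) := fun z hz =>
    DNLS.s22_eq_conj_transmission hc hq_int hM hz
  have hsq : ∀ z : ℂ, (z ^ 2).im = 2 * (z.re * z.im) := fun z => by
    rw [sq, Complex.mul_im]; ring
  have hspec := fun ζ hζ => DNLS.scatteringMatrix_spec (k := ζ) hc hq_int hM hζ
  have hcontour : ∀ ζ ∈ DNLS.contour, (ζ ^ 2).im = 0 := fun ζ hζ =>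
    DNLS.sq_im_eq_zero_of_mem_contour hζ
  have hplus : ∀ z ∈ DNLS.Dplus, 0 < (z ^ 2).im := fun z hz => by
    rw [hsq]; exact mul_pos two_pos hz
  have hminus : ∀ z ∈ DNLS.Dminus, (z ^ 2).im < 0 := fun z hz => by
    rw [hsq]; exact mul_neg_of_pos_of_neg two_pos hz
  have hplusOpen : IsOpen DNLS.Dplus :=
    isOpen_lt continuous_const (Complex.continuous_re.mul Complex.continuous_im)
  have hminusOpen : IsOpen DNLS.Dminus :=
    isOpen_lt (Complex.continuous_re.mul Complex.continuous_im) continuous_const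
  have hplus' : ∀ z ∈ DNLS.Dplus ∪ DNLS.contour, 0 ≤ (z ^ 2).im := fun z hz =>
    hz.elim (fun h => (hplus z h).le) fun h => (hcontour z h).ge
  have hminus' : ∀ z ∈ DNLS.Dminus ∪ DNLS.contour, (z ^ 2).im ≤ 0 := fun z hz =>
    hz.elim (fun h => (hminus z h).le) fun h => (hcontour z h).le
  have han11 : AnalyticOnNhd ℂ (DNLS.s11 q t) DNLS.Dplus := by
    refine DifferentiableOn.analyticOnNhd ?_ hplusOpen
    refine DifferentiableOn.congr ?_ fun z hz => h11 z (hplus z hz).le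
    exact hAd.comp (by fun_prop) hplus
  have hreal : ∀ x : ℝ, A x ≠ 0 := by
    intro x
    obtain ⟨ζ, hζ, hζx⟩ := DNLS.exists_mem_contour_sq_eq x
    have := hsing ζ hζ
    rwa [(hspec ζ hζ).1, h11 ζ (hcontour ζ hζ).ge, hζx] at this
  have hkq : ∀ n, 0 < (k n).re ∧ 0 < (k n).im ∧ DNLS.s11 q t (k n) = 0 := fun n =>
    (hk (k n)).2 ⟨n, rfl⟩
  have hkD : ∀ n, k n ∈ DNLS.Dplus := fun n => mul_pos (hkq n).1 (hkq n).2.1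
  have hpos : ∀ n, 0 < (k n ^ 2).im := fun n => hplus _ (hkD n)
  have hlinj : Function.Injective fun n => k n ^ 2 :=
    DNLS.sq_injective_on_quadrant hk_inj fun n => (hkq n).1
  -- The double zero of $s_{11}$ passes to $A$ because $z\mapsto z^2$ has nonzero derivative at
  -- $k_n\ne0$.
  have hord : ∀ n, analyticOrderAt A (k n ^ 2) = 2 := by
    intro n
    have h1 : analyticOrderAt (DNLS.s11 q t) (k n) = (2 : ℕ) := by
      refine (analyticOrderAt_eq_nat_iff_iteratedDeriv_eq_zero (han11 _ (hkD n))).2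
        ⟨fun i hi => ?_, (hk_double n).2⟩
      interval_cases i
      · simpa using (hkq n).2.2
      · simpa using (hk_double n).1
    have h2 : DNLS.s11 q t =ᶠ[𝓝 (k n)] A ∘ fun z => z ^ 2 := by
      filter_upwards [hplusOpen.mem_nhds (hkD n)] with z hz using h11 z (hplus z hz).le
    rw [analyticOrderAt_congr h2, analyticOrderAt_comp_of_deriv_ne_zero (by fun_prop)] at h1
    · exact_mod_cast h1
    · have hne : k n ≠ 0 := fun h => by
        have := (hkq n).1
        rw [h] at this
        exact lt_irrefl _ this
      simpa using hne
  -- A zero on the real line would be a spectral singularity; one above it has a square root in the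
  -- first quadrant, which must be some $k_n$.
  have hzero : ∀ w : ℂ, 0 ≤ w.im → A w = 0 → ∃ n, k n ^ 2 = w := by
    intro w hw h0
    rcases hw.eq_or_lt with hw | hw
    · have : w = (w.re : ℂ) := Complex.ext (by simp) (by simp [← hw])
      rw [this] at h0
      exact absurd h0 (hreal _)
    · obtain ⟨z, hzr, hzi, hz⟩ := DNLS.exists_sq_eq_of_im_pos hw
      obtain ⟨n, hn⟩ := (hk z).1 ⟨hzr, hzi, by
        rw [h11 z (by rw [hz]; exact hw.le), hz, h0]⟩
      exact ⟨n, by rw [hn, hz]⟩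
  obtain ⟨C, hC0, hC⟩ := DNLS.transmission_asymptotics hq hq_int hqx_int
  change ∀ w : ℂ, 0 ≤ w.im → 1 ≤ ‖w‖ →
    ‖A w - Complex.exp (-(Complex.I * DNLS.v0 q t))‖ ≤ C / ‖w‖ at hC
  obtain ⟨F, hFc, hFd, hF0, hFl, hF⟩ :=
    DNLS.exists_zero_free hAc hAd hlinj hpos hord hzero hC
  have hFn := DNLS.norm_eq_of_factor hpos hF
  have hArc : Continuous fun x : ℝ => A x :=
    hAc.comp_continuous Complex.continuous_ofReal fun x => by simp
  obtain ⟨K, hK0, hK⟩ := DNLS.exists_abs_log_norm_le hArc hreal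
    (e := Complex.exp (-(Complex.I * DNLS.v0 q t))) (by rw [Complex.norm_exp]; simp) hC0
    (fun x hx => by
      have := hC x (by simp) (by simpa using hx)
      simpa using this)
  -- This is $\log(1-\rho\tilde\rho)$ as a function of $x=\zeta^2$; its sign, opposite to that of
  -- $2\log|F|$, accounts for the minus in the exponent for $s_{11}$.
  set L : ℝ → ℝ := fun x => -(2 * Real.log ‖A x‖) with hL
  have hLc : Continuous L :=
    (continuous_const.mul (hArc.norm.log fun x => norm_ne_zero_iff.2 (hreal x))).neg
  have hLK : ∀ x, |L x| ≤ (2 * K) / (1 + |x|) := fun x => by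
    rw [hL]
    simp only
    rw [abs_neg, abs_mul, abs_two, mul_div_assoc]
    gcongr
    exact hK x
  have hdens : ∀ ζ ∈ DNLS.contour, Complex.log (1 - DNLS.rho q t ζ * DNLS.rhoTilde q t ζ) =
      (L (ζ ^ 2).re : ℂ) := fun ζ hζ => by
    rw [DNLS.log_one_sub_rho_mul hc hq_int hM hζ (hsing ζ hζ), hL]
    simp only
    rw [Complex.conj_eq_iff_re.1 (Complex.conj_eq_iff_im.2 (hcontour ζ hζ))]
  have hint : ∀ z : ℂ, z.re * z.im ≠ 0 → DNLS.ContourIntegrable (DNLS.traceIntegrand q t z) ∧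
      DNLS.contourIntegral (DNLS.traceIntegrand q t z) =
        ∫ x : ℝ, (L x : ℂ) / (x - z ^ 2) := fun z hz =>
    DNLS.contourIntegral_eq hLc (by positivity) hLK hz fun ζ hζ => by
      rw [DNLS.traceIntegrand, hdens ζ hζ]
  have htrace : ∀ z ∈ DNLS.Dplus, A (z ^ 2) =
      Complex.exp (-(1 / (2 * Real.pi * Complex.I)) * ∫ x : ℝ, (L x : ℂ) / (x - z ^ 2)) *
        (∏ n, ((z - DNLS.eta k n) / (z - (starRingEnd ℂ) (DNLS.eta k n))) ^ 2) *
          Complex.exp (-(Complex.I * DNLS.v0 q t)) := by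
    intro z hz
    have hw := hplus z hz
    have hneg : (fun x : ℝ => ((2 * Real.log ‖F x‖ : ℝ) : ℂ) / ((x : ℂ) - z ^ 2)) =
        fun x : ℝ => -((L x : ℂ) / (x - z ^ 2)) := by
      funext x
      rw [hFn, hL]
      push_cast
      ring
    have hi : Integrable fun x : ℝ => ((2 * Real.log ‖F x‖ : ℝ) : ℂ) / ((x : ℂ) - z ^ 2) := by
      rw [hneg]
      exact (DNLS.integrable_cauchy hLc (by positivity) hLK hw.ne').neg
    have h := DNLS.eq_exp_integral_log_norm hFc hFd hF0 hFl hw hi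
    rw [hneg, integral_neg, mul_neg, ← neg_mul] at h
    rw [hF _ hw.le, h, DNLS.prod_eta_eq]
  refine ⟨⟨?_, han11, fun ζ hζ => ((hspec ζ hζ).1).symm⟩,
    ⟨?_, ?_, fun ζ hζ => ((hspec ζ hζ).2.1).symm⟩, fun z hz => ?_, fun z hz => ?_, ?_, fun hr => ?_⟩
  · exact (hAc.comp (by fun_prop) hplus').congr fun z hz => h11 z (hplus' z hz)
  · refine ContinuousOn.congr ?_ fun z hz => h22 z (hminus' z hz)
    refine Complex.continuous_conj.comp_continuousOn (hAc.comp
      (Complex.continuous_conj.comp (continuous_pow 2)).continuousOn fun z hz => ?_)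
    change 0 ≤ ((starRingEnd ℂ) (z ^ 2)).im
    rw [Complex.conj_im]
    linarith [hminus' z hz]
  · refine DifferentiableOn.analyticOnNhd (fun z hz => ?_) hminusOpen
    have h1 : DifferentiableAt ℂ A ((starRingEnd ℂ) (z ^ 2)) :=
      hAd.differentiableAt (DNLS.isOpen_upper.mem_nhds (by
        change 0 < ((starRingEnd ℂ) (z ^ 2)).im
        rw [Complex.conj_im]
        linarith [hminus z hz]))
    have h2 : DifferentiableAt ℂ (fun z => (starRingEnd ℂ) (A ((starRingEnd ℂ) (z ^ 2)))) z := by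
      -- Conjugation on both sides keeps a holomorphic function holomorphic.
      have h3 : DifferentiableAt ℂ ((starRingEnd ℂ) ∘ A ∘ (starRingEnd ℂ)) (z ^ 2) := by
        rw [← Complex.conj_conj (z ^ 2)]
        exact h1.conj_conj
      exact DifferentiableAt.comp z (f := fun z : ℂ => z ^ 2) h3 (by fun_prop)
    refine (h2.congr_of_eventuallyEq ?_).differentiableWithinAt
    filter_upwards [hminusOpen.mem_nhds hz] with w hw using h22 w (hminus w hw).le
  · obtain ⟨hi1, hi2⟩ := hint z hz.ne'
    refine ⟨hi1, ?_⟩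
    rw [h11 z (hplus z hz).le, hi2]
    exact htrace z hz
  · obtain ⟨hi1, hi2⟩ := hint z hz.ne
    refine ⟨hi1, ?_⟩
    -- The formula at $\bar z$ is conjugated: the density is real, and $1/(2\pi i)$ changes sign.
    have hz' : (starRingEnd ℂ) z ∈ DNLS.Dplus := by
      have : z.re * z.im < 0 := hz
      change 0 < ((starRingEnd ℂ) z).re * ((starRingEnd ℂ) z).im
      simp
      linarith
    rw [h22 z (hminus z hz).le, hi2, map_pow, htrace _ hz']
    simp only [map_mul, map_prod, map_pow, map_div₀, map_sub, Complex.conj_conj,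
      ← Complex.exp_conj, ← integral_conj, map_neg, map_one, Complex.conj_ofReal, Complex.conj_I,
      map_ofNat]
    congr 2
    · congr 1
      congr 1
      ring
    · ring
  · rw [h11 0 (by simp)]
    simp [hA, DNLS.transmission_zero]
  · have hlog : ∀ x : ℝ, Real.log ‖A x‖ = 0 := by
      intro x
      obtain ⟨ζ, hζ, hζx⟩ := DNLS.exists_mem_contour_sq_eq x
      have h1 := hdens ζ hζ
      rw [(hr ζ hζ).1, zero_mul, sub_zero, Complex.log_one, hζx, Complex.ofReal_re] at h1
      have h2 : L x = 0 := by exact_mod_cast h1.symm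
      rw [hL] at h2
      simp only at h2
      linarith
    have h := DNLS.exp_eq_of_unimodular hpos hFc hFd hF0 hFl hF
      (by rw [hA]; exact DNLS.transmission_zero _) hlog
    -- Here $(k_n^2/\overline{k_n^2})^2=(k_n/\bar k_n)^4=e^{8i\arg k_n}$, the origin of the factor
    -- 8.
    have hprod : ∏ n, (k n ^ 2 / (starRingEnd ℂ) (k n ^ 2)) ^ 2 =
        Complex.exp (Complex.I * ((8 * ∑ n, Complex.arg (k n) : ℝ) : ℂ)) := by
      have : ∀ n, (k n ^ 2 / (starRingEnd ℂ) (k n ^ 2)) ^ 2 =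
          Complex.exp (Complex.I * (8 * Complex.arg (k n))) := by
        intro n
        have hne : k n ≠ 0 := fun h => by
          have := (hkq n).1
          rw [h] at this
          exact lt_irrefl _ this
        rw [map_pow, ← div_pow, ← pow_mul, DNLS.div_conj_eq_exp hne, ← Complex.exp_nat_mul]
        congr 1
        push_cast
        ring
      simp only [this]
      rw [← Complex.exp_sum, ← Finset.mul_sum, ← Finset.mul_sum]
      push_cast
      rfl
    rw [hprod, Complex.exp_eq_exp_iff_exists_int] at h
    obtain ⟨j, hj⟩ := h
    refine ⟨j, ?_⟩
    have h3 : Complex.I * ((DNLS.v0 q t : ℝ) : ℂ) =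
        Complex.I * ((8 * (∑ n, Complex.arg (k n)) + 2 * j * Real.pi : ℝ) : ℂ) := by
      rw [hj]
      push_cast
      ring
    exact_mod_cast mul_left_cancel₀ Complex.I_ne_zero h3
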